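/- **Theorem 3.6.** Let $-\infty<a<b<\infty$, $s_a,s_b\in\mathbb R$, $\varepsilon\in(0,(b-a)/2)$, and let $\chi_a,\chi_b\in C^\infty([a,b])$ be real-valued with $\chi_a=1$ on $[a,a+\varepsilon]$, $\chi_a=0$ on $[a+2\varepsilon,b]$, $\chi_b=1$ on $[b-\varepsilon,b]$, $\chi_b=0$ on $[a,b-2\varepsilon]$. Put $$\alpha_{s_a,s_b}=\frac{d}{dx}+\phi,\qquad \phi(x)=-\frac{s_a+\frac12}{x-a}\,\chi_a(x)+\frac{s_b+\frac12}{b-x}\,\chi_b(x),\quad x\in(a,b).$$ In the complex Hilbert space $L^2((a,b);dx)$ let $A_{max}=A_{s_a,s_b,max}$ be the operator $f\mapsto\alpha_{s_a,s_b}f$ with domain $$\operatorname{dom}(A_{max})=\mathcal D:=\{f\in L^2((a,b);dx) : f\in AC_{loc}((a,b)),\ \alpha_{s_a,s_b}f\in L^2((a,b);dx)\},$$ let $\dot A_{min}$ be its restriction to those $f\in\mathcal D$ whose support is a compact subset of $(a,b)$, and let $A_{min}=A_{s_a,s_b,min}$ be the closure of $\dot A_{min}$. Let $$H^1_0((a,b))=\{f\in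 L^2((a,b);dx): f\in AC([a,b]),\ f(a)=0=f(b),\ f'\in L^2((a,b);dx)\}.$$ For $f\in\mathcal D$, "$f(a)=0$" means $\lim_{x\downarrow a}f(x)=0$, and "$f(b)=0$" means $\lim_{x\uparrow b}f(x)=0$. Then $\dot A_{min}$ is closable, and the following hold. (i) If $s_a\ne0$ and $s_b\neq 0$, then $\operatorname{dom}(A_{min})=H^1_0((a,b))$. (ii) If exactly one of $s_a,s_b$ is $0$, then $C_0^\infty((a,b))$ is a core for $A_{min}$ and $H_0^1((a,b))\subsetneq\operatorname{dom}(A_{min})$. Moreover: * If $s_a=0$ and $s_b\neq0$, then for every $R>0$ $$\operatorname{dom}(A_{min})=\Big\{f\in\mathcal D:\ \lim_{x\downarrow a}\frac{f(x)}{[(x-a)\ln(R/(x-a))]^{1/2}}=0=\lim_{x\uparrow b}\frac{f(x)}{(b-x)^{1/2}}\Big\};$$ if in addition $s_b\notin(-\frac12,0)$, then $\operatorname{dom}(A_{min})=\{f\in\mathcal D: f(a)=0=f(b)\}$; and if $s_b\in(-\infty,-1]\cup(0,\infty)$, then $A_{min}=A_{max}$, in particular $\operatorname{dom}(A_{min})=\operatorname{dom}(A_{max})$.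 * If $s_a\ne0$ and $s_b=0$, then for every $R>0$ $$\operatorname{dom}(A_{min})=\Big\{f\in\mathcal D:\ \lim_{x\downarrow a}\frac{f(x)}{(x-a)^{1/2}}=0=\lim_{x\uparrow b}\frac{f(x)}{[(b-x)\ln(R/(b-x))]^{1/2}}\Big\};$$ if in addition $s_a\notin(-\frac12,0)$, then $\operatorname{dom}(A_{min})=\{f\in\mathcal D: f(a)=0=f(b)\}$; and if $s_a\in(-\infty,-1]\cup(0,\infty)$, then $A_{min}=A_{max}$, in particular $\operatorname{dom}(A_{min})=\operatorname{dom}(A_{max})$. (iii) If $s_a,s_b\in(-\infty,-1]\cup(0,\infty)$, then $$\operatorname{dom}(A_{max})=\mathcal D=\{f\in\mathcal D: f(a)=0=f(b)\}=\Big\{f\in\mathcal D: \lim_{x\downarrow a}\frac{f(x)}{(x-a)^{1/2}}=0=\lim_{x\uparrow b}\frac{f(x)}{(b-x)^{1/2}}\Big\}=\operatorname{dom}(A_{min})=H^1_0((a,b)).$$ Furthermore, $A_{max}=A_{min}$ whenever $s_a,s_b\in(-\infty,-1]\cup[0,\infty)$. (iv) If $s_a\in(-1,0)$ or $s_b\in(-1,0)$,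 then $\operatorname{dom}(A_{min})\subsetneq\operatorname{dom}(A_{max})$; if moreover $s_a\neq0$ and $s_b\ne0$, then $H^1_0((a,b))=\operatorname{dom}(A_{min})$. -/

import Mathlib

open MeasureTheory Set Filter Topology
open scoped ContDiff

namespace BesselType

/-- The complex Hilbert space `L²((a,b); dx)`. -/
abbrev L2 (a b : ℝ) : Type :=
  Lp ℂ 2 (volume.restrict (Ioo a b))

/-- `f ∈ AC_loc((a,b))`: `f` is absolutely continuous on every compact subinterval of `(a,b)`. -/
def ACLoc (a b : ℝ) (f : ℝ → ℂ) : Prop :=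
  ∀ c d : ℝ, a < c → c ≤ d → d < b → AbsolutelyContinuousOnInterval f c d

/-- The first-order differential expression `d/dx + φ`, applied to `f`. -/
noncomputable def firstOrder (φ : ℝ → ℝ) (f : ℝ → ℂ) (x : ℝ) : ℂ :=
  deriv f x + (φ x : ℂ) * f x

/-- `f` is a locally absolutely continuous representative of `u ∈ L²((a,b); dx)` such that
`f' + φ f` lies in `L²((a,b); dx)`. -/
structure MaxRep (a b : ℝ) (φ : ℝ → ℝ) (u : L2 a b) (f : ℝ → ℂ) : Prop where
  acLoc : ACLoc a b f
  ae_eq : u =ᵐ[volume.restrict (Ioo a b)] f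
  memLp : MemLp (firstOrder φ f) 2 (volume.restrict (Ioo a b))

theorem ACLoc.add {a b : ℝ} {f g : ℝ → ℂ} (hf : ACLoc a b f) (hg : ACLoc a b g) :
    ACLoc a b (f + g) :=
  fun c d hc hcd hd ↦ (hf c d hc hcd hd).add (hg c d hc hcd hd)

theorem ACLoc.const_smul {a b : ℝ} {f : ℝ → ℂ} (k : ℂ) (hf : ACLoc a b f) :
    ACLoc a b (k • f) :=
  fun c d hc hcd hd ↦ (hf c d hc hcd hd).const_smul k

theorem ACLoc.continuousOn {a b : ℝ} {f : ℝ → ℂ} (hf : ACLoc a b f) :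
    ContinuousOn f (Ioo a b) := by
  intro x hx
  obtain ⟨c, hc, hcx⟩ := exists_between hx.1
  obtain ⟨d, hxd, hd⟩ := exists_between hx.2
  have h := (hf c d hc (hcx.trans hxd).le hd).continuousOn
  rw [uIcc_of_le (hcx.trans hxd).le] at h
  exact (h.continuousAt (Icc_mem_nhds hcx hxd)).continuousWithinAt

theorem ACLoc.ae_differentiableAt {a b : ℝ} {f : ℝ → ℂ} (hf : ACLoc a b f) :
    ∀ᵐ x ∂volume.restrict (Ioo a b), DifferentiableAt ℝ f x := by
  have hbv : LocallyBoundedVariationOn f (Ioo a b) := by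
    intro c d hc hd
    rcases le_or_gt c d with hcd | hcd
    · have h := (hf c d hc.1 hcd hd.2).boundedVariationOn
      rw [uIcc_of_le hcd] at h
      exact h.mono inter_subset_right
    · rw [Icc_eq_empty (not_le.2 hcd), inter_empty]
      simp
  rw [ae_restrict_iff' measurableSet_Ioo]
  filter_upwards [hbv.ae_differentiableWithinAt_of_mem] with x hx hxm
  exact (hx hxm).differentiableAt (isOpen_Ioo.mem_nhds hxm)

theorem firstOrder_add {a b : ℝ} (φ : ℝ → ℝ) {f g : ℝ → ℂ} (hf : ACLoc a b f)
    (hg : ACLoc a b g) :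
    firstOrder φ (f + g) =ᵐ[volume.restrict (Ioo a b)] firstOrder φ f + firstOrder φ g := by
  filter_upwards [hf.ae_differentiableAt, hg.ae_differentiableAt] with x hx hy
  simp only [firstOrder, Pi.add_apply, deriv_add hx hy]
  ring

theorem firstOrder_const_smul (φ : ℝ → ℝ) (k : ℂ) (f : ℝ → ℂ) :
    firstOrder φ (k • f) = k • firstOrder φ f := by
  funext x
  simp only [firstOrder, Pi.smul_apply, smul_eq_mul, deriv_const_smul_field]
  ring

theorem MaxRep.add {a b : ℝ} {φ : ℝ → ℝ} {u v : L2 a b} {f g : ℝ → ℂ}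
    (hf : MaxRep a b φ u f) (hg : MaxRep a b φ v g) : MaxRep a b φ (u + v) (f + g) where
  acLoc := hf.acLoc.add hg.acLoc
  ae_eq := (Lp.coeFn_add u v).trans (hf.ae_eq.add hg.ae_eq)
  memLp := (memLp_congr_ae (firstOrder_add φ hf.acLoc hg.acLoc)).2 (hf.memLp.add hg.memLp)

theorem MaxRep.const_smul {a b : ℝ} {φ : ℝ → ℝ} {u : L2 a b} {f : ℝ → ℂ} (k : ℂ)
    (hf : MaxRep a b φ u f) : MaxRep a b φ (k • u) (k • f) where
  acLoc := hf.acLoc.const_smul k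
  ae_eq := (Lp.coeFn_smul k u).trans (hf.ae_eq.const_smul k)
  memLp := by
    rw [firstOrder_const_smul]
    exact hf.memLp.const_smul k

theorem MaxRep.zero (a b : ℝ) (φ : ℝ → ℝ) : MaxRep a b φ 0 0 where
  acLoc := fun c d _ _ _ ↦ by
    have h : Tendsto (fun _ : ℕ × (ℕ → ℝ × ℝ) ↦ (0 : ℝ))
      (AbsolutelyContinuousOnInterval.totalLengthFilter ⊓
        𝓟 (AbsolutelyContinuousOnInterval.disjWithin c d)) (𝓝 0) := tendsto_const_nhds
    refine h.congr fun E ↦ ?_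
    simp
  ae_eq := Lp.coeFn_zero _ _ _
  memLp := by
    have h : firstOrder φ 0 = 0 := by
      funext x
      simp [firstOrder]
    rw [h]
    exact MemLp.zero'

/-- The expression `f' + φ f` does not depend on the representative. -/
theorem MaxRep.firstOrder_ae_eq {a b : ℝ} {φ : ℝ → ℝ} {u : L2 a b} {f g : ℝ → ℂ}
    (hf : MaxRep a b φ u f) (hg : MaxRep a b φ u g) :
    firstOrder φ f =ᵐ[volume.restrict (Ioo a b)] firstOrder φ g := by
  have h : EqOn f g (Ioo a b) :=
    Measure.eqOn_open_of_ae_eq (hf.ae_eq.symm.trans hg.ae_eq) isOpen_Ioo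
      hf.acLoc.continuousOn hg.acLoc.continuousOn
  filter_upwards [ae_restrict_mem measurableSet_Ioo] with x hx
  simp only [firstOrder, h hx, (h.eventuallyEq_of_mem (isOpen_Ioo.mem_nhds hx)).deriv_eq]

/-- The domain of the maximal operator of `d/dx + φ` in `L²((a,b); dx)`: all `g ∈ L²((a,b); dx)`
with `g ∈ AC_loc((a,b))` and `g' + φ g ∈ L²((a,b); dx)`. -/
def maxDomain (a b : ℝ) (φ : ℝ → ℝ) : Submodule ℂ (L2 a b) where
  carrier := {u | ∃ f : ℝ → ℂ, MaxRep a b φ u f}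
  add_mem' := by
    rintro u v ⟨f, hf⟩ ⟨g, hg⟩
    exact ⟨f + g, hf.add hg⟩
  zero_mem' := ⟨0, MaxRep.zero a b φ⟩
  smul_mem' := by
    rintro k u ⟨f, hf⟩
    exact ⟨k • f, hf.const_smul k⟩

/-- The maximal operator `g ↦ g' + φ g` in `L²((a,b); dx)`. -/
noncomputable def maxOp (a b : ℝ) (φ : ℝ → ℝ) : L2 a b →ₗ.[ℂ] L2 a b where
  domain := maxDomain a b φ
  toFun :=
    { toFun := fun u ↦ u.2.choose_spec.memLp.toLp (firstOrder φ u.2.choose)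
      map_add' := by
        intro u v
        rw [← MemLp.toLp_add]
        refine (MemLp.toLp_eq_toLp_iff _ _).2 ?_
        exact ((u + v).2.choose_spec.firstOrder_ae_eq
          (u.2.choose_spec.add v.2.choose_spec)).trans
          (firstOrder_add φ u.2.choose_spec.acLoc v.2.choose_spec.acLoc)
      map_smul' := by
        intro k u
        rw [RingHom.id_apply, ← MemLp.toLp_const_smul]
        refine (MemLp.toLp_eq_toLp_iff _ _).2 ?_
        rw [← firstOrder_const_smul]
        exact (k • u).2.choose_spec.firstOrder_ae_eq (u.2.choose_spec.const_smul k) }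

/-- The maximal operator acts on any admissible representative by `f ↦ f' + φ f`. -/
theorem maxOp_ae_eq {a b : ℝ} {φ : ℝ → ℝ} (u : (maxOp a b φ).domain) {f : ℝ → ℂ}
    (hf : MaxRep a b φ (u : L2 a b) f) :
    maxOp a b φ u =ᵐ[volume.restrict (Ioo a b)] firstOrder φ f :=
  (MemLp.coeFn_toLp u.2.choose_spec.memLp).trans (u.2.choose_spec.firstOrder_ae_eq hf)

/-- The elements of `L²((a,b); dx)` whose (essential) support is a compact subset of `(a,b)`. -/
def compactlySupported (a b : ℝ) : Submodule ℂ (L2 a b) where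
  carrier := {u | ∃ K : Set ℝ, IsCompact K ∧ K ⊆ Ioo a b ∧
    ∀ᵐ x ∂volume.restrict (Ioo a b), x ∉ K → u x = 0}
  add_mem' := by
    rintro u v ⟨K, hK, hKs, hu⟩ ⟨M, hM, hMs, hv⟩
    refine ⟨K ∪ M, hK.union hM, union_subset hKs hMs, ?_⟩
    filter_upwards [hu, hv, Lp.coeFn_add u v] with x h1 h2 h3 hx
    rw [mem_union, not_or] at hx
    rw [h3, Pi.add_apply, h1 hx.1, h2 hx.2, add_zero]
  zero_mem' := by
    refine ⟨∅, isCompact_empty, empty_subset _, ?_⟩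
    filter_upwards [Lp.coeFn_zero ℂ 2 (volume.restrict (Ioo a b))] with x hx _
    exact hx
  smul_mem' := by
    rintro k u ⟨K, hK, hKs, hu⟩
    refine ⟨K, hK, hKs, ?_⟩
    filter_upwards [hu, Lp.coeFn_smul k u] with x h1 h3 hx
    rw [h3, Pi.smul_apply, h1 hx, smul_zero]

/-- The space `C_0^∞((a,b))` of smooth functions with compact support in `(a,b)`, as a subspace
of `L²((a,b); dx)`. -/
def testFunctions (a b : ℝ) : Submodule ℂ (L2 a b) where
  carrier := {u | ∃ g : ℝ → ℂ, ContDiff ℝ ∞ g ∧ HasCompactSupport g ∧ tsupport g ⊆ Ioo a b ∧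
    u =ᵐ[volume.restrict (Ioo a b)] g}
  add_mem' := by
    rintro u v ⟨g, hg, hgc, hgs, hu⟩ ⟨h, hh, hhc, hhs, hv⟩
    exact ⟨g + h, hg.add hh, hgc.add hhc, (tsupport_add g h).trans (union_subset hgs hhs),
      (Lp.coeFn_add u v).trans (hu.add hv)⟩
  zero_mem' := ⟨0, contDiff_const, HasCompactSupport.zero, by simp [tsupport],
    Lp.coeFn_zero _ _ _⟩
  smul_mem' := by
    rintro k u ⟨g, hg, hgc, hgs, hu⟩
    have hsub : tsupport (k • g) ⊆ tsupport g :=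
      closure_mono fun x hx hx0 ↦ hx (by rw [Pi.smul_apply, hx0, smul_zero])
    exact ⟨k • g, contDiff_const.smul hg, hgc.of_isClosed_subset (isClosed_tsupport _) hsub,
      hsub.trans hgs, (Lp.coeFn_smul k u).trans (hu.const_smul k)⟩

/-- The preminimal operator: `d/dx + φ` on the compactly supported elements of the maximal
domain. -/
noncomputable def preMinOp (a b : ℝ) (φ : ℝ → ℝ) : L2 a b →ₗ.[ℂ] L2 a b :=
  (maxOp a b φ).domRestrict (compactlySupported a b)

/-- The minimal operator: the closure of the preminimal operator. -/
noncomputable def minOp (a b : ℝ) (φ : ℝ → ℝ) : L2 a b →ₗ.[ℂ] L2 a b :=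
  (preMinOp a b φ).closure

/-- The Sobolev space `H_0^1((a,b))`: all `g ∈ L²((a,b); dx)` with `g ∈ AC([a,b])`,
`g(a) = 0 = g(b)` and `g' ∈ L²((a,b); dx)`. -/
def H01 (a b : ℝ) : Set (L2 a b) :=
  {u | ∃ g : ℝ → ℂ, AbsolutelyContinuousOnInterval g a b ∧
    u =ᵐ[volume.restrict (Ioo a b)] g ∧ g a = 0 ∧ g b = 0 ∧
    MemLp (deriv g) 2 (volume.restrict (Ioo a b))}

/-- The pair of smooth step functions on `[a,b]`: `χa` equals `1` on `[a, a+ε]` and `0` on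
`[a+2ε, b]`, while `χb` equals `1` on `[b-ε, b]` and `0` on `[a, b-2ε]`. -/
structure IsCutoffPair (a b ε : ℝ) (χa χb : ℝ → ℝ) : Prop where
  smooth_left : ContDiffOn ℝ ∞ χa (Icc a b)
  smooth_right : ContDiffOn ℝ ∞ χb (Icc a b)
  left_one : ∀ x ∈ Icc a (a + ε), χa x = 1
  left_zero : ∀ x ∈ Icc (a + 2 * ε) b, χa x = 0
  right_one : ∀ x ∈ Icc (b - ε) b, χb x = 1
  right_zero : ∀ x ∈ Icc a (b - 2 * ε), χb x = 0

/-- The coefficient `φ` of `α_{s_a,s_b} = d/dx + φ`. -/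
noncomputable def potential (a b sa sb : ℝ) (χa χb : ℝ → ℝ) (x : ℝ) : ℝ :=
  -((sa + 1 / 2) / (x - a)) * χa x + (sb + 1 / 2) / (b - x) * χb x

/-- The operator `A_{s_a,s_b,max}`. -/
noncomputable abbrev Amax (a b sa sb : ℝ) (χa χb : ℝ → ℝ) : L2 a b →ₗ.[ℂ] L2 a b :=
  maxOp a b (potential a b sa sb χa χb)

/-- The preminimal operator whose closure is `A_{s_a,s_b,min}`. -/
noncomputable abbrev AdotMin (a b sa sb : ℝ) (χa χb : ℝ → ℝ) : L2 a b →ₗ.[ℂ] L2 a b :=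
  preMinOp a b (potential a b sa sb χa χb)

/-- The operator `A_{s_a,s_b,min}`. -/
noncomputable abbrev Amin (a b sa sb : ℝ) (χa χb : ℝ → ℝ) : L2 a b →ₗ.[ℂ] L2 a b :=
  minOp a b (potential a b sa sb χa χb)

/-- The set of all `f ∈ L²((a,b); dx)` with `f ∈ AC_loc((a,b))` and
`α_{s_a,s_b} f ∈ L²((a,b); dx)` whose locally absolutely continuous representative satisfies the
additional (boundary) condition `bc`. -/
def domainWith (a b sa sb : ℝ) (χa χb : ℝ → ℝ) (bc : (ℝ → ℂ) → Prop) : Set (L2 a b) :=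
  {u | ∃ f : ℝ → ℂ, MaxRep a b (potential a b sa sb χa χb) u f ∧ bc f}

/-- `f(a) = 0`, the boundary value being the limit of `f(x)` as `x ↓ a`. -/
def VanishesLeft (a : ℝ) (f : ℝ → ℂ) : Prop :=
  Tendsto f (𝓝[>] a) (𝓝 0)

/-- `f(b) = 0`, the boundary value being the limit of `f(x)` as `x ↑ b`. -/
def VanishesRight (b : ℝ) (f : ℝ → ℂ) : Prop :=
  Tendsto f (𝓝[<] b) (𝓝 0)

/-- `f(x) / (x-a)^{1/2} → 0` as `x ↓ a`. -/
def SqrtLeft (a : ℝ) (f : ℝ → ℂ) : Prop :=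
  Tendsto (fun x ↦ f x / ((Real.sqrt (x - a) : ℝ) : ℂ)) (𝓝[>] a) (𝓝 0)

/-- `f(x) / (b-x)^{1/2} → 0` as `x ↑ b`. -/
def SqrtRight (b : ℝ) (f : ℝ → ℂ) : Prop :=
  Tendsto (fun x ↦ f x / ((Real.sqrt (b - x) : ℝ) : ℂ)) (𝓝[<] b) (𝓝 0)

/-- `f(x) / [(x-a) ln(R/(x-a))]^{1/2} → 0` as `x ↓ a`. -/
def LogLeft (a R : ℝ) (f : ℝ → ℂ) : Prop :=
  Tendsto (fun x ↦ f x / ((Real.sqrt ((x - a) * Real.log (R / (x - a))) : ℝ) : ℂ))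
    (𝓝[>] a) (𝓝 0)

/-- `f(x) / [(b-x) ln(R/(b-x))]^{1/2} → 0` as `x ↑ b`. -/
def LogRight (b R : ℝ) (f : ℝ → ℂ) : Prop :=
  Tendsto (fun x ↦ f x / ((Real.sqrt ((b - x) * Real.log (R / (b - x))) : ℝ) : ℂ))
    (𝓝[<] b) (𝓝 0)

end BesselType

open BesselType

/-! Everything is decided at the endpoints. In the variable `t = x - a` or `t = b - x`, membership
in the maximal domain says near the endpoint that `g' - (s + 1/2) g / t = v` with `v` square
integrable. Hence `(t^(-s-1/2) g)' = t^(-s-1/2) v`, and Cauchy-Schwarz with the explicit integral of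
`t^(-2s-1)` controls `g`: it is `o(√t)` for `s > 0` and `o(√(t log(R/t)))` for `s = 0`. For `s < 0`
it is `o(√t)` provided that the homogeneous solution `t^(s+1/2)` does not occur in it. That solution
is excluded by `g = O(√t)`, by `g → 0` when `s ≤ -1/2`, and by square integrability of `g` when `s ≤
-1`.

The central result is `MaxRep.mem_minOp_domain_iff`: an element of the maximal domain lies in the
minimal domain exactly when it is `o(√t)` at each endpoint with nonzero parameter. Necessity: graph
convergence gives pointwise convergence along a subsequence, and for `s < 0` the compactly supported
approximants satisfy `‖f_n‖ ≤ C √t` with `C` independent of `n`, so the bound passes to the limit.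
Sufficiency: multiply by cutoffs on a double logarithmic scale. Their derivatives are dominated by a
multiple of `1 / (t L log L)` with `L ~ log(1/t)`, and this weight times a function of size `√(t L)`
is still square integrable, so dominated convergence applies even when `s = 0`.

The identification with `H01` rests on Hardy's inequality (`IsLocalSol.exists_memLp_div`): if `s ≠
0` and `g = O(√t)`, then `g / t` is square integrable, so `φ f` and therefore `f'` are. Conversely
an element of `H01` is a local solution with `s = -1/2`, for which the singular coefficient
vanishes, and the same inequality puts it in the maximal domain.

Strict inclusions come from `(x - a)^(s+1/2) (b - x)` and its mirror image: it is in the maximal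
domain for `-1 < s` and is not `o(√t)` for `s ≤ 0`. The core property is obtained by smoothing the
derivative of a compactly supported element and correcting its integral. -/

namespace AbsolutelyContinuousOnInterval

/-! ### Absolutely continuous complex-valued functions. -/

theorem lipschitzWith_comp {X Y : Type*} [PseudoMetricSpace X] [PseudoMetricSpace Y] {f : ℝ → X}
    {c d : ℝ} {K : NNReal} {L : X → Y} (hL : LipschitzWith K L)
    (hf : AbsolutelyContinuousOnInterval f c d) :
    AbsolutelyContinuousOnInterval (fun x ↦ L (f x)) c d := by
  unfold AbsolutelyContinuousOnInterval at hf
  refine squeeze_zero (fun E ↦ Finset.sum_nonneg fun _ _ ↦ dist_nonneg) (fun E ↦ ?_)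
    (by simpa using hf.const_mul (K : ℝ))
  rw [Finset.mul_sum]
  exact Finset.sum_le_sum fun i _ ↦ hL.dist_le_mul _ _

theorem congr {X : Type*} [PseudoMetricSpace X] {f g : ℝ → X} {c d : ℝ}
    (hf : AbsolutelyContinuousOnInterval f c d) (h : EqOn f g (uIcc c d)) :
    AbsolutelyContinuousOnInterval g c d := by
  rw [absolutelyContinuousOnInterval_iff] at hf ⊢
  intro ε hε
  obtain ⟨δ, hδ, H⟩ := hf ε hε
  refine ⟨δ, hδ, fun E hE hl ↦ ?_⟩
  refine lt_of_eq_of_lt (Finset.sum_congr rfl fun i hi ↦ ?_) (H E hE hl)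
  rw [h (hE.1 i hi).1, h (hE.1 i hi).2]

theorem _root_.IntervalIntegrable.clm_comp {E F : Type*} [NormedAddCommGroup E] [NormedSpace ℝ E]
    [NormedAddCommGroup F] [NormedSpace ℝ F] {f : ℝ → E} {c d : ℝ} (L : E →L[ℝ] F)
    (h : IntervalIntegrable f volume c d) : IntervalIntegrable (fun x ↦ L (f x)) volume c d :=
  ⟨L.integrable_comp h.1, L.integrable_comp h.2⟩

variable {f g : ℝ → ℂ} {c d : ℝ}

theorem re (hf : AbsolutelyContinuousOnInterval f c d) :
    AbsolutelyContinuousOnInterval (fun x ↦ (f x).re) c d :=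
  hf.lipschitzWith_comp Complex.reCLM.lipschitz

theorem im (hf : AbsolutelyContinuousOnInterval f c d) :
    AbsolutelyContinuousOnInterval (fun x ↦ (f x).im) c d :=
  hf.lipschitzWith_comp Complex.imCLM.lipschitz

theorem ofReal {p : ℝ → ℝ} (hp : AbsolutelyContinuousOnInterval p c d) :
    AbsolutelyContinuousOnInterval (fun x ↦ (p x : ℂ)) c d :=
  hp.lipschitzWith_comp Complex.ofRealCLM.lipschitz

/-- Together with `re` and `im` this transfers results on real-valued absolutely continuous
functions to complex-valued ones. -/
theorem of_re_im (hr : AbsolutelyContinuousOnInterval (fun x ↦ (f x).re) c d)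
    (hi : AbsolutelyContinuousOnInterval (fun x ↦ (f x).im) c d) :
    AbsolutelyContinuousOnInterval f c d := by
  refine (hr.ofReal.add (hi.ofReal.const_smul Complex.I)).congr fun x _ ↦ ?_
  simp only [Pi.add_apply, smul_eq_mul]
  rw [mul_comm, Complex.re_add_im]

theorem complex_mul (hf : AbsolutelyContinuousOnInterval f c d)
    (hg : AbsolutelyContinuousOnInterval g c d) :
    AbsolutelyContinuousOnInterval (fun x ↦ f x * g x) c d :=
  hf.fun_smul hg

theorem ae_differentiableAt_complex (hf : AbsolutelyContinuousOnInterval f c d) :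
    ∀ᵐ x : ℝ, x ∈ uIcc c d → DifferentiableAt ℝ f x :=
  hf.boundedVariationOn.ae_differentiableAt_of_mem_uIcc

theorem intervalIntegrable_deriv_complex (hf : AbsolutelyContinuousOnInterval f c d) :
    IntervalIntegrable (deriv f) volume c d := by
  have h := (hf.re.intervalIntegrable_deriv.clm_comp Complex.ofRealCLM).add
    ((hf.im.intervalIntegrable_deriv.clm_comp Complex.ofRealCLM).const_mul Complex.I)
  refine h.congr_ae ?_
  filter_upwards [ae_restrict_of_ae hf.ae_differentiableAt_complex,
    ae_restrict_mem measurableSet_uIoc] with x hx hxm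
  have hd := (hx (uIoc_subset_uIcc hxm)).hasDerivAt
  have h1 : deriv (fun x ↦ (f x).re) x = (deriv f x).re :=
    (Complex.reCLM.hasFDerivAt.comp_hasDerivAt x hd).deriv
  have h2 : deriv (fun x ↦ (f x).im) x = (deriv f x).im :=
    (Complex.imCLM.hasFDerivAt.comp_hasDerivAt x hd).deriv
  simp only [h1, h2, Complex.ofRealCLM_apply]
  rw [mul_comm, Complex.re_add_im]

theorem _root_.IntervalIntegrable.absolutelyContinuousOnInterval_complex {c d x₀ : ℝ}
    (h : IntervalIntegrable f volume c d) (hx₀ : x₀ ∈ uIcc c d) :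
    AbsolutelyContinuousOnInterval (fun x ↦ ∫ v in x₀..x, f v) c d := by
  have hi : ∀ x ∈ uIcc c d, IntervalIntegrable f volume x₀ x := fun x hx ↦
    h.mono_set (uIcc_subset_uIcc hx₀ hx)
  refine of_re_im ?_ ?_
  · have hr : IntervalIntegrable (fun x ↦ (f x).re) volume c d :=
      h.clm_comp Complex.reCLM
    refine (hr.absolutelyContinuousOnInterval_intervalIntegral hx₀).congr fun x hx ↦ ?_
    exact Complex.reCLM.intervalIntegral_comp_comm (hi x hx)
  · have hr : IntervalIntegrable (fun x ↦ (f x).im) volume c d :=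
      h.clm_comp Complex.imCLM
    refine (hr.absolutelyContinuousOnInterval_intervalIntegral hx₀).congr fun x hx ↦ ?_
    exact Complex.imCLM.intervalIntegral_comp_comm (hi x hx)

/-- The difference of `f` and the primitive of its derivative is absolutely continuous with
derivative zero almost everywhere, hence constant. -/
theorem integral_deriv_eq_sub_complex (hf : AbsolutelyContinuousOnInterval f c d) :
    ∫ x in c..d, deriv f x = f d - f c := by
  have hi := hf.intervalIntegrable_deriv_complex
  have hF := hi.absolutelyContinuousOnInterval_complex (left_mem_uIcc)
  have hz : ∀ᵐ x : ℝ, x ∈ uIcc c d →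
      HasDerivAt (f - fun x ↦ ∫ v in c..x, deriv f v) 0 x := by
    filter_upwards [hf.ae_differentiableAt_complex, hi.ae_hasDerivAt_integral] with x h1 h2 hx
    simpa using! (h1 hx).hasDerivAt.sub (h2 hx c left_mem_uIcc)
  obtain ⟨C, hC⟩ := (hf.sub hF).const_of_ae_hasDerivAt_zero hz
  have h1 := hC c left_mem_uIcc
  have h2 := hC d right_mem_uIcc
  simp only [Pi.sub_apply, intervalIntegral.integral_same, sub_zero] at h1 h2
  rw [h1, ← h2]
  ring

theorem of_hasDerivAt {F : Type*} [NormedAddCommGroup F] [NormedSpace ℝ F] {p p' : ℝ → F}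
    (hp : ∀ x ∈ uIcc c d, HasDerivAt p (p' x) x) (hp' : ContinuousOn p' (uIcc c d)) :
    AbsolutelyContinuousOnInterval p c d := by
  obtain ⟨C, hC⟩ := isCompact_uIcc.exists_bound_of_continuousOn hp'
  have hL : LipschitzOnWith (Real.toNNReal C) p (uIcc c d) := by
    refine (convex_uIcc c d).lipschitzOnWith_of_nnnorm_hasDerivWithin_le
      (fun x hx ↦ (hp x hx).hasDerivWithinAt) fun x hx ↦ ?_
    rw [← NNReal.coe_le_coe, coe_nnnorm]
    exact (hC x hx).trans (Real.le_coe_toNNReal C)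
  exact hL.absolutelyContinuousOnInterval

/-- By the fundamental theorem of calculus the composition is a constant plus `σ` times a primitive
of `deriv f (p + σ * t)`, which is integrable by the change of variables. -/
theorem comp_affine {p σ : ℝ} (hσ : σ ≠ 0)
    (hf : AbsolutelyContinuousOnInterval f (p + σ * c) (p + σ * d)) :
    AbsolutelyContinuousOnInterval (fun t ↦ f (p + σ * t)) c d := by
  have hmem : ∀ t ∈ uIcc c d, p + σ * t ∈ uIcc (p + σ * c) (p + σ * d) := by
    intro t ht
    rcases lt_or_gt_of_ne hσ with h | h
    · rw [mem_uIcc] at ht ⊢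
      rcases ht with ⟨h1, h2⟩ | ⟨h1, h2⟩
      · right; constructor <;> nlinarith
      · left; constructor <;> nlinarith
    · rw [mem_uIcc] at ht ⊢
      rcases ht with ⟨h1, h2⟩ | ⟨h1, h2⟩
      · left; constructor <;> nlinarith
      · right; constructor <;> nlinarith
  have hi : IntervalIntegrable (fun t ↦ deriv f (p + σ * t)) volume c d := by
    have h := ((hf.intervalIntegrable_deriv_complex).comp_add_left p).comp_mul_left (c := σ)
    simpa [hσ] using! h
  refine (((hi.absolutelyContinuousOnInterval_complex left_mem_uIcc).const_smul (σ : ℂ)).add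
    (LipschitzWith.const (f (p + σ * c))).lipschitzOnWith.absolutelyContinuousOnInterval).congr
      fun t ht ↦ ?_
  have h := (hf.mono (uIcc_subset_uIcc left_mem_uIcc (hmem t ht))).integral_deriv_eq_sub_complex
  have h2 := intervalIntegral.smul_integral_comp_add_mul (a := c) (b := t) (deriv f) σ p
  rw [h, Complex.real_smul] at h2
  simp only [Pi.add_apply, smul_eq_mul]
  rw [h2]
  ring

end AbsolutelyContinuousOnInterval

/-! ### Integrating factors and square integrability estimates. -/

namespace BesselType

/-- The weighted fundamental theorem of calculus with integrating factor `P`. -/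
theorem integratingFactor {φ P : ℝ → ℝ} {f : ℝ → ℂ} {c d : ℝ}
    (hf : AbsolutelyContinuousOnInterval f c d)
    (hP : ∀ x ∈ uIcc c d, HasDerivAt P (φ x * P x) x) (hφ : ContinuousOn φ (uIcc c d)) :
    (P d : ℂ) * f d - (P c : ℂ) * f c = ∫ x in c..d, (P x : ℂ) * firstOrder φ f x := by
  have hPc : ContinuousOn P (uIcc c d) := fun x hx ↦ (hP x hx).continuousAt.continuousWithinAt
  have hPac := (AbsolutelyContinuousOnInterval.of_hasDerivAt hP (hφ.mul hPc)).ofReal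
  rw [← (hPac.complex_mul hf).integral_deriv_eq_sub_complex]
  refine intervalIntegral.integral_congr_ae ?_
  -- Since `P' = φ P`, the product rule gives `(P f)' = P (f' + φ f)` wherever `f` is
  -- differentiable.
  filter_upwards [hf.ae_differentiableAt_complex] with x hx hxm
  have hxc := uIoc_subset_uIcc hxm
  have h := ((hP x hxc).ofReal_comp.fun_mul (hx hxc).hasDerivAt).deriv
  rw [h]
  simp only [firstOrder, Complex.ofReal_mul]
  ring

theorem norm_integral_mul_le {P : ℝ → ℝ} {v : ℝ → ℂ} {c d : ℝ} (hcd : c ≤ d)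
    (hP : ContinuousOn P (Icc c d)) (hv : MemLp v 2 (volume.restrict (Ioc c d))) :
    ‖∫ x in c..d, (P x : ℂ) * v x‖ ≤
      Real.sqrt (∫ x in c..d, P x ^ 2) * Real.sqrt (∫ x in c..d, ‖v x‖ ^ 2) := by
  rw [intervalIntegral.integral_of_le hcd, intervalIntegral.integral_of_le hcd,
    intervalIntegral.integral_of_le hcd]
  have hPm : MemLp P 2 (volume.restrict (Ioc c d)) := by
    obtain ⟨C, hC⟩ := isCompact_Icc.exists_bound_of_continuousOn hP
    refine MemLp.of_bound ((hP.mono Ioc_subset_Icc_self).aestronglyMeasurable measurableSet_Ioc)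
      C ?_
    filter_upwards [ae_restrict_mem measurableSet_Ioc] with x hx
    exact hC x (Ioc_subset_Icc_self hx)
  refine (norm_integral_le_integral_norm _).trans ?_
  have h := integral_mul_norm_le_Lp_mul_Lq (μ := volume.restrict (Ioc c d))
    (f := fun x ↦ (P x : ℂ)) (g := v) (p := 2) (q := 2) ⟨by norm_num, by norm_num, by norm_num⟩
    (by rw [ENNReal.ofReal_ofNat]; exact hPm.ofReal) (by simpa using hv)
  simp only [norm_mul, Complex.norm_real]
  rw [Real.sqrt_eq_rpow, Real.sqrt_eq_rpow]
  simpa [Real.norm_eq_abs] using h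

/-- Dominated convergence in `L²`: apply the integral version to the squared norms, dominated by the
square of `G`. -/
theorem tendsto_eLpNorm_of_dominated {α : Type*} [MeasurableSpace α] {μ : Measure α}
    {F : ℕ → α → ℂ} {G : α → ℝ} (hF : ∀ n, AEStronglyMeasurable (F n) μ) (hG : MemLp G 2 μ)
    (hFG : ∀ n, ∀ᵐ x ∂μ, ‖F n x‖ ≤ G x) (h0 : ∀ᵐ x ∂μ, Tendsto (fun n ↦ F n x) atTop (𝓝 0)) :
    Tendsto (fun n ↦ eLpNorm (F n) 2 μ) atTop (𝓝 0) := by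
  have hlim : Tendsto (fun n ↦ ∫⁻ x, ‖F n x‖ₑ ^ (2 : ℝ) ∂μ) atTop (𝓝 (∫⁻ _, 0 ∂μ)) := by
    refine tendsto_lintegral_of_dominated_convergence' (fun x ↦ ‖G x‖ₑ ^ (2 : ℝ))
      (fun n ↦ (hF n).enorm.pow_const _) (fun n ↦ ?_) ?_ ?_
    · filter_upwards [hFG n] with x hx
      refine ENNReal.rpow_le_rpow ?_ (by norm_num)
      rw [enorm_le_iff_norm_le, Real.norm_eq_abs]
      exact hx.trans (le_abs_self _)
    · have := lintegral_rpow_enorm_lt_top_of_eLpNorm_lt_top (by norm_num) (by norm_num) hG.2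
      exact (by simpa using this : _ < _).ne
    · filter_upwards [h0] with x hx
      have h1 := (ENNReal.continuous_rpow_const (y := 2)).tendsto 0 |>.comp
        (show Tendsto (fun n ↦ ‖F n x‖ₑ) atTop (𝓝 0) by simpa using hx.enorm)
      simpa [Function.comp_def] using h1
  have h2 := ((ENNReal.continuous_rpow_const (y := 1 / 2)).tendsto _).comp hlim
  simp only [lintegral_zero] at h2
  rw [ENNReal.zero_rpow_of_pos (by norm_num)] at h2
  refine h2.congr fun n ↦ ?_
  rw [eLpNorm_eq_lintegral_rpow_enorm_toReal (by norm_num) (by norm_num)]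
  simp

/-! ### The local model at an endpoint: growth estimates on `(0,δ)`. -/

/-- `g` is locally absolutely continuous on `(0,δ)` and `g' - (s + 1/2) g / t` is square integrable
there. -/
structure IsLocalSol (s δ : ℝ) (g : ℝ → ℂ) : Prop where
  pos : 0 < δ
  acLoc : ACLoc 0 δ g
  memLp : MemLp (firstOrder (fun t ↦ -((s + 1 / 2) / t)) g) 2 (volume.restrict (Ioo 0 δ))

/-- The square of the `L²(0,y)`-norm of `g' - (s + 1/2) g / t`. -/
noncomputable def energy (s : ℝ) (g : ℝ → ℂ) (y : ℝ) : ℝ :=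
  ∫ t in 0..y, ‖firstOrder (fun t ↦ -((s + 1 / 2) / t)) g t‖ ^ 2

/-- The coefficient of the homogeneous solution `t^(s+1/2)` in `g` is zero, for `s < 0`. -/
def HasNoSingularPart (s : ℝ) (g : ℝ → ℂ) : Prop :=
  ∀ ε > 0, ∃ᶠ x in 𝓝[>] (0 : ℝ), x ^ (-s - 1 / 2) * ‖g x‖ < ε

theorem rpow_mul_rpow_weight {t : ℝ} (ht : 0 < t) (s : ℝ) :
    t ^ (s + 1 / 2) * t ^ (-s - 1 / 2) = 1 := by
  rw [← Real.rpow_add ht]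
  ring_nf
  exact Real.rpow_zero t

theorem rpow_mul_sqrt_weight {t : ℝ} (ht : 0 < t) (s : ℝ) :
    t ^ (s + 1 / 2) * Real.sqrt (t ^ (-2 * s)) = Real.sqrt t := by
  rw [Real.sqrt_eq_rpow, Real.sqrt_eq_rpow, ← Real.rpow_mul ht.le, ← Real.rpow_add ht]
  ring_nf

theorem integral_rpow_weight {s x y : ℝ} (hs : s ≠ 0) (hx : 0 < x) (hxy : x ≤ y) :
    ∫ t in x..y, t ^ (-2 * s - 1) = (y ^ (-2 * s) - x ^ (-2 * s)) / (-2 * s) := by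
  rw [integral_rpow (Or.inr ⟨fun h ↦ hs (by linarith), ?_⟩)]
  · ring_nf
  · rw [uIcc_of_le hxy]
    exact fun h ↦ absurd h.1 (not_le.2 hx)

namespace IsLocalSol

variable {s δ : ℝ} {g : ℝ → ℂ}

theorem intervalIntegrable_sq (h : IsLocalSol s δ g) :
    IntervalIntegrable (fun t ↦ ‖firstOrder (fun t ↦ -((s + 1 / 2) / t)) g t‖ ^ 2) volume 0 δ := by
  rw [intervalIntegrable_iff_integrableOn_Ioo_of_le h.pos.le]
  exact h.memLp.integrable_norm_pow two_ne_zero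

theorem tendsto_energy (h : IsLocalSol s δ g) : Tendsto (energy s g) (𝓝[>] 0) (𝓝 0) := by
  have hc : ContinuousOn (energy s g) (Icc 0 δ) := by
    have := intervalIntegral.continuousOn_primitive_interval (μ := volume) (a := (0 : ℝ)) (b := δ)
      (f := fun t ↦ ‖firstOrder (fun t ↦ -((s + 1 / 2) / t)) g t‖ ^ 2) (by
        rw [uIcc_of_le h.pos.le, integrableOn_Icc_iff_integrableOn_Ioo]
        exact h.memLp.integrable_norm_pow two_ne_zero)
    rwa [uIcc_of_le h.pos.le] at this
  have h0 := (hc 0 (left_mem_Icc.2 h.pos.le)).tendsto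
  have hz : energy s g 0 = 0 := intervalIntegral.integral_same
  rw [hz] at h0
  refine h0.mono_left ?_
  rw [← nhdsWithin_Ioo_eq_nhdsGT h.pos]
  exact nhdsWithin_mono _ Ioo_subset_Icc_self

/-- The function `t^(-s-1/2)` is an integrating factor for the coefficient `-(s + 1/2) / t`, so the
weighted increment is the integral of `t^(-s-1/2) v`. Cauchy-Schwarz then separates the integral of
`t^(-2s-1)` from the energy of `g`. -/
theorem norm_weighted_sub_le (h : IsLocalSol s δ g) {x y : ℝ} (hx : 0 < x) (hxy : x ≤ y)
    (hy : y < δ) :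
    ‖((y ^ (-s - 1 / 2) : ℝ) : ℂ) * g y - ((x ^ (-s - 1 / 2) : ℝ) : ℂ) * g x‖ ≤
      Real.sqrt (∫ t in x..y, t ^ (-2 * s - 1)) * Real.sqrt (energy s g y) := by
  have hpos : ∀ t ∈ Icc x y, 0 < t := fun t ht ↦ hx.trans_le ht.1
  have hP : ∀ t ∈ uIcc x y, HasDerivAt (fun t : ℝ ↦ t ^ (-s - 1 / 2))
      (-((s + 1 / 2) / t) * t ^ (-s - 1 / 2)) t := by
    intro t ht
    rw [uIcc_of_le hxy] at ht
    have h1 := Real.hasDerivAt_rpow_const (p := -s - 1 / 2) (Or.inl (hpos t ht).ne')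
    rw [Real.rpow_sub_one (hpos t ht).ne'] at h1
    convert h1 using 1
    ring
  have hφ : ContinuousOn (fun t : ℝ ↦ -((s + 1 / 2) / t)) (uIcc x y) := by
    rw [uIcc_of_le hxy]
    exact (continuousOn_const.div continuousOn_id fun t ht ↦ (hpos t ht).ne').neg
  have hPc : ContinuousOn (fun t : ℝ ↦ t ^ (-s - 1 / 2)) (Icc x y) := fun t ht ↦
    (hP t (by rwa [uIcc_of_le hxy])).continuousAt.continuousWithinAt
  rw [integratingFactor (h.acLoc x y hx hxy hy) hP hφ]
  have hsub : Ioc x y ⊆ Ioo 0 δ := fun t ht ↦ ⟨hx.trans ht.1, ht.2.trans_lt hy⟩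
  refine (norm_integral_mul_le hxy hPc (h.memLp.mono_measure (Measure.restrict_mono_set _ hsub))
    ).trans ?_
  have h1 : ∫ t in x..y, (t ^ (-s - 1 / 2)) ^ 2 = ∫ t in x..y, t ^ (-2 * s - 1) := by
    refine intervalIntegral.integral_congr fun t ht ↦ ?_
    rw [uIcc_of_le hxy] at ht
    rw [← Real.rpow_mul_natCast (hpos t ht).le]
    congr 1
    push_cast
    ring
  rw [h1]
  refine mul_le_mul_of_nonneg_left (Real.sqrt_le_sqrt ?_) (Real.sqrt_nonneg _)
  exact intervalIntegral.integral_mono_interval hx.le hxy le_rfl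
    (.of_forall fun t ↦ by positivity)
    (h.intervalIntegrable_sq.mono_set (by
      rw [uIcc_of_le (hx.le.trans hxy), uIcc_of_le h.pos.le]
      exact Icc_subset_Icc le_rfl hy.le))

/-- Propagates a bound inwards, from a fixed outer point `y` towards `0`. This is the useful
direction for `s ≥ 0`. -/
theorem weighted_norm_le_left (h : IsLocalSol s δ g) {x y : ℝ} (hx : 0 < x) (hxy : x ≤ y)
    (hy : y < δ) :
    x ^ (-s - 1 / 2) * ‖g x‖ ≤ y ^ (-s - 1 / 2) * ‖g y‖ +
      Real.sqrt (∫ t in x..y, t ^ (-2 * s - 1)) * Real.sqrt (energy s g y) := by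
  have h1 := h.norm_weighted_sub_le hx hxy hy
  have h2 := norm_sub_norm_le (((x ^ (-s - 1 / 2) : ℝ) : ℂ) * g x)
    (((y ^ (-s - 1 / 2) : ℝ) : ℂ) * g y)
  rw [norm_sub_rev] at h2
  simp only [norm_mul, Complex.norm_real, Real.norm_eq_abs,
    abs_of_pos (Real.rpow_pos_of_pos hx _),
    abs_of_pos (Real.rpow_pos_of_pos (hx.trans_le hxy) _)] at h2
  linarith

/-- Propagates a bound outwards. This is the useful direction for `s < 0`, where the weight
`t^(-2s-1)` is integrable at `0` and `x` can be sent to `0`. -/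
theorem weighted_norm_le_right (h : IsLocalSol s δ g) {x y : ℝ} (hx : 0 < x) (hxy : x ≤ y)
    (hy : y < δ) :
    y ^ (-s - 1 / 2) * ‖g y‖ ≤ x ^ (-s - 1 / 2) * ‖g x‖ +
      Real.sqrt (∫ t in x..y, t ^ (-2 * s - 1)) * Real.sqrt (energy s g y) := by
  have h1 := h.norm_weighted_sub_le hx hxy hy
  have h2 := norm_sub_norm_le (((y ^ (-s - 1 / 2) : ℝ) : ℂ) * g y)
    (((x ^ (-s - 1 / 2) : ℝ) : ℂ) * g x)
  simp only [norm_mul, Complex.norm_real, Real.norm_eq_abs,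
    abs_of_pos (Real.rpow_pos_of_pos hx _),
    abs_of_pos (Real.rpow_pos_of_pos (hx.trans_le hxy) _)] at h2
  linarith

theorem exists_energy_lt (h : IsLocalSol s δ g) {c r : ℝ} (hc : 0 < c) (hr : 0 < r) :
    ∃ y, 0 < y ∧ y < δ ∧ y < r ∧ Real.sqrt (energy s g y) < c := by
  have h1 : Tendsto (fun y ↦ Real.sqrt (energy s g y)) (𝓝[>] 0) (𝓝 0) := by
    simpa using h.tendsto_energy.sqrt
  obtain ⟨y, hy1, hy2, hy3⟩ := ((h1.eventually (gt_mem_nhds hc)).and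
    (inter_mem (Ioo_mem_nhdsGT h.pos) (Ioo_mem_nhdsGT hr))).exists
  exact ⟨y, hy2.1, hy2.2, hy3.2, hy1⟩

/-- Fix `y` with small energy and let `x` tend to `0`. The boundary term at `y` contributes
`x^(s+1/2) K = √x · x^s K`, which is negligible because `s > 0`, and the integral term contributes a
small multiple of `√x`. -/
theorem isLittleO_sqrt_of_pos (h : IsLocalSol s δ g) (hs : 0 < s) :
    g =o[𝓝[>] 0] Real.sqrt := by
  rw [Asymptotics.isLittleO_iff]
  intro c hc
  -- The threshold absorbs the factor `1 / √(2s)` from the integral of the weight, leaving `c / 2`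
  -- for this term and `c / 2` for the boundary term.
  obtain ⟨y, hy0, hyδ, -, hE⟩ := h.exists_energy_lt
    (show 0 < c / 2 * Real.sqrt (2 * s) by positivity) one_pos
  set K := y ^ (-s - 1 / 2) * ‖g y‖ with hK
  have hK0 : 0 ≤ K := by positivity
  have hlim : Tendsto (fun x : ℝ ↦ x ^ s * K) (𝓝[>] 0) (𝓝 0) := by
    have h1 : Tendsto (fun x : ℝ ↦ x ^ s * K) (𝓝 0) (𝓝 (0 ^ s * K)) :=
      ((Real.continuousAt_rpow_const 0 s (Or.inr hs.le)).tendsto).mul_const K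
    rw [Real.zero_rpow hs.ne', zero_mul] at h1
    exact h1.mono_left nhdsWithin_le_nhds
  filter_upwards [hlim.eventually (gt_mem_nhds (half_pos hc)), Ioo_mem_nhdsGT hy0] with x hx hxy
  have hx0 := hxy.1
  have h1 := h.weighted_norm_le_left hx0 hxy.2.le hyδ
  have h2 : Real.sqrt (∫ t in x..y, t ^ (-2 * s - 1)) ≤
      Real.sqrt (x ^ (-2 * s)) / Real.sqrt (2 * s) := by
    rw [← Real.sqrt_div (by positivity)]
    refine Real.sqrt_le_sqrt ?_
    rw [integral_rpow_weight hs.ne' hx0 hxy.2.le, ← neg_div_neg_eq, neg_mul, neg_neg]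
    gcongr
    have : 0 < y ^ (-2 * s) := by positivity
    simp only [neg_mul] at this ⊢
    linarith
  have h3 : Real.sqrt (∫ t in x..y, t ^ (-2 * s - 1)) * Real.sqrt (energy s g y) ≤
      Real.sqrt (x ^ (-2 * s)) * (c / 2) := by
    calc _ ≤ Real.sqrt (x ^ (-2 * s)) / Real.sqrt (2 * s) * (c / 2 * Real.sqrt (2 * s)) := by
          gcongr
      _ = _ := by
          have : Real.sqrt (2 * s) ≠ 0 := by positivity
          field_simp
  rw [Real.norm_of_nonneg (Real.sqrt_nonneg x)]
  calc ‖g x‖ = x ^ (s + 1 / 2) * (x ^ (-s - 1 / 2) * ‖g x‖) := by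
        rw [← mul_assoc, rpow_mul_rpow_weight hx0, one_mul]
    _ ≤ x ^ (s + 1 / 2) * (K + Real.sqrt (x ^ (-2 * s)) * (c / 2)) := by
        gcongr
        linarith
    _ = Real.sqrt x * (x ^ s * K) + Real.sqrt x * (c / 2) := by
        rw [mul_add, ← mul_assoc _ (Real.sqrt _), rpow_mul_sqrt_weight hx0, Real.rpow_add hx0,
          ← Real.sqrt_eq_rpow]
        ring
    _ ≤ Real.sqrt x * (c / 2) + Real.sqrt x * (c / 2) := by gcongr
    _ = c * Real.sqrt x := by ring

theorem isLittleO_sqrt_log (h : IsLocalSol 0 δ g) {R : ℝ} (hR : 0 < R) :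
    g =o[𝓝[>] 0] fun x ↦ Real.sqrt (x * Real.log (R / x)) := by
  rw [Asymptotics.isLittleO_iff]
  intro c hc
  -- For `s = 0` the weight integrates to `log (y / x)`; taking `y < R` bounds it by `log (R / x)`,
  -- which also tends to infinity and thereby absorbs the fixed boundary term `K`.
  obtain ⟨y, hy0, hyδ, hyR, hE⟩ := h.exists_energy_lt (half_pos hc) hR
  set K := y ^ (-0 - 1 / 2 : ℝ) * ‖g y‖ with hK
  have hK0 : 0 ≤ K := by positivity
  have hlim : Tendsto (fun x : ℝ ↦ Real.sqrt (Real.log (R / x))) (𝓝[>] 0) atTop := by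
    have h1 : Tendsto (fun x : ℝ ↦ R / x) (𝓝[>] 0) atTop := by
      simp only [div_eq_mul_inv]
      exact tendsto_inv_nhdsGT_zero.const_mul_atTop hR
    exact Real.tendsto_sqrt_atTop.comp (Real.tendsto_log_atTop.comp h1)
  filter_upwards [hlim.eventually_ge_atTop (2 * K / c), Ioo_mem_nhdsGT hy0] with x hx hxy
  have hx0 := hxy.1
  have h1 := h.weighted_norm_le_left hx0 hxy.2.le hyδ
  have h2 : Real.sqrt (∫ t in x..y, t ^ (-2 * (0 : ℝ) - 1)) ≤ Real.sqrt (Real.log (R / x)) := by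
    refine Real.sqrt_le_sqrt ?_
    have : ∫ t in x..y, t ^ (-2 * (0 : ℝ) - 1) = ∫ t in x..y, t⁻¹ :=
      intervalIntegral.integral_congr fun t _ ↦ by simp [Real.rpow_neg_one]
    rw [this, integral_inv_of_pos hx0 hy0]
    exact Real.log_le_log (by positivity) (by gcongr)
  have hKx : K ≤ Real.sqrt (Real.log (R / x)) * (c / 2) := by
    rw [div_le_iff₀ hc] at hx
    linarith
  rw [Real.norm_of_nonneg (Real.sqrt_nonneg _), Real.sqrt_mul hx0.le]
  calc ‖g x‖ = x ^ ((0 : ℝ) + 1 / 2) * (x ^ (-0 - 1 / 2 : ℝ) * ‖g x‖) := by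
        rw [← mul_assoc, rpow_mul_rpow_weight hx0, one_mul]
    _ ≤ x ^ ((0 : ℝ) + 1 / 2) * (Real.sqrt (Real.log (R / x)) * (c / 2) +
          Real.sqrt (Real.log (R / x)) * (c / 2)) := by
        gcongr
        refine h1.trans (add_le_add hKx ?_)
        gcongr
    _ = c * (Real.sqrt x * Real.sqrt (Real.log (R / x))) := by
        rw [zero_add, ← Real.sqrt_eq_rpow]
        ring

/-- Send `x` to `0` along points where the weighted norm is small, so that only the integral term
survives. The constant depends on `s` alone, which makes the bound uniform over approximating
sequences. -/
theorem norm_le_of_hasNoSingularPart (h : IsLocalSol s δ g) (hs : s < 0)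
    (hg : HasNoSingularPart s g) {y : ℝ} (hy : 0 < y) (hyδ : y < δ) :
    ‖g y‖ ≤ Real.sqrt y / Real.sqrt (-2 * s) * Real.sqrt (energy s g y) := by
  have key : y ^ (-s - 1 / 2) * ‖g y‖ ≤
      Real.sqrt (y ^ (-2 * s)) / Real.sqrt (-2 * s) * Real.sqrt (energy s g y) := by
    refine le_of_forall_pos_le_add fun ε hε ↦ ?_
    obtain ⟨x, hx1, hx2⟩ := ((hg ε hε).and_eventually (Ioo_mem_nhdsGT hy)).exists
    have h1 := h.weighted_norm_le_right hx2.1 hx2.2.le hyδ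
    have h2 : Real.sqrt (∫ t in x..y, t ^ (-2 * s - 1)) ≤
        Real.sqrt (y ^ (-2 * s)) / Real.sqrt (-2 * s) := by
      rw [← Real.sqrt_div (by positivity)]
      refine Real.sqrt_le_sqrt ?_
      rw [integral_rpow_weight hs.ne hx2.1 hx2.2.le]
      have h3 : 0 < x ^ (-2 * s) := Real.rpow_pos_of_pos hx2.1 _
      have h4 : 0 ≤ -2 * s := by linarith
      exact div_le_div_of_nonneg_right (by linarith) h4
    have h3 := mul_le_mul_of_nonneg_right h2 (Real.sqrt_nonneg (energy s g y))
    linarith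
  calc ‖g y‖ = y ^ (s + 1 / 2) * (y ^ (-s - 1 / 2) * ‖g y‖) := by
        rw [← mul_assoc, rpow_mul_rpow_weight hy, one_mul]
    _ ≤ y ^ (s + 1 / 2) * (Real.sqrt (y ^ (-2 * s)) / Real.sqrt (-2 * s) *
          Real.sqrt (energy s g y)) := by gcongr
    _ = _ := by
        rw [← rpow_mul_sqrt_weight hy s]
        ring

theorem isLittleO_sqrt_of_hasNoSingularPart (h : IsLocalSol s δ g) (hs : s < 0)
    (hg : HasNoSingularPart s g) : g =o[𝓝[>] 0] Real.sqrt := by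
  rw [Asymptotics.isLittleO_iff]
  intro c hc
  have h0 : 0 < Real.sqrt (-2 * s) := Real.sqrt_pos.2 (by linarith)
  have h1 : Tendsto (fun y ↦ Real.sqrt (energy s g y)) (𝓝[>] 0) (𝓝 0) := by
    simpa using h.tendsto_energy.sqrt
  filter_upwards [h1.eventually (gt_mem_nhds (show 0 < c * Real.sqrt (-2 * s) by positivity)),
    Ioo_mem_nhdsGT h.pos] with y hy1 hy2
  rw [Real.norm_of_nonneg (Real.sqrt_nonneg _)]
  calc _ ≤ _ := h.norm_le_of_hasNoSingularPart hs hg hy2.1 hy2.2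
    _ ≤ Real.sqrt y / Real.sqrt (-2 * s) * (c * Real.sqrt (-2 * s)) := by gcongr
    _ = _ := by rw [mul_comm c, ← mul_assoc, div_mul_cancel₀ _ h0.ne', mul_comm]

end IsLocalSol

theorem hasNoSingularPart_of_tendsto {s : ℝ} {g : ℝ → ℂ}
    (h : Tendsto (fun x : ℝ ↦ x ^ (-s - 1 / 2) * ‖g x‖) (𝓝[>] 0) (𝓝 0)) :
    HasNoSingularPart s g :=
  fun _ hε ↦ (h.eventually (gt_mem_nhds hε)).frequently

/-- The weight times `√x` is `x^(-s)`, which tends to `0` for negative `s`. -/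
theorem hasNoSingularPart_of_isBigO_sqrt {s : ℝ} {g : ℝ → ℂ} (hs : s < 0)
    (hg : g =O[𝓝[>] 0] Real.sqrt) : HasNoSingularPart s g := by
  refine hasNoSingularPart_of_tendsto ?_
  obtain ⟨C, hC⟩ := hg.bound
  have h1 : Tendsto (fun x : ℝ ↦ C * x ^ (-s)) (𝓝[>] 0) (𝓝 0) := by
    have h2 : Tendsto (fun x : ℝ ↦ C * x ^ (-s)) (𝓝 0) (𝓝 (C * 0 ^ (-s))) :=
      ((Real.continuousAt_rpow_const 0 (-s) (Or.inr (by linarith))).tendsto).const_mul C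
    rw [Real.zero_rpow (by linarith), mul_zero] at h2
    exact h2.mono_left nhdsWithin_le_nhds
  refine squeeze_zero' ?_ ?_ h1
  · filter_upwards [self_mem_nhdsWithin] with x hx
    have : (0 : ℝ) < x := hx
    positivity
  · filter_upwards [self_mem_nhdsWithin, hC] with x hx hxC
    have hx : (0 : ℝ) < x := hx
    calc x ^ (-s - 1 / 2) * ‖g x‖ ≤ x ^ (-s - 1 / 2) * (C * ‖Real.sqrt x‖) := by gcongr
      _ = C * (x ^ (-s - 1 / 2) * x ^ (1 / 2 : ℝ)) := by
        rw [Real.norm_of_nonneg (Real.sqrt_nonneg _), Real.sqrt_eq_rpow]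
        ring
      _ = C * x ^ (-s) := by
        rw [← Real.rpow_add hx]
        ring_nf

/-- For `s ≤ -1/2` the weight has nonnegative exponent, so it is at most `1` on `(0,1)`. -/
theorem hasNoSingularPart_of_tendsto_zero {s : ℝ} {g : ℝ → ℂ} (hs : s ≤ -1 / 2)
    (hg : Tendsto g (𝓝[>] 0) (𝓝 0)) : HasNoSingularPart s g := by
  refine hasNoSingularPart_of_tendsto ?_
  refine squeeze_zero' ?_ ?_ (by simpa using hg.norm)
  · filter_upwards [self_mem_nhdsWithin] with x hx
    have : (0 : ℝ) < x := hx
    positivity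
  · filter_upwards [Ioo_mem_nhdsGT one_pos] with x hx
    exact mul_le_of_le_one_left (norm_nonneg _)
      (Real.rpow_le_one hx.1.le hx.2.le (by linarith))

/-- Otherwise `‖g t‖ ≥ ε t^(s+1/2) ≥ ε t^(-1/2)` near `0`, and square integrability of `g` would
make `1 / t` integrable at `0`. -/
theorem hasNoSingularPart_of_memLp {s δ : ℝ} {g : ℝ → ℂ} (hs : s ≤ -1) (hδ : 0 < δ)
    (hg : MemLp g 2 (volume.restrict (Ioo 0 δ))) : HasNoSingularPart s g := by
  intro ε hε
  by_contra hcon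
  rw [not_frequently] at hcon
  obtain ⟨r, hr, hrs⟩ := mem_nhdsGT_iff_exists_Ioo_subset.1 hcon
  have hr : (0 : ℝ) < r := hr
  set m := min r (min δ 1) with hm
  have hm0 : 0 < m := lt_min hr (lt_min hδ one_pos)
  have hint : IntegrableOn (fun t ↦ ‖g t‖ ^ 2) (Ioo 0 m) :=
    IntegrableOn.mono_set (hg.integrable_norm_pow two_ne_zero)
      (Ioo_subset_Ioo_right ((min_le_right _ _).trans (min_le_left _ _)))
  have hint2 : IntegrableOn (fun t : ℝ ↦ ε ^ 2 * t ^ (-1 : ℝ)) (Ioo 0 m) := by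
    refine Integrable.mono' hint ?_ ?_
    · exact ((continuousOn_const.mul (ContinuousOn.rpow_const continuousOn_id
        fun t ht ↦ Or.inl ht.1.ne'))).aestronglyMeasurable measurableSet_Ioo
    · filter_upwards [ae_restrict_mem measurableSet_Ioo] with t ht
      have ht0 := ht.1
      have h1 : ε ≤ t ^ (-s - 1 / 2) * ‖g t‖ :=
        not_lt.1 (hrs ⟨ht.1, ht.2.trans_le (min_le_left _ _)⟩)
      have h2 : t ^ (-s - 1 / 2) ≤ t ^ (1 / 2 : ℝ) :=
        Real.rpow_le_rpow_of_exponent_ge ht0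
          (ht.2.le.trans ((min_le_right _ _).trans (min_le_right _ _))) (by linarith)
      have h3 : ε ≤ Real.sqrt t * ‖g t‖ := by
        rw [Real.sqrt_eq_rpow]
        exact h1.trans (by gcongr)
      have h4 : ε ^ 2 ≤ t * ‖g t‖ ^ 2 := by
        calc ε ^ 2 ≤ (Real.sqrt t * ‖g t‖) ^ 2 := by gcongr
          _ = _ := by rw [mul_pow, Real.sq_sqrt ht0.le]
      rw [Real.norm_of_nonneg (by positivity), Real.rpow_neg_one, ← div_eq_mul_inv,
        div_le_iff₀ ht0, mul_comm]
      exact h4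
  have hint3 : IntegrableOn (fun t : ℝ ↦ t ^ (-1 : ℝ)) (Ioo 0 m) := by
    have h1 := hint2.const_mul ((ε ^ 2)⁻¹)
    refine h1.congr (.of_forall fun t ↦ ?_)
    change (ε ^ 2)⁻¹ * (ε ^ 2 * t ^ (-1 : ℝ)) = t ^ (-1 : ℝ)
    rw [← mul_assoc, inv_mul_cancel₀ (by positivity), one_mul]
  rw [intervalIntegral.integrableOn_Ioo_rpow_iff hm0] at hint3
  linarith

/-! ### Hardy's inequality. -/

/-- A function on `(0,y)` whose square has uniformly bounded integrals over `(x,y)` is square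
integrable. -/
theorem memLp_two_of_integral_bounded {f : ℝ → ℂ} {y B : ℝ} (hy : 0 < y)
    (hf : ContinuousOn f (Ioc 0 y))
    (hB : ∀ x, 0 < x → x < y → ∫ t in x..y, ‖f t‖ ^ 2 ≤ B) :
    MemLp f 2 (volume.restrict (Ioo 0 y)) := by
  rw [memLp_two_iff_integrable_sq_norm
    ((hf.mono Ioo_subset_Ioc_self).aestronglyMeasurable measurableSet_Ioo)]
  -- The shift by `2` keeps the left endpoints strictly below `y` already for `n = 0`.
  have hu : ∀ n : ℕ, 0 < y / (n + 2) ∧ y / (n + 2) < y := fun n ↦ by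
    refine ⟨by positivity, div_lt_self hy ?_⟩
    have : (0 : ℝ) ≤ n := n.cast_nonneg
    linarith
  have hlim : Tendsto (fun n : ℕ ↦ y / ((n : ℝ) + 2)) atTop (𝓝 0) :=
    tendsto_const_nhds.div_atTop (tendsto_natCast_atTop_atTop.atTop_add tendsto_const_nhds)
  refine IntegrableOn.mono_set (integrableOn_Ioc_of_intervalIntegral_norm_bounded_left
    (I := B) (a₀ := 0) (b := y) (l := atTop) (fun n : ℕ ↦ ?_) hlim (.of_forall fun n ↦ ?_))
      Ioo_subset_Ioc_self
  · refine ContinuousOn.integrableOn_Icc (ContinuousOn.mono (hf.norm.pow 2) ?_) |>.mono_set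
      Ioc_subset_Icc_self
    exact fun t ht ↦ ⟨(hu n).1.trans_le ht.1, ht.2⟩
  · have := hB _ (hu n).1 (hu n).2
    rw [intervalIntegral.integral_of_le (hu n).2.le] at this
    simpa using this

/-- Hardy's inequality for local solutions: `g = O(√t)` implies that `g / t` is square
integrable. -/
theorem IsLocalSol.exists_memLp_div {s δ : ℝ} {g : ℝ → ℂ} (h : IsLocalSol s δ g) (hs : s ≠ 0)
    (hg : g =O[𝓝[>] 0] Real.sqrt) :
    ∃ r, 0 < r ∧ r < δ ∧ MemLp (fun t ↦ g t / t) 2 (volume.restrict (Ioo 0 r)) := by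
  obtain ⟨C, hC⟩ := hg.bound
  obtain ⟨r₀, hr₀, hr₀s⟩ := mem_nhdsGT_iff_exists_Ioo_subset.1 hC
  have hr₀ : (0 : ℝ) < r₀ := hr₀
  obtain ⟨r, hr, hrm⟩ := exists_between (lt_min hr₀ h.pos)
  have hrδ : r < δ := hrm.trans_le (min_le_right _ _)
  have hb : ∀ t, 0 < t → t ≤ r → ‖g t‖ ^ 2 ≤ C ^ 2 * t := by
    intro t ht htr
    have h1 : ‖g t‖ ≤ C * ‖Real.sqrt t‖ :=
      hr₀s ⟨ht, htr.trans_lt (hrm.trans_le (min_le_left _ _))⟩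
    rw [Real.norm_of_nonneg (Real.sqrt_nonneg t)] at h1
    calc ‖g t‖ ^ 2 ≤ (C * Real.sqrt t) ^ 2 := by gcongr
      _ = C ^ 2 * t := by rw [mul_pow, Real.sq_sqrt ht.le]
  have hgc : ContinuousOn g (Ioo 0 δ) := h.acLoc.continuousOn
  have hcont : ContinuousOn (fun t ↦ g t / (t : ℂ)) (Ioc 0 r) := by
    refine (hgc.mono fun t ht ↦ ⟨ht.1, ht.2.trans_lt hrδ⟩).div
      Complex.continuous_ofReal.continuousOn fun t ht ↦ ?_
    exact_mod_cast ht.1.ne'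
  refine ⟨r, hr, hrδ, memLp_two_of_integral_bounded hr hcont
    (B := (2 * C ^ 2 + energy s g r / |s|) / |s|) fun x hx hxr ↦ ?_⟩
  set v := firstOrder (fun t ↦ -((s + 1 / 2) / t)) g with hv
  have hs' : 0 < |s| := abs_pos.2 hs
  have hpos : ∀ t ∈ uIcc x r, 0 < t := fun t ht ↦ by
    rw [uIcc_of_le hxr.le] at ht
    exact hx.trans_le ht.1
  have hac := h.acLoc x r hx hxr.le hrδ
  -- the function `|g|² / t`
  set F : ℝ → ℝ := fun t ↦ ((g t).re * (g t).re + (g t).im * (g t).im) * t⁻¹ with hF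
  have hFn : ∀ t, F t = ‖g t‖ ^ 2 / t := fun t ↦ by
    rw [hF, ← Complex.normSq_eq_norm_sq, Complex.normSq_apply, div_eq_mul_inv]
  have hinv : AbsolutelyContinuousOnInterval (fun t : ℝ ↦ t⁻¹) x r :=
    .of_hasDerivAt (p' := fun t ↦ -(t ^ 2)⁻¹) (fun t ht ↦ hasDerivAt_inv (hpos t ht).ne')
      ((continuousOn_id.pow 2).inv₀ fun t ht ↦ pow_ne_zero 2 (hpos t ht).ne').neg
  have hFac : AbsolutelyContinuousOnInterval F x r :=
    ((hac.re.fun_mul hac.re).fun_add (hac.im.fun_mul hac.im)).fun_mul hinv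
  -- Multiplying by the sign of `s` makes the main term `2 |s| |g/t|²` positive, so both signs are
  -- handled together.
  set σ : ℝ := ((SignType.sign s : SignType) : ℝ) with hσ
  have hσs : σ * s = |s| := sign_mul_self s
  have hσ1 : |σ| ≤ 1 := by
    rcases lt_trichotomy s 0 with h1 | h1 | h1 <;> simp [hσ, h1]
  have hderiv : ∀ᵐ t ∂volume, t ∈ uIcc x r →
      |s| * ‖g t / (t : ℂ)‖ ^ 2 ≤ σ * deriv F t + ‖v t‖ ^ 2 / |s| := by
    filter_upwards [hac.ae_differentiableAt_complex] with t ht htm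
    have ht0 := hpos t htm
    have hd := (ht htm).hasDerivAt
    have h1 : HasDerivAt (fun t ↦ (g t).re) (deriv g t).re t :=
      Complex.reCLM.hasFDerivAt.comp_hasDerivAt t hd
    have h2 : HasDerivAt (fun t ↦ (g t).im) (deriv g t).im t :=
      Complex.imCLM.hasFDerivAt.comp_hasDerivAt t hd
    have h3 := (((h1.fun_mul h1).fun_add (h2.fun_mul h2)).fun_mul (hasDerivAt_inv ht0.ne')).deriv
    have hvt : deriv g t = v t + ((s + 1 / 2) / t : ℝ) * g t := by
      rw [hv, firstOrder]
      push_cast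
      ring
    have hre : (deriv g t).re = (v t).re + (s + 1 / 2) / t * (g t).re := by
      rw [hvt, Complex.add_re, Complex.re_ofReal_mul]
    have him : (deriv g t).im = (v t).im + (s + 1 / 2) / t * (g t).im := by
      rw [hvt, Complex.add_im, Complex.im_ofReal_mul]
    have h4 : deriv F t = 2 * s * ‖g t / (t : ℂ)‖ ^ 2 +
        2 * ((v t).re * ((g t).re / t) + (v t).im * ((g t).im / t)) := by
      rw [hF, h3, hre, him, norm_div, Complex.norm_real, Real.norm_of_nonneg ht0.le, div_pow,
        ← Complex.normSq_eq_norm_sq, Complex.normSq_apply]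
      field_simp
      ring
    have h5 : ‖g t / (t : ℂ)‖ ^ 2 = ((g t).re / t) ^ 2 + ((g t).im / t) ^ 2 := by
      rw [norm_div, Complex.norm_real, Real.norm_of_nonneg ht0.le, div_pow,
        ← Complex.normSq_eq_norm_sq, Complex.normSq_apply]
      field_simp
    have h6 : ‖v t‖ ^ 2 = (v t).re ^ 2 + (v t).im ^ 2 := by
      rw [← Complex.normSq_eq_norm_sq, Complex.normSq_apply]
      ring
    set p := (g t).re / t
    set q := (g t).im / t
    set a := (v t).re
    set b := (v t).im
    -- Young's inequality with parameter `|s|`: the cross term costs only half of `2 |s| |g/t|²`,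
    -- and the other half remains on the left-hand side.
    have h7 : -(2 * σ * (a * p + b * q)) ≤ |s| * (p ^ 2 + q ^ 2) + (a ^ 2 + b ^ 2) / |s| := by
      have hσ2 : σ ^ 2 ≤ 1 := by rw [← sq_abs]; exact pow_le_one₀ (abs_nonneg _) hσ1
      have e1 : |s| * (p ^ 2 + q ^ 2) + (a ^ 2 + b ^ 2) / |s| + 2 * σ * (a * p + b * q) =
          ((|s| * p + σ * a) ^ 2 + (|s| * q + σ * b) ^ 2 +
            (1 - σ ^ 2) * (a ^ 2 + b ^ 2)) / |s| := by
        field_simp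
        ring
      have e2 : 0 ≤ ((|s| * p + σ * a) ^ 2 + (|s| * q + σ * b) ^ 2 +
            (1 - σ ^ 2) * (a ^ 2 + b ^ 2)) / |s| := by
        have : 0 ≤ 1 - σ ^ 2 := by linarith
        positivity
      linarith
    rw [h4, h5, h6]
    have h8 : σ * (2 * s * (p ^ 2 + q ^ 2) + 2 * (a * p + b * q)) =
        2 * |s| * (p ^ 2 + q ^ 2) + 2 * σ * (a * p + b * q) := by
      rw [← hσs]
      ring
    rw [h8]
    linarith
  have hvi : IntervalIntegrable (fun t ↦ ‖v t‖ ^ 2) volume x r :=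
    h.intervalIntegrable_sq.mono_set (by
      rw [uIcc_of_le hxr.le, uIcc_of_le h.pos.le]
      exact Icc_subset_Icc hx.le hrδ.le)
  have hqi : IntervalIntegrable (fun t ↦ ‖g t / (t : ℂ)‖ ^ 2) volume x r := by
    refine ContinuousOn.intervalIntegrable ((hcont.mono ?_).norm.pow 2)
    rw [uIcc_of_le hxr.le]
    exact fun t ht ↦ ⟨hx.trans_le ht.1, ht.2⟩
  have hmono := intervalIntegral.integral_mono_ae_restrict hxr.le (hqi.const_mul |s|)
    ((hFac.intervalIntegrable_deriv.const_mul σ).add (hvi.div_const |s|)) (by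
      rw [EventuallyLE, ae_restrict_iff' measurableSet_Icc]
      filter_upwards [hderiv] with t ht htm
      exact ht (by rwa [uIcc_of_le hxr.le]))
  have hsplit : ∫ t in x..r, (σ * deriv F t + ‖v t‖ ^ 2 / |s|) =
      σ * (F r - F x) + (∫ t in x..r, ‖v t‖ ^ 2) / |s| := by
    rw [intervalIntegral.integral_add (hFac.intervalIntegrable_deriv.const_mul σ)
      (hvi.div_const |s|), intervalIntegral.integral_const_mul, hFac.integral_deriv_eq_sub,
      intervalIntegral.integral_div]
  rw [intervalIntegral.integral_const_mul] at hmono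
  have hmono' : |s| * ∫ t in x..r, ‖g t / (t : ℂ)‖ ^ 2 ≤
      σ * (F r - F x) + (∫ t in x..r, ‖v t‖ ^ 2) / |s| := by
    rw [← hsplit]
    exact hmono
  have hE : ∫ t in x..r, ‖v t‖ ^ 2 ≤ energy s g r :=
    intervalIntegral.integral_mono_interval hx.le hxr.le le_rfl (.of_forall fun t ↦ by positivity)
      (h.intervalIntegrable_sq.mono_set (by
        rw [uIcc_of_le hr.le, uIcc_of_le h.pos.le]
        exact Icc_subset_Icc le_rfl hrδ.le))
  have hFb : ∀ t, 0 < t → t ≤ r → |F t| ≤ C ^ 2 := fun t ht htr ↦ by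
    rw [hFn, abs_of_nonneg (by positivity), div_le_iff₀ ht]
    exact hb t ht htr
  have hFd : σ * (F r - F x) ≤ 2 * C ^ 2 := by
    calc σ * (F r - F x) ≤ |σ| * |F r - F x| := by rw [← abs_mul]; exact le_abs_self _
      _ ≤ 1 * (|F r| + |F x|) := by
        gcongr
        exact abs_sub _ _
      _ ≤ 2 * C ^ 2 := by linarith [hFb r hr le_rfl, hFb x hx hxr.le]
  rw [le_div_iff₀ hs', mul_comm]
  refine hmono'.trans (add_le_add hFd ?_)
  gcongr

/-! ### Reduction of the two endpoints to the local model. -/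

/-- A continuous coefficient on `(a,b)` which equals `-(s_a + 1/2)/(x-a)` near `a` and
`(s_b + 1/2)/(b-x)` near `b`. -/
structure IsBesselPotential (a b sa sb δ : ℝ) (φ : ℝ → ℝ) : Prop where
  pos : 0 < δ
  lt : δ < b - a
  continuousOn : ContinuousOn φ (Ioo a b)
  left : ∀ x ∈ Ioo a (a + δ), φ x = -((sa + 1 / 2) / (x - a))
  right : ∀ x ∈ Ioo (b - δ) b, φ x = (sb + 1 / 2) / (b - x)

theorem isBesselPotential_potential {a b ε : ℝ} (hε : 0 < ε) (hε' : ε < (b - a) / 2)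
    {χa χb : ℝ → ℝ} (hχ : IsCutoffPair a b ε χa χb) (sa sb : ℝ) :
    IsBesselPotential a b sa sb (min ε (b - a - 2 * ε)) (potential a b sa sb χa χb) where
  -- Within distance `ε` of an endpoint its own step function is `1`; within distance `b - a - 2ε`
  -- the opposite one is `0`. The minimum secures both, and it is positive because `ε < (b - a) /
  -- 2`.
  pos := lt_min hε (by linarith)
  lt := (min_le_left _ _).trans_lt (by linarith)
  continuousOn := by
    have ha := hχ.smooth_left.continuousOn.mono Ioo_subset_Icc_self
    have hb := hχ.smooth_right.continuousOn.mono Ioo_subset_Icc_self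
    have h1 : ContinuousOn (fun x ↦ (sa + 1 / 2) / (x - a)) (Ioo a b) :=
      continuousOn_const.div (continuousOn_id.sub continuousOn_const)
        fun x hx ↦ (sub_pos.2 hx.1).ne'
    have h2 : ContinuousOn (fun x ↦ (sb + 1 / 2) / (b - x)) (Ioo a b) :=
      continuousOn_const.div (continuousOn_const.sub continuousOn_id)
        fun x hx ↦ (sub_pos.2 hx.2).ne'
    exact (h1.neg.mul ha).add (h2.mul hb)
  left := fun x hx ↦ by
    have h1 : x ≤ a + ε := by linarith [hx.2, min_le_left ε (b - a - 2 * ε)]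
    have h2 : x ≤ b - 2 * ε := by linarith [hx.2, min_le_right ε (b - a - 2 * ε)]
    rw [potential, hχ.left_one x ⟨hx.1.le, h1⟩, hχ.right_zero x ⟨hx.1.le, h2⟩]
    ring
  right := fun x hx ↦ by
    have h1 : b - ε ≤ x := by linarith [hx.1, min_le_left ε (b - a - 2 * ε)]
    have h2 : a + 2 * ε ≤ x := by linarith [hx.1, min_le_right ε (b - a - 2 * ε)]
    rw [potential, hχ.right_one x ⟨h1, hx.2.le⟩, hχ.left_zero x ⟨h2, hx.2.le⟩]
    ring

theorem ACLoc.absolutelyContinuousOnInterval {a b x y : ℝ} {f : ℝ → ℂ} (hf : ACLoc a b f)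
    (hx : x ∈ Ioo a b) (hy : y ∈ Ioo a b) : AbsolutelyContinuousOnInterval f x y := by
  rcases le_total x y with h | h
  · exact hf x y hx.1 h hy.2
  · exact (hf y x hy.1 h hx.2).symm

theorem measurePreserving_affine {p σ : ℝ} (hσ : σ = 1 ∨ σ = -1) :
    MeasurePreserving (fun t : ℝ ↦ p + σ * t) := by
  rcases hσ with rfl | rfl
  · simpa using measurePreserving_add_left volume p
  · simpa [sub_eq_add_neg] using Measure.measurePreserving_sub_left volume p

theorem MemLp_comp_affine {F : Type*} [NormedAddCommGroup F] {p σ : ℝ} (hσ : σ = 1 ∨ σ = -1)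
    {S T : Set ℝ} (hT : MeasurableSet T) (hS : MapsTo (fun t ↦ p + σ * t) S T) {f : ℝ → F}
    (hf : MemLp f 2 (volume.restrict T)) :
    MemLp (fun t ↦ f (p + σ * t)) 2 (volume.restrict S) :=
  (hf.comp_measurePreserving ((measurePreserving_affine hσ).restrict_preimage hT)).mono_measure
    (Measure.restrict_mono_set _ hS)

/-- With `σ = 1` at the left endpoint and `σ = -1` at the right one, both singular coefficients
become `-(s + 1/2) / t`: the reflection changes the sign of the derivative and hence that of the
coefficient. -/
theorem firstOrder_comp_affine {φ ψ : ℝ → ℝ} {f : ℝ → ℂ} {p σ t : ℝ}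
    (h : ψ t = σ * φ (p + σ * t)) :
    firstOrder ψ (fun t ↦ f (p + σ * t)) t = σ * firstOrder φ f (p + σ * t) := by
  have hd : deriv (fun t ↦ f (p + σ * t)) t = σ • deriv f (p + σ * t) := by
    have h1 := deriv_comp_mul_left σ (fun u ↦ f (p + u)) t
    rw [h1, deriv_comp_const_add]
  rw [firstOrder, hd, h, firstOrder, Complex.real_smul]
  push_cast
  ring

theorem isLocalSol_comp_affine {a b s δ p σ : ℝ} {φ : ℝ → ℝ} {f : ℝ → ℂ} (hσ : σ = 1 ∨ σ = -1)
    (hδ : 0 < δ) (hmem : ∀ t ∈ Ioo 0 δ, p + σ * t ∈ Ioo a b)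
    (hφ : ∀ t ∈ Ioo 0 δ, -((s + 1 / 2) / t) = σ * φ (p + σ * t)) (hf : ACLoc a b f)
    (hL : MemLp (firstOrder φ f) 2 (volume.restrict (Ioo a b))) :
    IsLocalSol s δ (fun t ↦ f (p + σ * t)) where
  pos := hδ
  acLoc := fun c d hc hcd hd ↦ AbsolutelyContinuousOnInterval.comp_affine
    (by rcases hσ with rfl | rfl <;> norm_num) (hf.absolutelyContinuousOnInterval
      (hmem c ⟨hc, hcd.trans_lt hd⟩) (hmem d ⟨hc.trans_le hcd, hd⟩))
  memLp := by
    refine ((MemLp_comp_affine hσ measurableSet_Ioo hmem hL).const_mul (σ : ℂ)).ae_eq ?_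
    filter_upwards [ae_restrict_mem measurableSet_Ioo] with t ht
    exact (firstOrder_comp_affine (ψ := fun t ↦ -((s + 1 / 2) / t)) (hφ t ht)).symm

/-- Bounds local energies by a global norm, so that a graph-convergent sequence has uniformly
bounded local energies. -/
theorem energy_comp_affine_le {a b s δ p σ y : ℝ} {φ : ℝ → ℝ} {f : ℝ → ℂ} (hσ : σ = 1 ∨ σ = -1)
    (hmem : ∀ t ∈ Ioo 0 δ, p + σ * t ∈ Ioo a b)
    (hφ : ∀ t ∈ Ioo 0 δ, -((s + 1 / 2) / t) = σ * φ (p + σ * t))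
    (hL : MemLp (firstOrder φ f) 2 (volume.restrict (Ioo a b))) (hy : 0 < y) (hyδ : y < δ) :
    energy s (fun t ↦ f (p + σ * t)) y ≤ ∫ x in Ioo a b, ‖firstOrder φ f x‖ ^ 2 := by
  have hT := measurePreserving_affine (p := p) hσ
  have hemb : MeasurableEmbedding (fun t : ℝ ↦ p + σ * t) := by
    have hσ0 : σ ≠ 0 := by rcases hσ with rfl | rfl <;> norm_num
    exact ((Homeomorph.mulLeft₀ σ hσ0).trans (Homeomorph.addLeft p)).measurableEmbedding
  rw [← hT.setIntegral_preimage_emb hemb, energy, intervalIntegral.integral_of_le hy.le]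
  have hsub : Ioc 0 y ⊆ (fun t : ℝ ↦ p + σ * t) ⁻¹' Ioo a b := fun t ht ↦
    hmem t ⟨ht.1, ht.2.trans_lt hyδ⟩
  have hint : IntegrableOn (fun t ↦ ‖firstOrder φ f (p + σ * t)‖ ^ 2)
      ((fun t : ℝ ↦ p + σ * t) ⁻¹' Ioo a b) :=
    (MemLp_comp_affine hσ measurableSet_Ioo (fun t ht ↦ ht) hL).integrable_norm_pow two_ne_zero
  calc _ = ∫ t in Ioc 0 y, ‖firstOrder φ f (p + σ * t)‖ ^ 2 := by
        refine setIntegral_congr_fun measurableSet_Ioc fun t ht ↦ ?_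
        rw [firstOrder_comp_affine (ψ := fun t ↦ -((s + 1 / 2) / t)) (φ := φ)
          (hφ t ⟨ht.1, ht.2.trans_lt hyδ⟩), norm_mul]
        rcases hσ with rfl | rfl <;> simp
    _ ≤ _ := setIntegral_mono_set hint (.of_forall fun t ↦ by positivity) hsub.eventuallyLE

theorem integral_norm_sq_eq {a b : ℝ} (u : L2 a b) :
    ∫ x in Ioo a b, ‖u x‖ ^ 2 = ‖u‖ ^ 2 := by
  have h := L2.inner_def (𝕜 := ℂ) u u
  rw [inner_self_eq_norm_sq_to_K] at h
  have h2 : ∀ x, (inner ℂ (u x) (u x) : ℂ) = ((‖u x‖ ^ 2 : ℝ) : ℂ) := fun x ↦ by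
    rw [inner_self_eq_norm_sq_to_K]
    norm_cast
  simp only [h2] at h
  rw [integral_complex_ofReal] at h
  exact (Complex.ofReal_injective (by simpa using! h)).symm

theorem sqrt_integral_le_norm {a b x y : ℝ} (u : L2 a b) (hx : a < x) (hxy : x ≤ y) (hy : y < b) :
    Real.sqrt (∫ t in x..y, ‖u t‖ ^ 2) ≤ ‖u‖ := by
  rw [← Real.sqrt_sq (norm_nonneg u), ← integral_norm_sq_eq, intervalIntegral.integral_of_le hxy]
  refine Real.sqrt_le_sqrt (setIntegral_mono_set ?_ (.of_forall fun t ↦ by positivity)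
    (LE.le.eventuallyLE fun t ht ↦ ⟨hx.trans ht.1, ht.2.trans_lt hy⟩))
  exact (Lp.memLp u).integrable_norm_pow two_ne_zero

/-- Intervals with rational endpoints suffice, so the exceptional set is a countable union of null
sets. -/
theorem ae_restrict_Ioo_of_forall_Icc {a b : ℝ} {p : ℝ → Prop}
    (h : ∀ c d, a < c → c ≤ d → d < b → ∀ᵐ x, x ∈ Icc c d → p x) :
    ∀ᵐ x ∂volume.restrict (Ioo a b), p x := by
  rw [ae_restrict_iff' measurableSet_Ioo]
  have h1 : ∀ᵐ x : ℝ, ∀ q r : ℚ, a < q → (q : ℝ) ≤ r → (r : ℝ) < b → x ∈ Icc (q : ℝ) r → p x := by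
    simp only [ae_all_iff]
    exact fun q r h1 h2 h3 ↦ h q r h1 h2 h3
  filter_upwards [h1] with x hx hxm
  obtain ⟨q, hq1, hq2⟩ := exists_rat_btwn hxm.1
  obtain ⟨r, hr1, hr2⟩ := exists_rat_btwn hxm.2
  exact hx q r hq1 (hq2.trans hr1).le hr2 ⟨hq2.le, hr1.le⟩

/-! ### Graph limits of elements of the maximal domain. -/

section Maximal

variable {a b : ℝ} {φ : ℝ → ℝ}

/-- An integrating factor for `d/dx + φ`. -/
noncomputable def expFactor (a b : ℝ) (φ : ℝ → ℝ) (x : ℝ) : ℝ :=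
  Real.exp (∫ t in (a + b) / 2..x, φ t)

theorem expFactor_ne_zero (x : ℝ) : (expFactor a b φ x : ℂ) ≠ 0 := by
  exact_mod_cast (Real.exp_pos _).ne'

theorem uIcc_subset_Ioo {x y : ℝ} (hx : x ∈ Ioo a b) (hy : y ∈ Ioo a b) : uIcc x y ⊆ Ioo a b :=
  (convex_Ioo a b).ordConnected.uIcc_subset hx hy

theorem hasDerivAt_expFactor (hφ : ContinuousOn φ (Ioo a b)) {x : ℝ} (hx : x ∈ Ioo a b) :
    HasDerivAt (expFactor a b φ) (φ x * expFactor a b φ x) x := by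
  have hm : (a + b) / 2 ∈ Ioo a b := by
    have := hx.1.trans hx.2
    constructor <;> linarith
  have h1 : HasDerivAt (fun y ↦ ∫ t in (a + b) / 2..y, φ t) (φ x) x :=
    intervalIntegral.integral_hasDerivAt_right
      ((hφ.mono (uIcc_subset_Ioo hm hx)).intervalIntegrable)
      (hφ.stronglyMeasurableAtFilter isOpen_Ioo x hx) (hφ.continuousAt (isOpen_Ioo.mem_nhds hx))
  rw [mul_comm]
  exact h1.exp

/-- Variation of constants: a representative is determined on all of `(a,b)` by its value at one
point and by its image. -/
theorem MaxRep.expFactor_sub (hφ : ContinuousOn φ (Ioo a b)) {u : L2 a b} {f : ℝ → ℂ}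
    (hf : MaxRep a b φ u f) {w : L2 a b}
    (hw : w =ᵐ[volume.restrict (Ioo a b)] firstOrder φ f) {x y : ℝ} (hx : x ∈ Ioo a b)
    (hy : y ∈ Ioo a b) :
    (expFactor a b φ y : ℂ) * f y - (expFactor a b φ x : ℂ) * f x =
      ∫ t in x..y, (expFactor a b φ t : ℂ) * w t := by
  have hsub := uIcc_subset_Ioo hx hy
  rw [integratingFactor (hf.acLoc.absolutelyContinuousOnInterval hx hy)
    (fun t ht ↦ hasDerivAt_expFactor hφ (hsub ht)) (hφ.mono hsub)]
  refine intervalIntegral.integral_congr_ae ?_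
  rw [EventuallyEq, ae_restrict_iff' measurableSet_Ioo] at hw
  filter_upwards [hw] with t ht htm
  rw [ht (hsub (uIoc_subset_uIcc htm))]

theorem continuousOn_expFactor (hφ : ContinuousOn φ (Ioo a b)) :
    ContinuousOn (expFactor a b φ) (Ioo a b) := fun _ hx ↦
  (hasDerivAt_expFactor hφ hx).continuousAt.continuousWithinAt

theorem intervalIntegrable_continuousOn_mul {P : ℝ → ℝ} (hP : ContinuousOn P (Ioo a b)) {w : ℝ → ℂ}
    (hw : MemLp w 2 (volume.restrict (Ioo a b))) {x y : ℝ} (hx : x ∈ Ioo a b) (hy : y ∈ Ioo a b) :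
    IntervalIntegrable (fun t ↦ (P t : ℂ) * w t) volume x y := by
  have hsub := uIcc_subset_Ioo hx hy
  have hwi : IntervalIntegrable w volume x y := by
    rw [intervalIntegrable_iff]
    exact (hw.integrable (by norm_num)).mono_measure
      (Measure.restrict_mono_set _ (uIoc_subset_uIcc.trans hsub))
  exact hwi.continuousOn_mul (Complex.continuous_ofReal.comp_continuousOn (hP.mono hsub))

/-- On a compact subinterval `P` is bounded, so by Cauchy-Schwarz the integral depends continuously
on the `L²` function. -/
theorem tendsto_integral_mul_of_tendsto {P : ℝ → ℝ} (hP : ContinuousOn P (Ioo a b))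
    {w : ℕ → L2 a b} {w₀ : L2 a b} (hw : Tendsto w atTop (𝓝 w₀)) {x y : ℝ} (hx : x ∈ Ioo a b)
    (hy : y ∈ Ioo a b) :
    Tendsto (fun n ↦ ∫ t in x..y, (P t : ℂ) * w n t) atTop
      (𝓝 (∫ t in x..y, (P t : ℂ) * w₀ t)) := by
  wlog hxy : x ≤ y generalizing x y
  · simp only [intervalIntegral.integral_symm y x]
    exact (this hy hx (le_of_not_ge hxy)).neg
  rw [tendsto_iff_norm_sub_tendsto_zero]
  have hsub : Ioc x y ⊆ Ioo a b := fun t ht ↦ ⟨hx.1.trans ht.1, ht.2.trans_lt hy.2⟩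
  have hlim : Tendsto (fun n ↦ Real.sqrt (∫ t in x..y, P t ^ 2) * ‖w n - w₀‖) atTop (𝓝 0) := by
    simpa using (tendsto_iff_norm_sub_tendsto_zero.1 hw).const_mul _
  refine squeeze_zero (fun n ↦ norm_nonneg _) (fun n ↦ ?_) hlim
  rw [← intervalIntegral.integral_sub
    (intervalIntegrable_continuousOn_mul hP (Lp.memLp (w n)) hx hy)
    (intervalIntegrable_continuousOn_mul hP (Lp.memLp w₀) hx hy)]
  have hcongr : ∫ t in x..y, ((P t : ℂ) * w n t - (P t : ℂ) * w₀ t) =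
      ∫ t in x..y, (P t : ℂ) * (w n - w₀ : L2 a b) t := by
    refine intervalIntegral.integral_congr_ae ?_
    have h1 := Lp.coeFn_sub (w n) w₀
    rw [EventuallyEq, ae_restrict_iff' measurableSet_Ioo] at h1
    filter_upwards [h1] with t ht htm
    rw [uIoc_of_le hxy] at htm
    rw [ht (hsub htm), Pi.sub_apply]
    ring
  rw [hcongr]
  refine (norm_integral_mul_le hxy (hP.mono (by
    rw [← uIcc_of_le hxy]; exact uIcc_subset_Ioo hx hy))
    ((Lp.memLp (w n - w₀)).mono_measure (Measure.restrict_mono_set _ hsub))).trans ?_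
  exact mul_le_mul_of_nonneg_left (sqrt_integral_le_norm _ hx.1 hxy hy.2) (Real.sqrt_nonneg _)

/-- A graph limit of maximal elements is maximal, and representatives converge pointwise along a
subsequence. -/
theorem exists_maxRep_of_tendsto (hab : a < b) (hφ : ContinuousOn φ (Ioo a b)) {u : ℕ → L2 a b}
    {w : ℕ → L2 a b} {f : ℕ → ℝ → ℂ} (hf : ∀ n, MaxRep a b φ (u n) (f n))
    (hw : ∀ n, w n =ᵐ[volume.restrict (Ioo a b)] firstOrder φ (f n)) {u₀ w₀ : L2 a b}
    (hu₀ : Tendsto u atTop (𝓝 u₀)) (hw₀ : Tendsto w atTop (𝓝 w₀)) :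
    ∃ F : ℝ → ℂ, MaxRep a b φ u₀ F ∧ w₀ =ᵐ[volume.restrict (Ioo a b)] firstOrder φ F ∧
      ∃ ns : ℕ → ℕ, StrictMono ns ∧ ∀ x ∈ Ioo a b, Tendsto (fun k ↦ f (ns k) x) atTop (𝓝 (F x)) := by
  obtain ⟨ns, hns, hae⟩ := (tendstoInMeasure_of_tendsto_Lp hu₀).exists_seq_tendsto_ae
  have hae2 : ∀ᵐ x ∂volume.restrict (Ioo a b), x ∈ Ioo a b ∧
      Tendsto (fun k ↦ f (ns k) x) atTop (𝓝 (u₀ x)) := by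
    filter_upwards [hae, ae_all_iff.2 fun n ↦ (hf n).ae_eq,
      ae_restrict_mem measurableSet_Ioo] with x h1 h2 h3
    exact ⟨h3, by simpa only [h2] using h1⟩
  -- A nonzero measure is needed to pick a base point `x₀` at which the subsequence converges.
  have : NeZero (volume.restrict (Ioo a b)) := ⟨by simp [Measure.restrict_eq_zero, hab]⟩
  obtain ⟨x₀, hx₀, hlim₀⟩ := hae2.exists
  set E := expFactor a b φ with hE
  have hEc : ContinuousOn E (Ioo a b) := continuousOn_expFactor hφ
  -- The limit is prescribed by variation of constants from the limiting value at `x₀` and the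
  -- limiting image `w₀`; this turns almost everywhere convergence into convergence at every point
  -- of `(a,b)`.
  set F : ℝ → ℂ := fun y ↦ (E y : ℂ)⁻¹ * ((E x₀ : ℂ) * u₀ x₀ + ∫ t in x₀..y, (E t : ℂ) * w₀ t)
    with hF
  have hFlim : ∀ x ∈ Ioo a b, Tendsto (fun k ↦ f (ns k) x) atTop (𝓝 (F x)) := by
    intro x hx
    have h1 := (hlim₀.const_mul (E x₀ : ℂ)).add
      ((tendsto_integral_mul_of_tendsto hEc hw₀ hx₀ hx).comp hns.tendsto_atTop)
    refine (h1.const_mul (E x : ℂ)⁻¹).congr fun k ↦ ?_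
    rw [Function.comp_apply, ← (hf (ns k)).expFactor_sub hφ (hw (ns k)) hx₀ hx]
    have := expFactor_ne_zero (a := a) (b := b) (φ := φ) x
    rw [add_sub_cancel, ← mul_assoc, inv_mul_cancel₀ this, one_mul]
  have hEinv : ∀ x ∈ Ioo a b, HasDerivAt (fun x ↦ (E x)⁻¹) (-(φ x) * (E x)⁻¹) x := by
    intro x hx
    have h1 := (hasDerivAt_expFactor hφ hx).fun_inv (Real.exp_pos _).ne'
    refine h1.congr_deriv ?_
    have : expFactor a b φ x ≠ 0 := (Real.exp_pos _).ne'
    rw [← hE] at this ⊢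
    field_simp
  have hFac : ACLoc a b F := by
    intro c d hc hcd hd
    have hcm : c ∈ Ioo a b := ⟨hc, hcd.trans_lt hd⟩
    have hdm : d ∈ Ioo a b := ⟨hc.trans_le hcd, hd⟩
    have hsub := uIcc_subset_Ioo hcm hdm
    have h1 : AbsolutelyContinuousOnInterval (fun x ↦ ((E x)⁻¹)) c d :=
      .of_hasDerivAt (fun x hx ↦ hEinv x (hsub hx)) ((hφ.mono hsub).neg.mul
        fun x hx ↦ (hEinv x (hsub hx)).continuousAt.continuousWithinAt)
    have h2 := (intervalIntegrable_continuousOn_mul hEc (Lp.memLp w₀) hcm hdm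
      ).absolutelyContinuousOnInterval_complex left_mem_uIcc
    have h3 : AbsolutelyContinuousOnInterval
        (fun _ : ℝ ↦ (E x₀ : ℂ) * u₀ x₀ + ∫ t in x₀..c, (E t : ℂ) * w₀ t) c d :=
      (LipschitzWith.const _).lipschitzOnWith.absolutelyContinuousOnInterval
    refine (h1.ofReal.complex_mul (h3.fun_add h2)).congr fun x hx ↦ ?_
    have h4 := intervalIntegral.integral_add_adjacent_intervals
      (intervalIntegrable_continuousOn_mul hEc (Lp.memLp w₀) hx₀ hcm)
      (intervalIntegrable_continuousOn_mul hEc (Lp.memLp w₀) hcm (hsub hx))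
    rw [hF]
    simp only
    rw [← h4, Complex.ofReal_inv]
    ring
  have hFd : firstOrder φ F =ᵐ[volume.restrict (Ioo a b)] w₀ := by
    refine ae_restrict_Ioo_of_forall_Icc fun c d hc hcd hd ↦ ?_
    have hcm : c ∈ Ioo a b := ⟨hc, hcd.trans_lt hd⟩
    have hdm : d ∈ Ioo a b := ⟨hc.trans_le hcd, hd⟩
    have hsub := uIcc_subset_Ioo hcm hdm
    filter_upwards [(intervalIntegrable_continuousOn_mul hEc (Lp.memLp w₀) hcm hdm
      ).ae_hasDerivAt_integral] with x hx hxm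
    rw [← uIcc_of_le hcd] at hxm
    have hxI := hsub hxm
    have h1 := hx hxm c left_mem_uIcc
    have h2 : (fun y ↦ ∫ t in x₀..y, (E t : ℂ) * w₀ t) =ᶠ[𝓝 x]
        fun y ↦ (∫ t in x₀..c, (E t : ℂ) * w₀ t) + ∫ t in c..y, (E t : ℂ) * w₀ t := by
      filter_upwards [isOpen_Ioo.mem_nhds hxI] with y hy
      exact (intervalIntegral.integral_add_adjacent_intervals
        (intervalIntegrable_continuousOn_mul hEc (Lp.memLp w₀) hx₀ hcm)
        (intervalIntegrable_continuousOn_mul hEc (Lp.memLp w₀) hcm hy)).symm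
    have h3 := (h1.const_add (∫ t in x₀..c, (E t : ℂ) * w₀ t)).congr_of_eventuallyEq h2
    have h4 := ((hEinv x hxI).ofReal_comp.fun_mul (h3.const_add ((E x₀ : ℂ) * u₀ x₀)))
    have hF2 : F = fun y ↦ (((E y)⁻¹ : ℝ) : ℂ) *
        ((E x₀ : ℂ) * u₀ x₀ + ∫ t in x₀..y, (E t : ℂ) * w₀ t) := by
      rw [hF]
      simp only [Complex.ofReal_inv]
    rw [← hF2] at h4
    have : (E x : ℂ) ≠ 0 := expFactor_ne_zero x
    rw [firstOrder, h4.deriv, hF]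
    push_cast
    field_simp
    ring
  have hFae : u₀ =ᵐ[volume.restrict (Ioo a b)] F := by
    filter_upwards [hae2] with x hx
    exact tendsto_nhds_unique hx.2 (hFlim x hx.1)
  exact ⟨F, ⟨hFac, hFae, (memLp_congr_ae hFd).2 (Lp.memLp w₀)⟩, hFd.symm, ns, hns, hFlim⟩

end Maximal

/-! ### Closedness, closability and the graph of the minimal operator. -/

section Operators

variable {a b : ℝ} {φ : ℝ → ℝ}

theorem mem_graph_maxOp_iff {u w : L2 a b} :
    (u, w) ∈ (maxOp a b φ).graph ↔
      ∃ f, MaxRep a b φ u f ∧ w =ᵐ[volume.restrict (Ioo a b)] firstOrder φ f := by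
  rw [LinearPMap.mem_graph_iff]
  constructor
  · rintro ⟨⟨u', f, hf⟩, rfl, hw⟩
    obtain rfl : maxOp a b φ ⟨u', f, hf⟩ = w := hw
    exact ⟨f, hf, maxOp_ae_eq ⟨u', f, hf⟩ hf⟩
  · rintro ⟨f, hf, hw⟩
    exact ⟨⟨u, f, hf⟩, rfl, Lp.ext ((maxOp_ae_eq ⟨u, f, hf⟩ hf).trans hw.symm)⟩

theorem mem_graph_preMinOp_iff {u w : L2 a b} :
    (u, w) ∈ (preMinOp a b φ).graph ↔
      (u, w) ∈ (maxOp a b φ).graph ∧ u ∈ compactlySupported a b := by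
  rw [LinearPMap.mem_graph_iff, LinearPMap.mem_graph_iff]
  constructor
  · rintro ⟨⟨u', hu'⟩, rfl, hw⟩
    exact ⟨⟨⟨u', hu'.2⟩, rfl, hw⟩, hu'.1⟩
  · rintro ⟨⟨⟨u', hu'⟩, rfl, hw⟩, h⟩
    exact ⟨⟨u', ⟨h, hu'⟩⟩, rfl, hw⟩

theorem maxOp_isClosed (hab : a < b) (hφ : ContinuousOn φ (Ioo a b)) :
    (maxOp a b φ).IsClosed := by
  refine isClosed_of_closure_subset fun p hp ↦ ?_
  obtain ⟨q, hq, hlim⟩ := mem_closure_iff_seq_limit.1 hp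
  choose f hf hw using fun n ↦ mem_graph_maxOp_iff.1 (show ((q n).1, (q n).2) ∈ _ from hq n)
  obtain ⟨F, hF, hw₀, -⟩ := exists_maxRep_of_tendsto hab hφ hf hw
    ((continuous_fst.tendsto p).comp hlim) ((continuous_snd.tendsto p).comp hlim)
  exact mem_graph_maxOp_iff.2 ⟨F, hF, hw₀⟩

theorem preMinOp_le_maxOp : preMinOp a b φ ≤ maxOp a b φ :=
  LinearPMap.domRestrict_le

/-- A restriction of a closed operator is closable. -/
theorem preMinOp_isClosable (hab : a < b) (hφ : ContinuousOn φ (Ioo a b)) :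
    (preMinOp a b φ).IsClosable :=
  (maxOp_isClosed hab hφ).isClosable.leIsClosable preMinOp_le_maxOp

theorem minOp_le_maxOp (hab : a < b) (hφ : ContinuousOn φ (Ioo a b)) :
    minOp a b φ ≤ maxOp a b φ := by
  have h := (maxOp_isClosed hab hφ).isClosable.closure_mono preMinOp_le_maxOp
  have h2 : (maxOp a b φ).closure = maxOp a b φ := by
    refine LinearPMap.eq_of_eq_graph ?_
    rw [← (maxOp_isClosed hab hφ).isClosable.graph_closure_eq_closure_graph]
    exact (maxOp_isClosed hab hφ).submodule_topologicalClosure_eq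
  rwa [h2] at h

theorem mem_graph_minOp_iff (hab : a < b) (hφ : ContinuousOn φ (Ioo a b)) {u w : L2 a b} :
    (u, w) ∈ (minOp a b φ).graph ↔ ∃ q : ℕ → L2 a b × L2 a b,
      (∀ n, q n ∈ (preMinOp a b φ).graph) ∧ Tendsto q atTop (𝓝 (u, w)) := by
  rw [minOp, ← (preMinOp_isClosable hab hφ).graph_closure_eq_closure_graph]
  exact mem_closure_iff_seq_limit

theorem minOp_eq_maxOp (hab : a < b) (hφ : ContinuousOn φ (Ioo a b))
    (h : (maxOp a b φ).domain ≤ (minOp a b φ).domain) : minOp a b φ = maxOp a b φ :=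
  LinearPMap.eq_of_le_of_domain_eq (minOp_le_maxOp hab hφ)
    (le_antisymm (minOp_le_maxOp hab hφ).1 h)

theorem MaxRep.exists_Icc_of_compactlySupported (hab : a < b) {u : L2 a b} {f : ℝ → ℂ}
    (hf : MaxRep a b φ u f) (hu : u ∈ compactlySupported a b) :
    ∃ c d, a < c ∧ c ≤ d ∧ d < b ∧ ∀ x ∈ Ioo a b, x ∉ Icc c d → f x = 0 := by
  obtain ⟨K, hK, hKs, hu0⟩ := hu
  -- The midpoint is adjoined so that infimum and supremum are attained inside `(a,b)` even if `K`
  -- is empty.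
  have hne : (K ∪ {(a + b) / 2}).Nonempty := ⟨_, Or.inr rfl⟩
  have hKc : IsCompact (K ∪ {(a + b) / 2}) := hK.union isCompact_singleton
  have hKs2 : K ∪ {(a + b) / 2} ⊆ Ioo a b :=
    union_subset hKs (singleton_subset_iff.2 ⟨by linarith, by linarith⟩)
  refine ⟨sInf (K ∪ {(a + b) / 2}), sSup (K ∪ {(a + b) / 2}), (hKs2 (hKc.sInf_mem hne)).1,
    csInf_le_csSup hne hKc.bddBelow hKc.bddAbove,
    (hKs2 (hKc.sSup_mem hne)).2, fun x hx hxn ↦ ?_⟩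
  have hxK : x ∉ K := fun h ↦ hxn ⟨csInf_le hKc.bddBelow (Or.inl h),
    le_csSup hKc.bddAbove (Or.inl h)⟩
  have hopen : IsOpen (Ioo a b \ K) := isOpen_Ioo.sdiff hK.isClosed
  have hae : f =ᵐ[volume.restrict (Ioo a b \ K)] fun _ ↦ 0 := by
    have h1 := ae_restrict_of_ae_restrict_of_subset (sdiff_subset (t := K)) hf.ae_eq
    have h2 := ae_restrict_of_ae_restrict_of_subset (sdiff_subset (t := K)) hu0
    filter_upwards [h1, h2, ae_restrict_mem hopen.measurableSet] with y h3 h4 h5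
    rw [← h3]
    exact h4 h5.2
  exact Measure.eqOn_open_of_ae_eq hae hopen (hf.acLoc.continuousOn.mono sdiff_subset)
    continuousOn_const ⟨hx, hxK⟩

/-- Elements of the minimal domain are limits of representatives vanishing near the endpoints. -/
theorem exists_maxRep_of_mem_minOp (hab : a < b) (hφ : ContinuousOn φ (Ioo a b)) {u : L2 a b}
    (hu : u ∈ (minOp a b φ).domain) :
    ∃ (F : ℝ → ℂ) (f : ℕ → ℝ → ℂ) (M : ℝ), MaxRep a b φ u F ∧
      (∀ x ∈ Ioo a b, Tendsto (fun n ↦ f n x) atTop (𝓝 (F x))) ∧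
      ∀ n, ACLoc a b (f n) ∧ MemLp (firstOrder φ (f n)) 2 (volume.restrict (Ioo a b)) ∧
        ∫ x in Ioo a b, ‖firstOrder φ (f n) x‖ ^ 2 ≤ M ∧
        ∃ c d, a < c ∧ d < b ∧ ∀ x ∈ Ioo a b, x ∉ Icc c d → f n x = 0 := by
  have hg : (u, minOp a b φ ⟨u, hu⟩) ∈ (minOp a b φ).graph := LinearPMap.mem_graph _ ⟨u, hu⟩
  obtain ⟨q, hq, hlim⟩ := (mem_graph_minOp_iff hab hφ).1 hg
  have hq' := fun n ↦ mem_graph_preMinOp_iff.1 (show ((q n).1, (q n).2) ∈ _ from hq n)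
  choose f hf hw using fun n ↦ mem_graph_maxOp_iff.1 (hq' n).1
  have hl2 : Tendsto (fun n ↦ (q n).2) atTop (𝓝 (minOp a b φ ⟨u, hu⟩)) :=
    (continuous_snd.tendsto _).comp hlim
  obtain ⟨F, hF, -, ns, -, hpt⟩ := exists_maxRep_of_tendsto hab hφ hf hw
    ((continuous_fst.tendsto _).comp hlim) hl2
  -- The images converge, so their squared norms have a common bound.
  obtain ⟨M, hM⟩ := (hl2.norm.pow 2).bddAbove_range
  refine ⟨F, fun k ↦ f (ns k), M, hF, hpt, fun k ↦
    ⟨(hf (ns k)).acLoc, (hf (ns k)).memLp, ?_, ?_⟩⟩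
  · refine le_trans (le_of_eq ?_) (hM ⟨ns k, rfl⟩)
    refine Eq.trans ?_ (integral_norm_sq_eq (q (ns k)).2)
    refine integral_congr_ae ?_
    filter_upwards [hw (ns k)] with x hx
    rw [hx]
  · obtain ⟨c, d, hc, -, hd, h0⟩ := (hf (ns k)).exists_Icc_of_compactlySupported hab (hq' (ns k)).2
    exact ⟨c, d, hc, hd, h0⟩

end Operators

/-! ### Endpoint behaviour in the maximal and minimal domains. -/

section Endpoints

variable {a b sa sb δ : ℝ} {φ : ℝ → ℝ}

theorem IsBesselPotential.a_lt_b (hφ : IsBesselPotential a b sa sb δ φ) : a < b := by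
  linarith [hφ.pos, hφ.lt]

theorem IsBesselPotential.left_affine (hφ : IsBesselPotential a b sa sb δ φ) :
    (∀ t ∈ Ioo 0 δ, a + 1 * t ∈ Ioo a b) ∧
      ∀ t ∈ Ioo 0 δ, -((sa + 1 / 2) / t) = 1 * φ (a + 1 * t) := by
  refine ⟨fun t ht ↦ ⟨by linarith [ht.1], by linarith [ht.2, hφ.lt]⟩, fun t ht ↦ ?_⟩
  rw [hφ.left _ ⟨by linarith [ht.1], by linarith [ht.2]⟩]
  ring_nf

theorem IsBesselPotential.right_affine (hφ : IsBesselPotential a b sa sb δ φ) :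
    (∀ t ∈ Ioo 0 δ, b + -1 * t ∈ Ioo a b) ∧
      ∀ t ∈ Ioo 0 δ, -((sb + 1 / 2) / t) = -1 * φ (b + -1 * t) := by
  refine ⟨fun t ht ↦ ⟨by linarith [ht.2, hφ.lt], by linarith [ht.1]⟩, fun t ht ↦ ?_⟩
  rw [hφ.right _ ⟨by linarith [ht.2], by linarith [ht.1]⟩]
  ring_nf

theorem map_affine_left (a : ℝ) : map (fun t ↦ a + 1 * t) (𝓝[>] (0 : ℝ)) = 𝓝[>] a := by
  simp

theorem map_affine_right (b : ℝ) : map (fun t ↦ b + -1 * t) (𝓝[>] (0 : ℝ)) = 𝓝[<] b := by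
  have h := map_subLeft_nhdsGT (c := b) (a := (0 : ℝ))
  simpa [sub_eq_add_neg] using h

theorem isLittleO_iff_tendsto_div {l : Filter ℝ} {g : ℝ → ℂ} {w : ℝ → ℝ} (hw : ∀ᶠ t in l, 0 < w t) :
    g =o[l] w ↔ Tendsto (fun t ↦ g t / (w t : ℂ)) l (𝓝 0) := by
  rw [← Asymptotics.isLittleO_iff_tendsto' (g := fun t ↦ (w t : ℂ))]
  · rw [← Asymptotics.isLittleO_norm_right (g' := fun t ↦ (w t : ℂ))]
    simp only [Complex.norm_real]
    rw [Asymptotics.isLittleO_norm_right]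
  · filter_upwards [hw] with t ht h
    exact absurd h (by exact_mod_cast ht.ne')

theorem sqrtLeft_iff {f : ℝ → ℂ} :
    SqrtLeft a f ↔ (fun t ↦ f (a + 1 * t)) =o[𝓝[>] 0] Real.sqrt := by
  rw [isLittleO_iff_tendsto_div, SqrtLeft, ← map_affine_left, tendsto_map'_iff]
  · simp [Function.comp_def]
  · filter_upwards [self_mem_nhdsWithin] with t ht
    exact Real.sqrt_pos.2 ht

theorem sqrtRight_iff {f : ℝ → ℂ} :
    SqrtRight b f ↔ (fun t ↦ f (b + -1 * t)) =o[𝓝[>] 0] Real.sqrt := by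
  rw [isLittleO_iff_tendsto_div, SqrtRight, ← map_affine_right, tendsto_map'_iff]
  · simp [Function.comp_def]
  · filter_upwards [self_mem_nhdsWithin] with t ht
    exact Real.sqrt_pos.2 ht

theorem sqrt_mul_log_pos {R : ℝ} (hR : 0 < R) :
    ∀ᶠ t in 𝓝[>] (0 : ℝ), 0 < Real.sqrt (t * Real.log (R / t)) := by
  filter_upwards [Ioo_mem_nhdsGT hR] with t ht
  exact Real.sqrt_pos.2 (mul_pos ht.1 (Real.log_pos ((one_lt_div ht.1).2 ht.2)))

theorem logLeft_iff {f : ℝ → ℂ} {R : ℝ} (hR : 0 < R) :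
    LogLeft a R f ↔
      (fun t ↦ f (a + 1 * t)) =o[𝓝[>] 0] fun t ↦ Real.sqrt (t * Real.log (R / t)) := by
  rw [isLittleO_iff_tendsto_div (sqrt_mul_log_pos hR), LogLeft, ← map_affine_left,
    tendsto_map'_iff]
  simp [Function.comp_def]

theorem logRight_iff {f : ℝ → ℂ} {R : ℝ} (hR : 0 < R) :
    LogRight b R f ↔
      (fun t ↦ f (b + -1 * t)) =o[𝓝[>] 0] fun t ↦ Real.sqrt (t * Real.log (R / t)) := by
  rw [isLittleO_iff_tendsto_div (sqrt_mul_log_pos hR), LogRight, ← map_affine_right,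
    tendsto_map'_iff]
  simp [Function.comp_def]

theorem vanishesLeft_iff {f : ℝ → ℂ} :
    VanishesLeft a f ↔ Tendsto (fun t ↦ f (a + 1 * t)) (𝓝[>] 0) (𝓝 0) := by
  rw [VanishesLeft, ← map_affine_left, tendsto_map'_iff]
  rfl

theorem vanishesRight_iff {f : ℝ → ℂ} :
    VanishesRight b f ↔ Tendsto (fun t ↦ f (b + -1 * t)) (𝓝[>] 0) (𝓝 0) := by
  rw [VanishesRight, ← map_affine_right, tendsto_map'_iff]
  rfl

theorem tendsto_zero_of_isLittleO_sqrt {g : ℝ → ℂ} (h : g =o[𝓝[>] 0] Real.sqrt) :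
    Tendsto g (𝓝[>] 0) (𝓝 0) := by
  refine h.isBigO.trans_tendsto ?_
  have := (Real.continuous_sqrt.tendsto 0).mono_left (nhdsWithin_le_nhds (s := Ioi (0 : ℝ)))
  rwa [Real.sqrt_zero] at this

theorem tendsto_zero_of_isLittleO_sqrt_log {g : ℝ → ℂ} {R : ℝ} (hR : 0 < R)
    (h : g =o[𝓝[>] 0] fun t ↦ Real.sqrt (t * Real.log (R / t))) :
    Tendsto g (𝓝[>] 0) (𝓝 0) := by
  refine h.isBigO.trans_tendsto ?_
  have h1 : Tendsto (fun t : ℝ ↦ Real.log R * t - t * Real.log t) (𝓝[>] 0) (𝓝 0) := by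
    have h2 : Continuous fun t : ℝ ↦ Real.log R * t - t * Real.log t :=
      (continuous_const.mul continuous_id).sub Real.continuous_mul_log
    have h4 := h2.tendsto 0
    simp only [mul_zero, zero_mul, sub_zero] at h4
    exact h4.mono_left nhdsWithin_le_nhds
  have h3 : Tendsto (fun t : ℝ ↦ t * Real.log (R / t)) (𝓝[>] 0) (𝓝 0) := by
    refine h1.congr' ?_
    filter_upwards [self_mem_nhdsWithin] with t ht
    rw [Real.log_div hR.ne' (ne_of_gt ht)]
    ring
  simpa using h3.sqrt

theorem MaxRep.isLocalSol_left (hφ : IsBesselPotential a b sa sb δ φ) {u : L2 a b} {f : ℝ → ℂ}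
    (hf : MaxRep a b φ u f) : IsLocalSol sa δ (fun t ↦ f (a + 1 * t)) :=
  isLocalSol_comp_affine (Or.inl rfl) hφ.pos hφ.left_affine.1 hφ.left_affine.2 hf.acLoc hf.memLp

theorem MaxRep.isLocalSol_right (hφ : IsBesselPotential a b sa sb δ φ) {u : L2 a b} {f : ℝ → ℂ}
    (hf : MaxRep a b φ u f) : IsLocalSol sb δ (fun t ↦ f (b + -1 * t)) :=
  isLocalSol_comp_affine (Or.inr rfl) hφ.pos hφ.right_affine.1 hφ.right_affine.2 hf.acLoc hf.memLp

theorem IsLocalSol.isLittleO_sqrt_of_memLp {s : ℝ} {g : ℝ → ℂ} (h : IsLocalSol s δ g)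
    (hg : MemLp g 2 (volume.restrict (Ioo 0 δ))) (hs : s ≤ -1 ∨ 0 < s) :
    g =o[𝓝[>] 0] Real.sqrt := by
  rcases hs with hs | hs
  · exact h.isLittleO_sqrt_of_hasNoSingularPart (by linarith)
      (hasNoSingularPart_of_memLp hs h.pos hg)
  · exact h.isLittleO_sqrt_of_pos hs

theorem MaxRep.memLp_rep {u : L2 a b} {f : ℝ → ℂ} (hf : MaxRep a b φ u f) :
    MemLp f 2 (volume.restrict (Ioo a b)) :=
  (memLp_congr_ae hf.ae_eq).1 (Lp.memLp u)

theorem MaxRep.sqrtLeft (hφ : IsBesselPotential a b sa sb δ φ) {u : L2 a b} {f : ℝ → ℂ}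
    (hf : MaxRep a b φ u f) (hs : sa ≤ -1 ∨ 0 < sa) : SqrtLeft a f :=
  sqrtLeft_iff.2 ((hf.isLocalSol_left hφ).isLittleO_sqrt_of_memLp
    (MemLp_comp_affine (Or.inl rfl) measurableSet_Ioo hφ.left_affine.1 hf.memLp_rep) hs)

theorem MaxRep.sqrtRight (hφ : IsBesselPotential a b sa sb δ φ) {u : L2 a b} {f : ℝ → ℂ}
    (hf : MaxRep a b φ u f) (hs : sb ≤ -1 ∨ 0 < sb) : SqrtRight b f :=
  sqrtRight_iff.2 ((hf.isLocalSol_right hφ).isLittleO_sqrt_of_memLp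
    (MemLp_comp_affine (Or.inr rfl) measurableSet_Ioo hφ.right_affine.1 hf.memLp_rep) hs)

theorem IsLocalSol.isLittleO_sqrt_of_tendsto_zero {s : ℝ} {g : ℝ → ℂ} (h : IsLocalSol s δ g)
    (hg : Tendsto g (𝓝[>] 0) (𝓝 0)) (hs : s ≤ -1 / 2 ∨ 0 < s) :
    g =o[𝓝[>] 0] Real.sqrt := by
  rcases hs with hs | hs
  · exact h.isLittleO_sqrt_of_hasNoSingularPart (by linarith)
      (hasNoSingularPart_of_tendsto_zero hs hg)
  · exact h.isLittleO_sqrt_of_pos hs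

/-- A pointwise limit of local solutions with bounded energy and no singular part is `o(√t)`. -/
theorem IsLocalSol.isLittleO_sqrt_of_approx {s M : ℝ} {g : ℝ → ℂ} (h : IsLocalSol s δ g)
    (hs : s < 0) {G : ℕ → ℝ → ℂ} (hG : ∀ n, IsLocalSol s δ (G n))
    (hE : ∀ n, ∀ y ∈ Ioo 0 δ, energy s (G n) y ≤ M) (hN : ∀ n, HasNoSingularPart s (G n))
    (hlim : ∀ y ∈ Ioo 0 δ, Tendsto (fun n ↦ G n y) atTop (𝓝 (g y))) :
    g =o[𝓝[>] 0] Real.sqrt := by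
  -- The uniform bound only yields `O(√t)` in the limit; this already excludes the singular part,
  -- and the limit's own energy estimate improves it to `o(√t)`.
  refine h.isLittleO_sqrt_of_hasNoSingularPart hs (hasNoSingularPart_of_isBigO_sqrt hs ?_)
  refine Asymptotics.IsBigO.of_bound (Real.sqrt M / Real.sqrt (-2 * s)) ?_
  filter_upwards [Ioo_mem_nhdsGT h.pos] with y hy
  rw [Real.norm_of_nonneg (Real.sqrt_nonneg y)]
  refine le_of_tendsto' (hlim y hy).norm fun n ↦ ?_
  refine ((hG n).norm_le_of_hasNoSingularPart hs (hN n) hy.1 hy.2).trans ?_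
  have h1 := Real.sqrt_le_sqrt (hE n y hy)
  calc Real.sqrt y / Real.sqrt (-2 * s) * Real.sqrt (energy s (G n) y)
      ≤ Real.sqrt y / Real.sqrt (-2 * s) * Real.sqrt M := by gcongr
    _ = _ := by ring

theorem hasNoSingularPart_of_eventually_eq_zero {s : ℝ} {g : ℝ → ℂ}
    (hg : ∀ᶠ t in 𝓝[>] 0, g t = 0) : HasNoSingularPart s g :=
  hasNoSingularPart_of_tendsto <| tendsto_const_nhds.congr' <| by
    filter_upwards [hg] with t ht
    simp [ht]

/-- Functions in the minimal domain are `o(√·)` at endpoints with nonzero parameter. -/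
theorem exists_maxRep_sqrt_of_mem_minOp (hφ : IsBesselPotential a b sa sb δ φ) {u : L2 a b}
    (hu : u ∈ (minOp a b φ).domain) :
    ∃ f, MaxRep a b φ u f ∧ (sa ≠ 0 → SqrtLeft a f) ∧ (sb ≠ 0 → SqrtRight b f) := by
  obtain ⟨F, f, M, hF, hlim, hf⟩ := exists_maxRep_of_mem_minOp hφ.a_lt_b hφ.continuousOn hu
  refine ⟨F, hF, fun hs ↦ ?_, fun hs ↦ ?_⟩
  -- A positive parameter forces `o(√t)` on the whole maximal domain. Only for a negative parameter
  -- is the approximation needed: the approximants vanish near the endpoint and so have no singular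
  -- part.
  · rcases lt_or_gt_of_ne hs with hs | hs
    · obtain ⟨hmem, hpot⟩ := hφ.left_affine
      refine sqrtLeft_iff.2 ((hF.isLocalSol_left hφ).isLittleO_sqrt_of_approx hs (M := M)
        (G := fun n t ↦ f n (a + 1 * t)) (fun n ↦ ?_) (fun n y hy ↦ ?_) (fun n ↦ ?_)
        fun y hy ↦ hlim _ (hmem y hy))
      · exact isLocalSol_comp_affine (Or.inl rfl) hφ.pos hmem hpot (hf n).1 (hf n).2.1
      · exact (energy_comp_affine_le (Or.inl rfl) hmem hpot (hf n).2.1 hy.1 hy.2).trans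
          (hf n).2.2.1
      · obtain ⟨c, d, hc, -, h0⟩ := (hf n).2.2.2
        refine hasNoSingularPart_of_eventually_eq_zero ?_
        filter_upwards [Ioo_mem_nhdsGT hφ.pos, Ioo_mem_nhdsGT (sub_pos.2 hc)] with t ht1 ht2
        exact h0 _ (hmem t ht1) fun h ↦ by linarith [h.1, ht2.2]
    · exact hF.sqrtLeft hφ (Or.inr hs)
  · rcases lt_or_gt_of_ne hs with hs | hs
    · obtain ⟨hmem, hpot⟩ := hφ.right_affine
      refine sqrtRight_iff.2 ((hF.isLocalSol_right hφ).isLittleO_sqrt_of_approx hs (M := M)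
        (G := fun n t ↦ f n (b + -1 * t)) (fun n ↦ ?_) (fun n y hy ↦ ?_) (fun n ↦ ?_)
        fun y hy ↦ hlim _ (hmem y hy))
      · exact isLocalSol_comp_affine (Or.inr rfl) hφ.pos hmem hpot (hf n).1 (hf n).2.1
      · exact (energy_comp_affine_le (Or.inr rfl) hmem hpot (hf n).2.1 hy.1 hy.2).trans
          (hf n).2.2.1
      · obtain ⟨c, d, -, hd, h0⟩ := (hf n).2.2.2
        refine hasNoSingularPart_of_eventually_eq_zero ?_
        filter_upwards [Ioo_mem_nhdsGT hφ.pos, Ioo_mem_nhdsGT (sub_pos.2 hd)] with t ht1 ht2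
        exact h0 _ (hmem t ht1) fun h ↦ by linarith [h.2, ht2.2]
    · exact hF.sqrtRight hφ (Or.inr hs)

end Endpoints

/-! ### Hardy's inequality on `(a,b)` and the Sobolev space. -/

/-- The weight is bounded away from `0`, so square integrability of the product is only at stake
near `0`. -/
theorem memLp_mul_of_continuousOn_Ioc {κ : ℝ → ℝ} {g : ℝ → ℂ} {ℓ r : ℝ} (hr : 0 < r)
    (hκ : ContinuousOn κ (Ioc 0 ℓ)) (hg : MemLp g 2 (volume.restrict (Ioo 0 ℓ)))
    (hr' : MemLp (fun t ↦ (κ t : ℂ) * g t) 2 (volume.restrict (Ioo 0 r))) :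
    MemLp (fun t ↦ (κ t : ℂ) * g t) 2 (volume.restrict (Ioo 0 ℓ)) := by
  have hm : AEStronglyMeasurable (fun t ↦ (κ t : ℂ) * g t) (volume.restrict (Ioo 0 ℓ)) :=
    ((Complex.continuous_ofReal.comp_continuousOn (hκ.mono Ioo_subset_Ioc_self)
      ).aestronglyMeasurable measurableSet_Ioo).mul hg.1
  rw [memLp_two_iff_integrable_sq_norm hm]
  obtain ⟨C, hC⟩ := isCompact_Icc.exists_bound_of_continuousOn
    (hκ.mono (t := Icc r ℓ) fun t ht ↦ ⟨hr.trans_le ht.1, ht.2⟩)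
  have hsub : Ico r ℓ ⊆ Ioo 0 ℓ := fun t ht ↦ ⟨hr.trans_le ht.1, ht.2⟩
  have h2 : MemLp (fun t ↦ (κ t : ℂ) * g t) 2 (volume.restrict (Ico r ℓ)) := by
    refine (hg.mono_measure (Measure.restrict_mono_set _ hsub)).of_le_mul (c := C)
      (hm.mono_measure (Measure.restrict_mono_set _ hsub)) ?_
    filter_upwards [ae_restrict_mem measurableSet_Ico] with t ht
    rw [norm_mul, Complex.norm_real]
    exact mul_le_mul_of_nonneg_right (hC t ⟨ht.1, ht.2.le⟩) (norm_nonneg _)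
  refine (IntegrableOn.union (hr'.integrable_norm_pow two_ne_zero)
    (h2.integrable_norm_pow two_ne_zero)).mono_set fun t ht ↦ ?_
  rcases lt_or_ge t r with h | h
  · exact Or.inl ⟨ht.1, h⟩
  · exact Or.inr ⟨h, ht.2⟩

section Sobolev

variable {a b : ℝ}

theorem memLp_weight_left {κ : ℝ → ℝ} {f : ℝ → ℂ} {r : ℝ} (hr : 0 < r)
    (hκ : ContinuousOn κ (Ioc 0 (b - a))) (hf : MemLp f 2 (volume.restrict (Ioo a b)))
    (hr' : MemLp (fun t ↦ (κ t : ℂ) * f (a + 1 * t)) 2 (volume.restrict (Ioo 0 r))) :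
    MemLp (fun x ↦ (κ (x - a) : ℂ) * f x) 2 (volume.restrict (Ioo a b)) := by
  have h1 := memLp_mul_of_continuousOn_Ioc hr hκ (MemLp_comp_affine (p := a) (Or.inl rfl)
    measurableSet_Ioo (S := Ioo 0 (b - a)) (fun t ht ↦ ⟨by linarith [ht.1], by linarith [ht.2]⟩)
    hf) hr'
  have h2 := MemLp_comp_affine (p := -a) (Or.inl rfl) measurableSet_Ioo (S := Ioo a b)
    (fun t ht ↦ ⟨by linarith [ht.1], by linarith [ht.2]⟩) h1
  convert h2 using 2 with x
  ring_nf

theorem memLp_weight_right {κ : ℝ → ℝ} {f : ℝ → ℂ} {r : ℝ} (hr : 0 < r)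
    (hκ : ContinuousOn κ (Ioc 0 (b - a))) (hf : MemLp f 2 (volume.restrict (Ioo a b)))
    (hr' : MemLp (fun t ↦ (κ t : ℂ) * f (b + -1 * t)) 2 (volume.restrict (Ioo 0 r))) :
    MemLp (fun x ↦ (κ (b - x) : ℂ) * f x) 2 (volume.restrict (Ioo a b)) := by
  have h1 := memLp_mul_of_continuousOn_Ioc hr hκ (MemLp_comp_affine (p := b) (Or.inr rfl)
    measurableSet_Ioo (S := Ioo 0 (b - a)) (fun t ht ↦ ⟨by linarith [ht.2], by linarith [ht.1]⟩)
    hf) hr'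
  have h2 := MemLp_comp_affine (p := b) (Or.inr rfl) measurableSet_Ioo (S := Ioo a b)
    (fun t ht ↦ ⟨by linarith [ht.2], by linarith [ht.1]⟩) h1
  convert h2 using 2 with x
  ring_nf

theorem continuousOn_inv_Ioc (ℓ : ℝ) : ContinuousOn (fun t : ℝ ↦ t⁻¹) (Ioc 0 ℓ) :=
  continuousOn_id.inv₀ fun _ ht ↦ ht.1.ne'

theorem memLp_hardy_left {s δ : ℝ} {f : ℝ → ℂ} (h : IsLocalSol s δ fun t ↦ f (a + 1 * t))
    (hs : s ≠ 0) (hf : MemLp f 2 (volume.restrict (Ioo a b))) (hb : SqrtLeft a f) :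
    MemLp (fun x ↦ (((x - a)⁻¹ : ℝ) : ℂ) * f x) 2 (volume.restrict (Ioo a b)) := by
  obtain ⟨r, hr, -, hm⟩ := h.exists_memLp_div hs (sqrtLeft_iff.1 hb).isBigO
  refine memLp_weight_left hr (continuousOn_inv_Ioc _) hf ?_
  convert hm using 2 with t
  push_cast
  ring

theorem memLp_hardy_right {s δ : ℝ} {f : ℝ → ℂ} (h : IsLocalSol s δ fun t ↦ f (b + -1 * t))
    (hs : s ≠ 0) (hf : MemLp f 2 (volume.restrict (Ioo a b))) (hb : SqrtRight b f) :
    MemLp (fun x ↦ (((b - x)⁻¹ : ℝ) : ℂ) * f x) 2 (volume.restrict (Ioo a b)) := by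
  obtain ⟨r, hr, -, hm⟩ := h.exists_memLp_div hs (sqrtRight_iff.1 hb).isBigO
  refine memLp_weight_right hr (continuousOn_inv_Ioc _) hf ?_
  convert hm using 2 with t
  push_cast
  ring

variable {sa sb δ : ℝ} {φ : ℝ → ℝ}

theorem IsBesselPotential.exists_bound (hφ : IsBesselPotential a b sa sb δ φ) :
    ∃ K, 0 ≤ K ∧ ∀ x ∈ Ioo a b, |φ x| ≤ K + |sa + 1 / 2| * (x - a)⁻¹ + |sb + 1 / 2| * (b - x)⁻¹ := by
  have hδ := hφ.pos
  obtain ⟨K, hK⟩ := (isCompact_Icc (a := a + δ / 2) (b := b - δ / 2)).exists_bound_of_continuousOn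
    (hφ.continuousOn.mono fun x hx ↦ ⟨by linarith [hx.1], by linarith [hx.2]⟩)
  refine ⟨max K 0, le_max_right _ _, fun x hx ↦ ?_⟩
  have h1 : 0 < x - a := sub_pos.2 hx.1
  have h2 : 0 < b - x := sub_pos.2 hx.2
  have h3 : 0 ≤ |sa + 1 / 2| * (x - a)⁻¹ := by positivity
  have h4 : 0 ≤ |sb + 1 / 2| * (b - x)⁻¹ := by positivity
  have h5 := le_max_right K 0
  rcases lt_or_ge x (a + δ / 2) with h | h
  · rw [hφ.left x ⟨hx.1, by linarith⟩, abs_neg, abs_div, abs_of_pos h1, div_eq_mul_inv]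
    linarith
  rcases lt_or_ge (b - δ / 2) x with h' | h'
  · rw [hφ.right x ⟨by linarith, hx.2⟩, abs_div, abs_of_pos h2, div_eq_mul_inv]
    linarith
  · have := hK x ⟨h, h'⟩
    rw [Real.norm_eq_abs] at this
    linarith [le_max_left K 0]

theorem IsBesselPotential.memLp_mul (hφ : IsBesselPotential a b sa sb δ φ) {f : ℝ → ℂ}
    (hf : MemLp f 2 (volume.restrict (Ioo a b)))
    (ha : MemLp (fun x ↦ (((x - a)⁻¹ : ℝ) : ℂ) * f x) 2 (volume.restrict (Ioo a b)))
    (hb : MemLp (fun x ↦ (((b - x)⁻¹ : ℝ) : ℂ) * f x) 2 (volume.restrict (Ioo a b))) :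
    MemLp (fun x ↦ (φ x : ℂ) * f x) 2 (volume.restrict (Ioo a b)) := by
  obtain ⟨K, hK0, hK⟩ := hφ.exists_bound
  have h1 := ((hf.norm.const_mul K).add (ha.norm.const_mul |sa + 1 / 2|)).add
    (hb.norm.const_mul |sb + 1 / 2|)
  refine h1.mono (((Complex.continuous_ofReal.comp_continuousOn hφ.continuousOn
    ).aestronglyMeasurable measurableSet_Ioo).mul hf.1) ?_
  filter_upwards [ae_restrict_mem measurableSet_Ioo] with x hx
  refine le_trans ?_ (le_abs_self _)
  have h2 : 0 < x - a := sub_pos.2 hx.1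
  have h3 : 0 < b - x := sub_pos.2 hx.2
  simp only [Pi.add_apply, norm_mul, Complex.norm_real, Real.norm_eq_abs, abs_inv, abs_of_pos h2,
    abs_of_pos h3]
  calc |φ x| * ‖f x‖ ≤ (K + |sa + 1 / 2| * (x - a)⁻¹ + |sb + 1 / 2| * (b - x)⁻¹) * ‖f x‖ := by
        gcongr
        exact hK x hx
    _ = _ := by ring

/-- Elements of `H¹₀` belong to the maximal domain and are `o(√·)` at both endpoints. -/
theorem exists_maxRep_sqrt_of_mem_H01 (hφ : IsBesselPotential a b sa sb δ φ) {u : L2 a b}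
    (hu : u ∈ H01 a b) : ∃ f, MaxRep a b φ u f ∧ SqrtLeft a f ∧ SqrtRight b f := by
  obtain ⟨g, hac, hae, hga, hgb, hd⟩ := hu
  have hab := hφ.a_lt_b
  have hacl : ACLoc a b g := fun c d hc hcd hd ↦ hac.mono (by
    rw [uIcc_of_le hcd, uIcc_of_le hab.le]
    exact Icc_subset_Icc hc.le hd.le)
  have hf : MemLp g 2 (volume.restrict (Ioo a b)) := (memLp_congr_ae hae).1 (Lp.memLp u)
  have hd0 : firstOrder (fun _ ↦ 0) g = deriv g := by
    funext x
    simp [firstOrder]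
  have hd' : MemLp (firstOrder (fun _ ↦ 0) g) 2 (volume.restrict (Ioo a b)) := by rwa [hd0]
  have hcont := hac.continuousOn
  rw [uIcc_of_le hab.le] at hcont
  -- For `s = -1/2` the coefficient `-(s + 1/2) / t` vanishes, so `g' ∈ L²` is the local equation.
  -- Its homogeneous solutions are constants, which the zero boundary values exclude.
  have hl : IsLocalSol (-1 / 2) (b - a) fun t ↦ g (a + 1 * t) :=
    isLocalSol_comp_affine (Or.inl rfl) (sub_pos.2 hab)
      (fun t ht ↦ ⟨by linarith [ht.1], by linarith [ht.2]⟩) (fun t _ ↦ by norm_num) hacl hd'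
  have hr : IsLocalSol (-1 / 2) (b - a) fun t ↦ g (b + -1 * t) :=
    isLocalSol_comp_affine (Or.inr rfl) (sub_pos.2 hab)
      (fun t ht ↦ ⟨by linarith [ht.2], by linarith [ht.1]⟩) (fun t _ ↦ by norm_num) hacl hd'
  have hvl : VanishesLeft a g := by
    have := (hcont a (left_mem_Icc.2 hab.le)).mono Ioo_subset_Icc_self
    rw [ContinuousWithinAt, nhdsWithin_Ioo_eq_nhdsGT hab, hga] at this
    exact this
  have hvr : VanishesRight b g := by
    have := (hcont b (right_mem_Icc.2 hab.le)).mono Ioo_subset_Icc_self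
    rw [ContinuousWithinAt, nhdsWithin_Ioo_eq_nhdsLT hab, hgb] at this
    exact this
  have hsl : SqrtLeft a g := sqrtLeft_iff.2
    (hl.isLittleO_sqrt_of_tendsto_zero (vanishesLeft_iff.1 hvl) (Or.inl le_rfl))
  have hsr : SqrtRight b g := sqrtRight_iff.2
    (hr.isLittleO_sqrt_of_tendsto_zero (vanishesRight_iff.1 hvr) (Or.inl le_rfl))
  have hφg := hφ.memLp_mul hf (memLp_hardy_left hl (by norm_num) hf hsl)
    (memLp_hardy_right hr (by norm_num) hf hsr)
  exact ⟨g, ⟨hacl, hae, hd.add hφg⟩, hsl, hsr⟩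

/-- Hardy's inequality at both endpoints makes `φ f` square integrable, hence also `f'`. The
primitive of `f'` from `a` is then absolutely continuous on the closed interval and supplies the
representative. -/
theorem MaxRep.mem_H01 (hφ : IsBesselPotential a b sa sb δ φ) {u : L2 a b} {f : ℝ → ℂ}
    (hf : MaxRep a b φ u f) (hsa : sa ≠ 0) (hsb : sb ≠ 0) (hl : SqrtLeft a f)
    (hr : SqrtRight b f) : u ∈ H01 a b := by
  have hab := hφ.a_lt_b
  have hφf := hφ.memLp_mul hf.memLp_rep
    (memLp_hardy_left (hf.isLocalSol_left hφ) hsa hf.memLp_rep hl)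
    (memLp_hardy_right (hf.isLocalSol_right hφ) hsb hf.memLp_rep hr)
  have hd : MemLp (deriv f) 2 (volume.restrict (Ioo a b)) := by
    have h1 := hf.memLp.sub hφf
    refine (memLp_congr_ae (.of_forall fun x ↦ ?_)).1 h1
    simp [firstOrder]
  have hi : IntervalIntegrable (deriv f) volume a b := by
    rw [intervalIntegrable_iff_integrableOn_Ioo_of_le hab.le]
    exact hd.integrable (by norm_num)
  set G : ℝ → ℂ := fun x ↦ ∫ t in a..x, deriv f t with hG
  have hGac : AbsolutelyContinuousOnInterval G a b :=
    hi.absolutelyContinuousOnInterval_complex left_mem_uIcc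
  have hGc := hGac.continuousOn
  rw [uIcc_of_le hab.le] at hGc
  have hGl : Tendsto G (𝓝[>] a) (𝓝 0) := by
    have := (hGc a (left_mem_Icc.2 hab.le)).mono Ioo_subset_Icc_self
    rw [ContinuousWithinAt, nhdsWithin_Ioo_eq_nhdsGT hab] at this
    simpa [hG] using this
  have hGr : Tendsto G (𝓝[<] b) (𝓝 (G b)) := by
    have := (hGc b (right_mem_Icc.2 hab.le)).mono Ioo_subset_Icc_self
    rwa [ContinuousWithinAt, nhdsWithin_Ioo_eq_nhdsLT hab] at this
  have hvl : Tendsto f (𝓝[>] a) (𝓝 0) :=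
    vanishesLeft_iff.2 (tendsto_zero_of_isLittleO_sqrt (sqrtLeft_iff.1 hl))
  have hvr : Tendsto f (𝓝[<] b) (𝓝 0) :=
    vanishesRight_iff.2 (tendsto_zero_of_isLittleO_sqrt (sqrtRight_iff.1 hr))
  have hGI : ∀ x ∈ Ioo a b, IntervalIntegrable (deriv f) volume a x := fun x hx ↦
    hi.mono_set (uIcc_subset_uIcc left_mem_uIcc (by
      rw [uIcc_of_le hab.le]
      exact ⟨hx.1.le, hx.2.le⟩))
  have hdiff : ∀ x ∈ Ioo a b, ∀ c ∈ Ioo a b, f x = f c + G x - G c := by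
    intro x hx c hc
    have h1 := (hf.acLoc.absolutelyContinuousOnInterval hc hx).integral_deriv_eq_sub_complex
    rw [← intervalIntegral.integral_interval_sub_left (hGI x hx) (hGI c hc)] at h1
    rw [add_sub_assoc, hG]
    simp only
    rw [h1]
    ring
  have hfG : ∀ x ∈ Ioo a b, f x = G x := by
    intro x hx
    -- Letting `c` tend to `a`, where both `f` and `G` vanish, removes the integration constant.
    have h1 : Tendsto (fun c ↦ f c + G x - G c) (𝓝[>] a) (𝓝 (0 + G x - 0)) :=
      (hvl.add_const _).sub hGl
    have h2 : Tendsto (fun c ↦ f c + G x - G c) (𝓝[>] a) (𝓝 (f x)) := by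
      refine tendsto_const_nhds.congr' ?_
      filter_upwards [Ioo_mem_nhdsGT hab] with c hc
      exact hdiff x hx c hc
    simpa using tendsto_nhds_unique h2 h1
  refine ⟨G, hGac, ?_, by simp [hG], ?_, ?_⟩
  · filter_upwards [hf.ae_eq, ae_restrict_mem measurableSet_Ioo] with x hx hxm
    rw [hx, hfG x hxm]
  · refine tendsto_nhds_unique hGr (hvr.congr' ?_)
    filter_upwards [Ioo_mem_nhdsLT hab] with x hx
    exact hfG x hx
  · refine (memLp_congr_ae ?_).1 hd
    filter_upwards [ae_restrict_mem measurableSet_Ioo] with x hx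
    refine EventuallyEq.deriv_eq ?_
    filter_upwards [isOpen_Ioo.mem_nhds hx] with y hy
    exact hfG y hy

end Sobolev

/-! ### Cutoffs on a double logarithmic scale. -/

theorem deriv_smoothTransition_of_neg {x : ℝ} (h : x < 0) : deriv Real.smoothTransition x = 0 := by
  have : Real.smoothTransition =ᶠ[𝓝 x] fun _ ↦ 0 := by
    filter_upwards [gt_mem_nhds h] with y hy
    exact Real.smoothTransition.zero_of_nonpos hy.le
  rw [this.deriv_eq]
  simp

theorem deriv_smoothTransition_of_one_lt {x : ℝ} (h : 1 < x) :
    deriv Real.smoothTransition x = 0 := by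
  have : Real.smoothTransition =ᶠ[𝓝 x] fun _ ↦ 1 := by
    filter_upwards [lt_mem_nhds h] with y hy
    exact Real.smoothTransition.one_of_one_le hy.le
  rw [this.deriv_eq]
  simp

theorem exists_bound_deriv_smoothTransition :
    ∃ M, ∀ x, |deriv Real.smoothTransition x| ≤ M := by
  have hc : Continuous (deriv Real.smoothTransition) :=
    (Real.smoothTransition.contDiff (n := 1)).continuous_deriv le_rfl
  obtain ⟨M, hM⟩ := (isCompact_Icc (a := (0 : ℝ)) (b := 1)).exists_bound_of_continuousOn
    hc.continuousOn
  refine ⟨max M 0, fun x ↦ ?_⟩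
  rcases lt_or_ge x 0 with h | h
  · simp [deriv_smoothTransition_of_neg h]
  rcases lt_or_ge 1 x with h' | h'
  · simp [deriv_smoothTransition_of_one_lt h']
  · exact (hM x ⟨h, h'⟩).trans (le_max_left _ _)

/-- The scale `log (e² ℓ / t)`, which is at least `2` on `(0,ℓ]`. -/
noncomputable def logScale (ℓ t : ℝ) : ℝ := Real.log (Real.exp 2 * ℓ / t)

theorem two_le_logScale {ℓ t : ℝ} (ht : t ∈ Ioc 0 ℓ) : 2 ≤ logScale ℓ t := by
  have hℓ : 0 < ℓ := ht.1.trans_le ht.2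
  rw [logScale, Real.le_log_iff_exp_le (by have := ht.1; positivity), mul_div_assoc]
  exact le_mul_of_one_le_right (Real.exp_pos 2).le ((one_le_div ht.1).2 ht.2)

theorem log_logScale_pos {ℓ t : ℝ} (ht : t ∈ Ioc 0 ℓ) : 0 < Real.log (logScale ℓ t) :=
  Real.log_pos (by linarith [two_le_logScale ht])

theorem hasDerivAt_logScale {ℓ t : ℝ} (ht : t ∈ Ioc 0 ℓ) :
    HasDerivAt (logScale ℓ) (-t⁻¹) t := by
  have hℓ : 0 < ℓ := ht.1.trans_le ht.2
  have h0 : t ≠ 0 := ht.1.ne'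
  have h1 : HasDerivAt (fun t ↦ Real.log (Real.exp 2 * ℓ) - Real.log t) (-t⁻¹) t := by
    simpa using (Real.hasDerivAt_log h0).const_sub (Real.log (Real.exp 2 * ℓ))
  refine h1.congr_of_eventuallyEq ?_
  filter_upwards [lt_mem_nhds ht.1] with y hy
  rw [logScale, Real.log_div (by positivity) (ne_of_gt hy)]

theorem hasDerivAt_log_logScale {ℓ t : ℝ} (ht : t ∈ Ioc 0 ℓ) :
    HasDerivAt (fun t ↦ Real.log (logScale ℓ t)) (-(t * logScale ℓ t)⁻¹) t := by
  have h := (hasDerivAt_logScale ht).log (by linarith [two_le_logScale ht])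
  refine h.congr_deriv ?_
  have h1 : logScale ℓ t ≠ 0 := by linarith [two_le_logScale ht]
  have h2 : t ≠ 0 := ht.1.ne'
  field_simp

theorem tendsto_logScale {ℓ : ℝ} (hℓ : 0 < ℓ) : Tendsto (logScale ℓ) (𝓝[>] 0) atTop := by
  have h1 : Tendsto (fun x : ℝ ↦ Real.exp 2 * ℓ / x) (𝓝[>] 0) atTop := by
    simp only [div_eq_mul_inv]
    exact tendsto_inv_nhdsGT_zero.const_mul_atTop (by positivity)
  exact Real.tendsto_log_atTop.comp h1

/-- The weight `1 / (t log (e² ℓ / t) log log (e² ℓ / t))`. -/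
noncomputable def logWeight (ℓ t : ℝ) : ℝ := (t * logScale ℓ t * Real.log (logScale ℓ t))⁻¹

theorem logWeight_pos {ℓ t : ℝ} (ht : t ∈ Ioc 0 ℓ) : 0 < logWeight ℓ t := by
  have h1 := two_le_logScale ht
  have h2 := log_logScale_pos ht
  have h3 := ht.1
  unfold logWeight
  positivity

theorem continuousOn_logWeight (ℓ : ℝ) : ContinuousOn (logWeight ℓ) (Ioc 0 ℓ) := by
  intro t ht
  refine ContinuousAt.continuousWithinAt ?_
  have h1 := two_le_logScale ht
  have h2 := log_logScale_pos ht
  have h3 := ht.1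
  exact ((continuousAt_id.mul (hasDerivAt_logScale ht).continuousAt).mul
    (hasDerivAt_log_logScale ht).continuousAt).inv₀
      (mul_pos (mul_pos h3 (by linarith)) h2).ne'

/-- A function of size `√(t log (1/t))` at `0` is square integrable against `logWeight`. -/
theorem exists_memLp_logWeight_mul {ℓ R : ℝ} {g : ℝ → ℂ} (hℓ : 0 < ℓ) (hR : 0 < R)
    (hgc : ContinuousOn g (Ioo 0 ℓ))
    (hg : g =O[𝓝[>] 0] fun t ↦ Real.sqrt (t * Real.log (R / t))) :
    ∃ r, 0 < r ∧ MemLp (fun t ↦ (logWeight ℓ t : ℂ) * g t) 2 (volume.restrict (Ioo 0 r)) := by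
  obtain ⟨C, hC⟩ := hg.bound
  -- The last condition compares scales: `log (R / t)` differs from `logScale ℓ t` by the constant
  -- `log (R / (e² ℓ))`, so close to `0` it is at most `2 * logScale ℓ t`.
  obtain ⟨r, hr, hrs⟩ := mem_nhdsGT_iff_exists_Ioo_subset.1 (inter_mem (inter_mem hC
    (inter_mem (Ioo_mem_nhdsGT hℓ) (Ioo_mem_nhdsGT hR)))
    ((tendsto_logScale hℓ).eventually_ge_atTop (Real.log (R / (Real.exp 2 * ℓ)))))
  have hr : (0 : ℝ) < r := hr
  have hsub : Ioo 0 r ⊆ Ioo 0 ℓ := fun t ht ↦ (hrs ht).1.2.1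
  refine ⟨r, hr, ?_⟩
  have hm : AEStronglyMeasurable (fun t ↦ (logWeight ℓ t : ℂ) * g t) (volume.restrict (Ioo 0 r)) :=
    ((Complex.continuous_ofReal.comp_continuousOn ((continuousOn_logWeight ℓ).mono
      (hsub.trans Ioo_subset_Ioc_self))).mul (hgc.mono hsub)).aestronglyMeasurable measurableSet_Ioo
  rw [memLp_two_iff_integrable_sq_norm hm]
  -- the derivative of `1 / log log (e² ℓ / t)` is integrable at `0`
  have hrℓ : r / 2 < ℓ := (hsub ⟨half_pos hr, half_lt_self hr⟩).2
  have hrℓ' : r ≤ ℓ := by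
    by_contra h
    have := (hsub ⟨hℓ, not_le.1 h⟩).2
    linarith
  have hderiv : ∀ t ∈ Ioc 0 ℓ, HasDerivAt (fun t ↦ (Real.log (logScale ℓ t))⁻¹)
      ((t * logScale ℓ t)⁻¹ / Real.log (logScale ℓ t) ^ 2) t := by
    intro t ht
    have h := (hasDerivAt_log_logScale ht).fun_inv (log_logScale_pos ht).ne'
    rwa [neg_neg] at h
  -- With `L = logScale ℓ t`, the squared product is at most `2 C² / (t L (log L)²)`, a multiple of
  -- the derivative of `1 / log L`. That function is increasing and has a finite limit at `0`, so
  -- its derivative is integrable there.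
  have hint : IntegrableOn (fun t ↦ (t * logScale ℓ t)⁻¹ / Real.log (logScale ℓ t) ^ 2)
      (Ioc 0 r) := by
    refine intervalIntegral.integrableOn_deriv_of_nonneg
      (g := fun t ↦ (Real.log (logScale ℓ t))⁻¹) (fun t ht ↦ ?_)
      (fun t ht ↦ hderiv t ⟨ht.1, ht.2.le.trans hrℓ'⟩) fun t ht ↦ ?_
    · rcases ht.1.eq_or_lt with h0 | h0
      · subst h0
        -- The default values of division, logarithm and inverse at `0` combine to `0`, which agrees
        -- with the limit and makes the function continuous at the endpoint.
        have hz : (Real.log (logScale ℓ 0))⁻¹ = 0 := by simp [logScale]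
        have hlim : Tendsto (fun t ↦ (Real.log (logScale ℓ t))⁻¹) (𝓝[>] 0) (𝓝 0) :=
          tendsto_inv_atTop_zero.comp (Real.tendsto_log_atTop.comp (tendsto_logScale hℓ))
        have h1 : ContinuousWithinAt (fun t ↦ (Real.log (logScale ℓ t))⁻¹) (Ioi 0) 0 := by
          rw [ContinuousWithinAt, hz]
          exact hlim
        exact (continuousWithinAt_Ioi_iff_Ici.1 h1).mono Icc_subset_Ici_self
      · exact (hderiv t ⟨h0, ht.2.trans hrℓ'⟩).continuousAt.continuousWithinAt
    · have h1 := two_le_logScale (ℓ := ℓ) ⟨ht.1, ht.2.le.trans hrℓ'⟩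
      have h2 := ht.1
      positivity
  refine Integrable.mono' ((hint.mono_set Ioo_subset_Ioc_self).const_mul (2 * C ^ 2))
    (hm.norm.pow 2) ?_
  filter_upwards [ae_restrict_mem measurableSet_Ioo] with t ht
  obtain ⟨⟨h1, -, h2⟩, h3⟩ := hrs ht
  have ht0 := ht.1
  have htℓ : t ∈ Ioc 0 ℓ := ⟨ht.1, ht.2.le.trans hrℓ'⟩
  have hL := two_le_logScale htℓ
  have hW := log_logScale_pos htℓ
  have hlogR : Real.log (R / t) ≤ 2 * logScale ℓ t := by
    have e : Real.log (R / t) = Real.log (R / (Real.exp 2 * ℓ)) + logScale ℓ t := by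
      rw [logScale, ← Real.log_mul (by positivity) (by positivity)]
      congr 1
      field_simp
    have h3 : Real.log (R / (Real.exp 2 * ℓ)) ≤ logScale ℓ t := h3
    linarith
  have hlog0 : 0 ≤ Real.log (R / t) := Real.log_nonneg ((one_le_div ht0).2 h2.2.le)
  have h1 : ‖g t‖ ≤ C * ‖Real.sqrt (t * Real.log (R / t))‖ := h1
  rw [Real.norm_of_nonneg (Real.sqrt_nonneg _)] at h1
  have hg2 : ‖g t‖ ^ 2 ≤ C ^ 2 * (t * (2 * logScale ℓ t)) := by
    calc ‖g t‖ ^ 2 ≤ (C * Real.sqrt (t * Real.log (R / t))) ^ 2 := by gcongr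
      _ = C ^ 2 * (t * Real.log (R / t)) := by
        rw [mul_pow, Real.sq_sqrt (by positivity)]
      _ ≤ _ := by gcongr
  rw [Real.norm_of_nonneg (by positivity), norm_mul, Complex.norm_real, mul_pow,
    Real.norm_of_nonneg (logWeight_pos htℓ).le]
  calc logWeight ℓ t ^ 2 * ‖g t‖ ^ 2 ≤ logWeight ℓ t ^ 2 * (C ^ 2 * (t * (2 * logScale ℓ t))) := by
        gcongr
    _ = _ := by
        have : logScale ℓ t ≠ 0 := by linarith
        rw [logWeight]
        field_simp

/-- Smooth cutoffs of `(0,ℓ)` which vanish near `0` and exhaust the interval, with derivatives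
dominated by the weight `κ`. -/
structure IsCutoffSeq (ℓ : ℝ) (κ : ℝ → ℝ) (θ θ' : ℕ → ℝ → ℝ) : Prop where
  hasDerivAt : ∀ n, ∀ t ∈ Ioo 0 ℓ, HasDerivAt (θ n) (θ' n t) t
  continuousOn : ∀ n, ContinuousOn (θ' n) (Ioo 0 ℓ)
  nonneg : ∀ n t, 0 ≤ θ n t
  le_one : ∀ n t, θ n t ≤ 1
  bound : ∀ n, ∀ t ∈ Ioo 0 ℓ, |θ' n t| ≤ κ t
  eventually_eq : ∀ t ∈ Ioo 0 ℓ, ∀ᶠ n in atTop, θ n t = 1 ∧ θ' n t = 0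
  exists_zero : ∀ n, ∃ τ > 0, ∀ t ∈ Ioo 0 τ, θ n t = 0

theorem exists_isCutoffSeq {ℓ : ℝ} (hℓ : 0 < ℓ) :
    ∃ M θ θ', IsCutoffSeq ℓ (fun t ↦ M * logWeight ℓ t) θ θ' := by
  obtain ⟨M, hM⟩ := exists_bound_deriv_smoothTransition
  set W : ℝ → ℝ := fun t ↦ Real.log (logScale ℓ t) with hW
  -- The cutoff equals `1` where `W ≤ n + 1` and `0` where `W ≥ 2 (n + 1)`; since `W` tends to
  -- infinity at `0`, each cutoff vanishes near `0`.
  refine ⟨2 * M, fun n t ↦ Real.smoothTransition (2 - W t / (n + 1)), fun n t ↦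
    deriv Real.smoothTransition (2 - W t / (n + 1)) * ((t * logScale ℓ t)⁻¹ / (n + 1)),
    fun n t ht ↦ ?_, fun n ↦ ?_, fun n t ↦ Real.smoothTransition.nonneg _,
    fun n t ↦ Real.smoothTransition.le_one _, fun n t ht ↦ ?_, fun t ht ↦ ?_, fun n ↦ ?_⟩
  · have h1 := ((hasDerivAt_log_logScale (Ioo_subset_Ioc_self ht)).div_const
      ((n : ℝ) + 1)).const_sub 2
    have h2 : HasDerivAt Real.smoothTransition
        (deriv Real.smoothTransition (2 - W t / (n + 1))) (2 - W t / (n + 1)) :=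
      ((Real.smoothTransition.contDiff (n := 1)).differentiable one_ne_zero _).hasDerivAt
    refine (h2.comp t h1).congr_deriv ?_
    ring
  · have hWc : ContinuousOn W (Ioo 0 ℓ) := fun t ht ↦
      (hasDerivAt_log_logScale (Ioo_subset_Ioc_self ht)).continuousAt.continuousWithinAt
    have hc : Continuous (deriv Real.smoothTransition) :=
      (Real.smoothTransition.contDiff (n := 1)).continuous_deriv le_rfl
    refine (hc.comp_continuousOn (continuousOn_const.sub (hWc.div_const _))).mul
      (ContinuousOn.div_const (ContinuousOn.inv₀ (continuousOn_id.mul fun t ht ↦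
        (hasDerivAt_logScale (Ioo_subset_Ioc_self ht)).continuousAt.continuousWithinAt)
          fun t ht ↦ ?_) _)
    have h1 := two_le_logScale (Ioo_subset_Ioc_self ht)
    exact (mul_pos ht.1 (by linarith)).ne'
  · have ht' := Ioo_subset_Ioc_self ht
    have hL := two_le_logScale ht'
    have hW0 : 0 < W t := log_logScale_pos ht'
    have ht0 := ht.1
    have hn : (0 : ℝ) < n + 1 := by positivity
    have hM0 : 0 ≤ M := (abs_nonneg _).trans (hM 0)
    rcases lt_or_ge (2 - W t / (n + 1)) 0 with h | h
    · rw [deriv_smoothTransition_of_neg h, zero_mul, abs_zero]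
      have := logWeight_pos ht'
      positivity
    · rw [abs_mul, abs_of_pos (by positivity : 0 < (t * logScale ℓ t)⁻¹ / ((n : ℝ) + 1))]
      -- Where the derivative can be nonzero, `1 / (n + 1) ≤ 2 / W t`. This gains the extra factor
      -- `1 / log L` in the weight, uniformly in `n`.
      have h1 : W t ≤ 2 * (n + 1) := by
        rw [sub_nonneg, div_le_iff₀ hn] at h
        exact h
      have h2 : (t * logScale ℓ t)⁻¹ / ((n : ℝ) + 1) ≤ 2 * logWeight ℓ t := by
        have e : 2 * logWeight ℓ t = (t * logScale ℓ t)⁻¹ * (2 / W t) := by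
          rw [logWeight, mul_inv (t * logScale ℓ t)]
          ring
        rw [e, div_eq_mul_inv]
        refine mul_le_mul_of_nonneg_left ?_ (by positivity)
        rw [inv_eq_one_div, div_le_div_iff₀ hn hW0]
        linarith
      calc _ ≤ M * (2 * logWeight ℓ t) := mul_le_mul (hM _) h2 (by positivity) hM0
        _ = 2 * M * logWeight ℓ t := by ring
  · have h1 : Tendsto (fun n : ℕ ↦ (n : ℝ) + 1) atTop atTop :=
      tendsto_natCast_atTop_atTop.atTop_add tendsto_const_nhds
    filter_upwards [h1.eventually_gt_atTop (W t)] with n hn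
    have hn0 : (0 : ℝ) < n + 1 := by positivity
    have h2 : 1 < 2 - W t / (n + 1) := by
      have := (div_lt_one hn0).2 hn
      linarith
    exact ⟨Real.smoothTransition.one_of_one_le h2.le, by
      rw [deriv_smoothTransition_of_one_lt h2, zero_mul]⟩
  · have h1 : Tendsto W (𝓝[>] 0) atTop := Real.tendsto_log_atTop.comp (tendsto_logScale hℓ)
    obtain ⟨τ, hτ, hs⟩ := mem_nhdsGT_iff_exists_Ioo_subset.1
      (h1.eventually_ge_atTop (2 * ((n : ℝ) + 1)))
    refine ⟨τ, hτ, fun t ht ↦ Real.smoothTransition.zero_of_nonpos ?_⟩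
    have hn0 : (0 : ℝ) < n + 1 := by positivity
    have h2 : 2 * ((n : ℝ) + 1) ≤ W t := hs ht
    rw [sub_nonpos, le_div_iff₀ hn0]
    exact h2

/-! ### Sufficient conditions for membership in the minimal domain. -/

section Cutoff

variable {a b : ℝ} {φ : ℝ → ℝ}

/-- Products of maximal representatives with smooth functions. -/
theorem firstOrder_mul {f : ℝ → ℂ} {η η' : ℝ → ℝ} (hf : ACLoc a b f)
    (hη : ∀ x ∈ Ioo a b, HasDerivAt η (η' x) x) :
    firstOrder φ (fun x ↦ (η x : ℂ) * f x) =ᵐ[volume.restrict (Ioo a b)]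
      fun x ↦ (η x : ℂ) * firstOrder φ f x + (η' x : ℂ) * f x := by
  filter_upwards [hf.ae_differentiableAt, ae_restrict_mem measurableSet_Ioo] with x hx hxm
  have h := ((hη x hxm).ofReal_comp.fun_mul hx.hasDerivAt).deriv
  rw [firstOrder, h, firstOrder]
  ring

theorem ACLoc.ofReal_mul {f : ℝ → ℂ} {η η' : ℝ → ℝ} (hf : ACLoc a b f)
    (hη : ∀ x ∈ Ioo a b, HasDerivAt η (η' x) x) (hη' : ContinuousOn η' (Ioo a b)) :
    ACLoc a b fun x ↦ (η x : ℂ) * f x := by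
  intro c d hc hcd hd
  have hsub := uIcc_subset_Ioo (a := a) (b := b) ⟨hc, hcd.trans_lt hd⟩ ⟨hc.trans_le hcd, hd⟩
  exact (AbsolutelyContinuousOnInterval.of_hasDerivAt (fun x hx ↦ hη x (hsub hx))
    (hη'.mono hsub)).ofReal.complex_mul (hf c d hc hcd hd)

/-- Square integrability of `f` against the weights of two cutoff sequences implies that `f` lies in
the minimal domain. -/
theorem MaxRep.mem_minOp_domain_of_cutoff (hab : a < b) (hφ : ContinuousOn φ (Ioo a b))
    {u : L2 a b} {f : ℝ → ℂ} (hf : MaxRep a b φ u f) {κ : ℝ → ℝ} {θ θ' : ℕ → ℝ → ℝ}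
    (hθ : IsCutoffSeq (b - a) κ θ θ')
    (hl : MemLp (fun x ↦ (κ (x - a) : ℂ) * f x) 2 (volume.restrict (Ioo a b)))
    (hr : MemLp (fun x ↦ (κ (b - x) : ℂ) * f x) 2 (volume.restrict (Ioo a b))) :
    u ∈ (minOp a b φ).domain := by
  have hml : ∀ x ∈ Ioo a b, x - a ∈ Ioo 0 (b - a) := fun x hx ↦
    ⟨by linarith [hx.1], by linarith [hx.2]⟩
  have hmr : ∀ x ∈ Ioo a b, b - x ∈ Ioo 0 (b - a) := fun x hx ↦
    ⟨by linarith [hx.2], by linarith [hx.1]⟩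
  -- Truncation at both endpoints at once. In `η f`, the image is `η v + η' f`; the commutator term
  -- `η' f` is dominated by the two weighted functions and vanishes eventually at each point.
  set η : ℕ → ℝ → ℝ := fun n x ↦ θ n (x - a) * θ n (b - x) with hη
  set η' : ℕ → ℝ → ℝ := fun n x ↦ θ' n (x - a) * θ n (b - x) - θ n (x - a) * θ' n (b - x) with hη'
  have hd : ∀ n, ∀ x ∈ Ioo a b, HasDerivAt (η n) (η' n x) x := by
    intro n x hx
    have h1 := (hθ.hasDerivAt n _ (hml x hx)).comp x ((hasDerivAt_id x).sub_const a)
    have h2 := (hθ.hasDerivAt n _ (hmr x hx)).comp x ((hasDerivAt_id x).const_sub b)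
    refine (h1.fun_mul h2).congr_deriv ?_
    simp only [hη', Function.comp_apply, id]
    ring
  have hcl : ∀ n, ContinuousOn (fun x ↦ θ n (x - a)) (Ioo a b) := fun n x hx ↦
    ((hθ.hasDerivAt n _ (hml x hx)).comp x ((hasDerivAt_id x).sub_const a)
      ).continuousAt.continuousWithinAt
  have hcr : ∀ n, ContinuousOn (fun x ↦ θ n (b - x)) (Ioo a b) := fun n x hx ↦
    ((hθ.hasDerivAt n _ (hmr x hx)).comp x ((hasDerivAt_id x).const_sub b)
      ).continuousAt.continuousWithinAt
  have hdc : ∀ n, ContinuousOn (η' n) (Ioo a b) := fun n ↦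
    (((hθ.continuousOn n).comp (continuousOn_id.sub continuousOn_const) hml).mul (hcr n)).sub
      ((hcl n).mul ((hθ.continuousOn n).comp (continuousOn_const.sub continuousOn_id) hmr))
  have hη01 : ∀ n x, 0 ≤ η n x ∧ η n x ≤ 1 := fun n x ↦
    ⟨mul_nonneg (hθ.nonneg _ _) (hθ.nonneg _ _),
      mul_le_one₀ (hθ.le_one _ _) (hθ.nonneg _ _) (hθ.le_one _ _)⟩
  have hηm : ∀ n, AEStronglyMeasurable (fun x ↦ (η n x : ℂ)) (volume.restrict (Ioo a b)) := fun n ↦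
    (Complex.continuous_ofReal.comp_continuousOn ((hcl n).mul (hcr n))).aestronglyMeasurable
      measurableSet_Ioo
  have hη'm : ∀ n, AEStronglyMeasurable (fun x ↦ (η' n x : ℂ)) (volume.restrict (Ioo a b)) :=
    fun n ↦ (Complex.continuous_ofReal.comp_continuousOn (hdc n)).aestronglyMeasurable
      measurableSet_Ioo
  have hη'b : ∀ n, ∀ x ∈ Ioo a b, |η' n x| ≤ κ (x - a) + κ (b - x) := by
    intro n x hx
    have h1 := hθ.bound n _ (hml x hx)
    have h2 := hθ.bound n _ (hmr x hx)
    calc |η' n x| ≤ |θ' n (x - a) * θ n (b - x)| + |θ n (x - a) * θ' n (b - x)| := abs_sub _ _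
      _ ≤ |θ' n (x - a)| * 1 + 1 * |θ' n (b - x)| := by
        rw [abs_mul, abs_mul, abs_of_nonneg (hθ.nonneg n (b - x)),
          abs_of_nonneg (hθ.nonneg n (x - a))]
        gcongr
        · exact hθ.le_one _ _
        · exact hθ.le_one _ _
      _ ≤ _ := by linarith
  have hκ0 : ∀ t ∈ Ioo 0 (b - a), 0 ≤ κ t := fun t ht ↦ (abs_nonneg _).trans (hθ.bound 0 t ht)
  set v := firstOrder φ f with hv
  have hG := (hl.norm.add hr.norm)
  have hη'f : ∀ n, ∀ᵐ x ∂volume.restrict (Ioo a b), ‖(η' n x : ℂ) * f x‖ ≤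
      ‖(κ (x - a) : ℂ) * f x‖ + ‖(κ (b - x) : ℂ) * f x‖ := by
    intro n
    filter_upwards [ae_restrict_mem measurableSet_Ioo] with x hx
    simp only [norm_mul, Complex.norm_real, Real.norm_eq_abs]
    rw [abs_of_nonneg (hκ0 _ (hml x hx)), abs_of_nonneg (hκ0 _ (hmr x hx)), ← add_mul]
    exact mul_le_mul_of_nonneg_right (hη'b n x hx) (norm_nonneg _)
  have hfL := hf.memLp_rep
  have h1 : ∀ n, MemLp (fun x ↦ (η n x : ℂ) * f x) 2 (volume.restrict (Ioo a b)) := fun n ↦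
    hfL.of_le ((hηm n).mul hfL.1) (.of_forall fun x ↦ by
      rw [norm_mul, Complex.norm_real, Real.norm_of_nonneg (hη01 n x).1]
      exact mul_le_of_le_one_left (norm_nonneg _) (hη01 n x).2)
  have h2 : ∀ n, MemLp (fun x ↦ (η n x : ℂ) * v x) 2 (volume.restrict (Ioo a b)) := fun n ↦
    hf.memLp.of_le ((hηm n).mul hf.memLp.1) (.of_forall fun x ↦ by
      rw [norm_mul, Complex.norm_real, Real.norm_of_nonneg (hη01 n x).1]
      exact mul_le_of_le_one_left (norm_nonneg _) (hη01 n x).2)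
  have h3 : ∀ n, MemLp (fun x ↦ (η' n x : ℂ) * f x) 2 (volume.restrict (Ioo a b)) := fun n ↦
    hG.of_le ((hη'm n).mul hfL.1) (by
      filter_upwards [hη'f n] with x hx
      exact hx.trans (le_abs_self _))
  have h4 : ∀ n, MemLp (fun x ↦ (η n x : ℂ) * v x + (η' n x : ℂ) * f x) 2
      (volume.restrict (Ioo a b)) := fun n ↦ (h2 n).add (h3 n)
  have hev : ∀ x ∈ Ioo a b, ∀ᶠ n in atTop, η n x = 1 ∧ η' n x = 0 := by
    intro x hx
    filter_upwards [hθ.eventually_eq _ (hml x hx), hθ.eventually_eq _ (hmr x hx)] with n hn1 hn2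
    simp [hη, hη', hn1.1, hn1.2, hn2.1, hn2.2]
  refine LinearPMap.mem_domain_of_mem_graph (y := hf.memLp.toLp v)
    ((mem_graph_minOp_iff hab hφ).2 ⟨fun n ↦ ((h1 n).toLp _, (h4 n).toLp _), fun n ↦ ?_, ?_⟩)
  · refine mem_graph_preMinOp_iff.2 ⟨mem_graph_maxOp_iff.2 ⟨fun x ↦ (η n x : ℂ) * f x,
      ⟨hf.acLoc.ofReal_mul (hd n) (hdc n), (h1 n).coeFn_toLp,
        (memLp_congr_ae (firstOrder_mul hf.acLoc (hd n))).2 (h4 n)⟩,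
      (h4 n).coeFn_toLp.trans (firstOrder_mul hf.acLoc (hd n)).symm⟩, ?_⟩
    obtain ⟨τ, hτ, h0⟩ := hθ.exists_zero n
    refine ⟨Icc (a + τ) (b - τ), isCompact_Icc, fun x hx ↦ ⟨by linarith [hx.1], by linarith [hx.2]⟩,
      ?_⟩
    filter_upwards [(h1 n).coeFn_toLp, ae_restrict_mem measurableSet_Ioo] with x hx hxm hxn
    rw [hx]
    by_cases hxa : a + τ ≤ x
    · have hxb : b - τ < x := not_le.1 fun h ↦ hxn ⟨hxa, h⟩
      simp [hη, h0 (b - x) ⟨by linarith [hxm.2], by linarith⟩]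
    · rw [not_le] at hxa
      simp [hη, h0 (x - a) ⟨by linarith [hxm.1], by linarith⟩]
  · have hu : u = hfL.toLp f := Lp.ext (hf.ae_eq.trans hfL.coeFn_toLp.symm)
    refine Tendsto.prodMk_nhds ?_ ?_
    · rw [hu, Lp.tendsto_Lp_iff_tendsto_eLpNorm'']
      refine tendsto_eLpNorm_of_dominated (G := fun x ↦ 2 * ‖f x‖)
        (fun n ↦ ((h1 n).sub hfL).1) (hfL.norm.const_mul 2) (fun n ↦ .of_forall fun x ↦ ?_) ?_
      · refine (norm_sub_le _ _).trans ?_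
        rw [norm_mul, Complex.norm_real, Real.norm_of_nonneg (hη01 n x).1]
        have := mul_le_of_le_one_left (norm_nonneg (f x)) (hη01 n x).2
        linarith
      · filter_upwards [ae_restrict_mem measurableSet_Ioo] with x hx
        refine tendsto_const_nhds.congr' ?_
        filter_upwards [hev x hx] with n hn
        simp [hn.1]
    · rw [Lp.tendsto_Lp_iff_tendsto_eLpNorm'']
      refine tendsto_eLpNorm_of_dominated
        (G := fun x ↦ 2 * ‖v x‖ + (‖(κ (x - a) : ℂ) * f x‖ + ‖(κ (b - x) : ℂ) * f x‖))
        (fun n ↦ ((h4 n).sub hf.memLp).1) ((hf.memLp.norm.const_mul 2).add hG) (fun n ↦ ?_) ?_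
      · filter_upwards [hη'f n] with x hx
        have e : (η n x : ℂ) * v x + (η' n x : ℂ) * f x - v x =
            ((η n x : ℂ) * v x - v x) + (η' n x : ℂ) * f x := by ring
        rw [Pi.sub_apply, e]
        refine (norm_add_le _ _).trans (add_le_add ((norm_sub_le _ _).trans ?_) hx)
        rw [norm_mul, Complex.norm_real, Real.norm_of_nonneg (hη01 n x).1]
        have := mul_le_of_le_one_left (norm_nonneg (v x)) (hη01 n x).2
        linarith
      · filter_upwards [ae_restrict_mem measurableSet_Ioo] with x hx
        refine tendsto_const_nhds.congr' ?_
        filter_upwards [hev x hx] with n hn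
        simp [hn.1, hn.2]

theorem isBigO_sqrt_log_of_isBigO_sqrt {g : ℝ → ℂ} (hg : g =O[𝓝[>] 0] Real.sqrt) :
    g =O[𝓝[>] 0] fun t ↦ Real.sqrt (t * Real.log (1 / t)) := by
  refine hg.trans (Asymptotics.IsBigO.of_bound 1 ?_)
  -- Below `1 / e` the factor `log (1 / t)` is at least `1`.
  filter_upwards [Ioo_mem_nhdsGT (Real.exp_pos (-1))] with t ht
  rw [Real.norm_of_nonneg (Real.sqrt_nonneg _), Real.norm_of_nonneg (Real.sqrt_nonneg _), one_mul]
  refine Real.sqrt_le_sqrt (le_mul_of_one_le_right ht.1.le ?_)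
  rw [Real.le_log_iff_exp_le (by have := ht.1; positivity), le_div_iff₀ ht.1]
  calc Real.exp 1 * t ≤ Real.exp 1 * Real.exp (-1) := by
        have := ht.2.le
        gcongr
    _ = 1 := by rw [← Real.exp_add]; simp

/-- A representative of size `√(t log (1/t))` at both endpoints lies in the minimal domain. -/
theorem MaxRep.mem_minOp_domain (hab : a < b) (hφ : ContinuousOn φ (Ioo a b)) {u : L2 a b}
    {f : ℝ → ℂ} (hf : MaxRep a b φ u f) {R R' : ℝ} (hR : 0 < R) (hR' : 0 < R')
    (hl : (fun t ↦ f (a + 1 * t)) =O[𝓝[>] 0] fun t ↦ Real.sqrt (t * Real.log (R / t)))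
    (hr : (fun t ↦ f (b + -1 * t)) =O[𝓝[>] 0] fun t ↦ Real.sqrt (t * Real.log (R' / t))) :
    u ∈ (minOp a b φ).domain := by
  have hℓ : 0 < b - a := sub_pos.2 hab
  obtain ⟨M, θ, θ', hθ⟩ := exists_isCutoffSeq hℓ
  have hcl : ContinuousOn (fun t ↦ f (a + 1 * t)) (Ioo 0 (b - a)) :=
    hf.acLoc.continuousOn.comp (by fun_prop) fun t ht ↦ ⟨by linarith [ht.1], by linarith [ht.2]⟩
  have hcr : ContinuousOn (fun t ↦ f (b + -1 * t)) (Ioo 0 (b - a)) :=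
    hf.acLoc.continuousOn.comp (by fun_prop) fun t ht ↦ ⟨by linarith [ht.2], by linarith [ht.1]⟩
  obtain ⟨r, hr0, hrL⟩ := exists_memLp_logWeight_mul hℓ hR hcl hl
  obtain ⟨r', hr0', hrL'⟩ := exists_memLp_logWeight_mul hℓ hR' hcr hr
  have h1 := (memLp_weight_left hr0 (continuousOn_logWeight _) hf.memLp_rep hrL).const_mul (M : ℂ)
  have h2 := (memLp_weight_right hr0' (continuousOn_logWeight _) hf.memLp_rep hrL').const_mul
    (M : ℂ)
  refine hf.mem_minOp_domain_of_cutoff hab hφ hθ ?_ ?_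
  · convert h1 using 2 with x
    push_cast
    ring
  · convert h2 using 2 with x
    push_cast
    ring

end Cutoff

/-! ### Smooth compactly supported functions form a core. -/

section Core

variable {a b : ℝ} {φ : ℝ → ℝ}

/-- The potential is bounded on compact subsets of `(a,b)`, so its endpoint singularities play no
role for compactly supported functions. -/
theorem memLp_mul_of_eq_zero_off_compact (hφ : ContinuousOn φ (Ioo a b)) {f : ℝ → ℂ}
    (hf : MemLp f 2 (volume.restrict (Ioo a b))) {K : Set ℝ} (hK : IsCompact K)
    (hKs : K ⊆ Ioo a b) (h0 : ∀ x ∈ Ioo a b, x ∉ K → f x = 0) :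
    MemLp (fun x ↦ (φ x : ℂ) * f x) 2 (volume.restrict (Ioo a b)) := by
  obtain ⟨C, hC⟩ := hK.exists_bound_of_continuousOn (hφ.mono hKs)
  refine hf.of_le_mul (c := C) (((Complex.continuous_ofReal.comp_continuousOn hφ
    ).aestronglyMeasurable measurableSet_Ioo).mul hf.1) ?_
  filter_upwards [ae_restrict_mem measurableSet_Ioo] with x hx
  by_cases hxK : x ∈ K
  · rw [norm_mul, Complex.norm_real]
    exact mul_le_mul_of_nonneg_right (hC x hxK) (norm_nonneg _)
  · simp [h0 x hx hxK]

/-- A test function represents itself in the maximal domain. -/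
theorem maxRep_of_testFunction (hφ : ContinuousOn φ (Ioo a b)) {u : L2 a b} {g : ℝ → ℂ}
    (hg : ContDiff ℝ ∞ g) (hgc : HasCompactSupport g) (hgs : tsupport g ⊆ Ioo a b)
    (hu : u =ᵐ[volume.restrict (Ioo a b)] g) : MaxRep a b φ u g where
  acLoc := fun c d _ _ _ ↦ ContDiffOn.absolutelyContinuousOnInterval
    (hg.of_le (by exact_mod_cast le_top)).contDiffOn
  ae_eq := hu
  memLp := by
    have h1 : Continuous (deriv g) := hg.continuous_deriv (by exact_mod_cast le_top)
    have h2 : MemLp (deriv g) 2 (volume.restrict (Ioo a b)) :=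
      h1.memLp_of_hasCompactSupport hgc.deriv
    exact h2.add (memLp_mul_of_eq_zero_off_compact hφ
      (hg.continuous.memLp_of_hasCompactSupport hgc) hgc hgs
      fun x _ hx ↦ image_eq_zero_of_notMem_tsupport hx)

theorem testFunctions_le_compactlySupported : testFunctions a b ≤ compactlySupported a b := by
  rintro u ⟨g, -, hgc, hgs, hu⟩
  refine ⟨tsupport g, hgc, hgs, ?_⟩
  filter_upwards [hu] with x hx hxn
  rw [hx, image_eq_zero_of_notMem_tsupport hxn]

theorem testFunctions_le_minOp_domain (hφ : ContinuousOn φ (Ioo a b)) :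
    testFunctions a b ≤ (minOp a b φ).domain := by
  intro u hu
  obtain ⟨g, hg, hgc, hgs, hug⟩ := hu
  exact (LinearPMap.le_closure (preMinOp a b φ)).1
    ⟨testFunctions_le_compactlySupported ⟨g, hg, hgc, hgs, hug⟩, g,
      maxRep_of_testFunction hφ hg hgc hgs hug⟩

/-- A smooth function `(0 ≤ κ ≤ 1)` equal to one on `[c,d]`, positive exactly on `(c₁,d₁)`. -/
theorem exists_smooth_plateau {c₁ c d d₁ : ℝ} (h1 : c₁ < c) (h3 : d < d₁) :
    ∃ κ : ℝ → ℝ, ContDiff ℝ ∞ κ ∧ (∀ x, 0 ≤ κ x) ∧ (∀ x, κ x ≤ 1) ∧ (∀ x ∈ Icc c d, κ x = 1) ∧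
      (∀ x ∉ Ioo c₁ d₁, κ x = 0) ∧ ∀ x ∈ Ioo c₁ d₁, 0 < κ x := by
  have e1 : 0 < c - c₁ := sub_pos.2 h1
  have e2 : 0 < d₁ - d := sub_pos.2 h3
  refine ⟨fun x ↦ Real.smoothTransition ((x - c₁) / (c - c₁)) *
    Real.smoothTransition ((d₁ - x) / (d₁ - d)), ?_, fun x ↦ ?_, fun x ↦ ?_, fun x hx ↦ ?_,
    fun x hx ↦ ?_, fun x hx ↦ ?_⟩
  · exact (Real.smoothTransition.contDiff.comp ((contDiff_id.sub contDiff_const).div_const _)).mul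
      (Real.smoothTransition.contDiff.comp ((contDiff_const.sub contDiff_id).div_const _))
  · exact mul_nonneg (Real.smoothTransition.nonneg _) (Real.smoothTransition.nonneg _)
  · exact mul_le_one₀ (Real.smoothTransition.le_one _) (Real.smoothTransition.nonneg _)
      (Real.smoothTransition.le_one _)
  · simp only
    rw [Real.smoothTransition.one_of_one_le ((one_le_div e1).2 (by linarith [hx.1])),
      Real.smoothTransition.one_of_one_le ((one_le_div e2).2 (by linarith [hx.2])), one_mul]
  · simp only
    rw [mem_Ioo, not_and_or, not_lt, not_lt] at hx
    rcases hx with hx | hx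
    · rw [Real.smoothTransition.zero_of_nonpos (div_nonpos_of_nonpos_of_nonneg (by linarith) e1.le),
        zero_mul]
    · rw [Real.smoothTransition.zero_of_nonpos (div_nonpos_of_nonpos_of_nonneg (by linarith) e2.le),
        mul_zero]
  · exact mul_pos (Real.smoothTransition.pos_of_pos (div_pos (by linarith [hx.1]) e1))
      (Real.smoothTransition.pos_of_pos (div_pos (by linarith [hx.2]) e2))

/-- The primitive of a smooth function is smooth. -/
theorem contDiff_primitive {k : ℝ → ℂ} (hk : ContDiff ℝ ∞ k) (c : ℝ) :
    ContDiff ℝ ∞ (fun x ↦ ∫ t in c..x, k t) ∧ deriv (fun x ↦ ∫ t in c..x, k t) = k := by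
  have h1 : ∀ x, HasDerivAt (fun x ↦ ∫ t in c..x, k t) (k x) x := fun x ↦
    intervalIntegral.integral_hasDerivAt_right (hk.continuous.intervalIntegrable _ _)
      hk.continuous.stronglyMeasurable.stronglyMeasurableAtFilter hk.continuous.continuousAt
  have h2 : deriv (fun x ↦ ∫ t in c..x, k t) = k := funext fun x ↦ (h1 x).deriv
  refine ⟨contDiff_infty_iff_deriv.2 ⟨fun x ↦ (h1 x).differentiableAt, ?_⟩, h2⟩
  rwa [h2]

/-- Compactly supported elements of the maximal domain are graph limits of test functions. -/
theorem exists_testFunctions_tendsto (hab : a < b) (hφ : ContinuousOn φ (Ioo a b)) {u w : L2 a b}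
    (h : (u, w) ∈ (preMinOp a b φ).graph) :
    ∃ q : ℕ → L2 a b × L2 a b, (∀ n, q n ∈ (maxOp a b φ).graph ∧ (q n).1 ∈ testFunctions a b) ∧
      Tendsto q atTop (𝓝 (u, w)) := by
  obtain ⟨hg, hu⟩ := mem_graph_preMinOp_iff.1 h
  obtain ⟨f, hf, hw⟩ := mem_graph_maxOp_iff.1 hg
  obtain ⟨c, d, hc, hcd, hd, h0⟩ := hf.exists_Icc_of_compactlySupported hab hu
  have hfL := hf.memLp_rep
  obtain ⟨c₁, hc₁, hc₁c⟩ := exists_between hc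
  obtain ⟨d₁, hdd₁, hd₁⟩ := exists_between hd
  have hcd₁ : c₁ < d₁ := hc₁c.trans_le (hcd.trans hdd₁.le)
  have hc₁m : c₁ ∈ Ioo a b := ⟨hc₁, hcd₁.trans hd₁⟩
  have hd₁m : d₁ ∈ Ioo a b := ⟨hc₁.trans hcd₁, hd₁⟩
  have hsub : Icc c₁ d₁ ⊆ Ioo a b := fun x hx ↦ ⟨hc₁.trans_le hx.1, hx.2.trans_lt hd₁⟩
  have hsub' : Icc c d ⊆ Ioo a b := fun x hx ↦ ⟨hc.trans_le hx.1, hx.2.trans_lt hd⟩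
  have hφf := memLp_mul_of_eq_zero_off_compact hφ hfL isCompact_Icc hsub' h0
  have hdf : MemLp (deriv f) 2 (volume.restrict (Ioo a b)) := by
    refine (memLp_congr_ae (.of_forall fun x ↦ ?_)).1 (hf.memLp.sub hφf)
    simp [firstOrder]
  have hdf0 : ∀ x ∈ Ioo a b, x ∉ Icc c d → deriv f x = 0 := by
    intro x hx hxn
    have h1 : f =ᶠ[𝓝 x] fun _ ↦ 0 := by
      filter_upwards [isOpen_Ioo.mem_nhds hx, isClosed_Icc.isOpen_compl.mem_nhds hxn] with y hy hyn
      exact h0 y hy hyn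
    rw [h1.deriv_eq, deriv_const]
  obtain ⟨κ, hκ, hκ0, hκ1, hκone, hκz, hκpos⟩ := exists_smooth_plateau hc₁c hdd₁
  have hκC : ContDiff ℝ ∞ (fun x ↦ (κ x : ℂ)) := Complex.ofRealCLM.contDiff.comp hκ
  set I₁ : ℂ := ∫ x in c₁..d₁, (κ x : ℂ) with hI₁
  have hI₁0 : I₁ ≠ 0 := by
    have h1 : 0 < ∫ x in c₁..d₁, κ x := intervalIntegral.intervalIntegral_pos_of_pos_on
      (hκ.continuous.intervalIntegrable _ _) hκpos hcd₁
    rw [hI₁, intervalIntegral.integral_ofReal]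
    exact_mod_cast h1.ne'
  -- These approximate `f'` in `L²`, not `f` itself, so that convergence of the derivatives is built
  -- in and the functions are recovered by integration.
  choose g hgc hgs hgn using fun n : ℕ ↦ hdf.exist_eLpNorm_sub_le (by norm_num) (by norm_num)
    (show (0 : ℝ) < 1 / ((n : ℝ) + 1) by positivity)
  -- smooth approximations of `f'` with support in `[c₁,d₁]`, corrected to have integral zero
  set m : ℕ → ℂ := fun n ↦ (∫ x in c₁..d₁, (κ x : ℂ) * g n x) / I₁ with hm
  set k : ℕ → ℝ → ℂ := fun n x ↦ (κ x : ℂ) * g n x - m n * κ x with hk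
  have hkd : ∀ n, ContDiff ℝ ∞ (k n) := fun n ↦ (hκC.mul (hgs n)).sub (contDiff_const.mul hκC)
  have hk0 : ∀ n, ∀ x ∉ Ioo c₁ d₁, k n x = 0 := fun n x hx ↦ by simp [hk, hκz x hx]
  have hki : ∀ n, ∫ x in c₁..d₁, k n x = 0 := by
    intro n
    rw [hk]
    simp only
    rw [intervalIntegral.integral_sub ((hκC.mul (hgs n)).continuous.intervalIntegrable _ _)
      ((contDiff_const.mul hκC).continuous.intervalIntegrable _ _),
      intervalIntegral.integral_const_mul, ← hI₁, hm]
    simp only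
    rw [div_mul_cancel₀ _ hI₁0, sub_self]
  -- The vanishing total integral is what makes the primitive zero again beyond `d₁`, hence
  -- compactly supported.
  set G : ℕ → ℝ → ℂ := fun n x ↦ ∫ t in c₁..x, k n t with hG
  have hGd : ∀ n, ContDiff ℝ ∞ (G n) := fun n ↦ (contDiff_primitive (hkd n) c₁).1
  have hGderiv : ∀ n, deriv (G n) = k n := fun n ↦ (contDiff_primitive (hkd n) c₁).2
  have hG0 : ∀ n, ∀ x ∉ Icc c₁ d₁, G n x = 0 := by
    intro n x hx
    rw [mem_Icc, not_and_or, not_le, not_le] at hx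
    rcases hx with hx | hx
    · refine (intervalIntegral.integral_congr (g := fun _ ↦ 0) fun t ht ↦ ?_).trans (by simp)
      rw [uIcc_of_ge hx.le] at ht
      exact hk0 n t fun h ↦ by linarith [h.1, ht.2]
    · have h1 : ∫ t in d₁..x, k n t = 0 := by
        refine (intervalIntegral.integral_congr (g := fun _ ↦ 0) fun t ht ↦ ?_).trans (by simp)
        rw [uIcc_of_le hx.le] at ht
        exact hk0 n t fun h ↦ by linarith [h.2, ht.1]
      change ∫ t in c₁..x, k n t = 0
      rw [← intervalIntegral.integral_add_adjacent_intervals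
        ((hkd n).continuous.intervalIntegrable c₁ d₁)
        ((hkd n).continuous.intervalIntegrable d₁ x), hki, h1, add_zero]
  have hGt : ∀ n, tsupport (G n) ⊆ Icc c₁ d₁ := fun n ↦
    closure_minimal (fun x hx ↦ by_contra fun hxn ↦ hx (hG0 n x hxn)) isClosed_Icc
  have hGc : ∀ n, HasCompactSupport (G n) := fun n ↦
    isCompact_Icc.of_isClosed_subset (isClosed_tsupport _) (hGt n)
  have hGL : ∀ n, MemLp (G n) 2 (volume.restrict (Ioo a b)) := fun n ↦
    (hGd n).continuous.memLp_of_hasCompactSupport (hGc n)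
  -- convergence of the derivatives
  have hκsupp : HasCompactSupport (fun x ↦ (κ x : ℂ)) :=
    HasCompactSupport.intro (isCompact_Icc (a := c₁) (b := d₁)) fun x hx ↦ by
      simp [hκz x fun h ↦ hx (Ioo_subset_Icc_self h)]
  have hκL : MemLp (fun x ↦ (κ x : ℂ)) 2 (volume.restrict (Ioo a b)) :=
    hκC.continuous.memLp_of_hasCompactSupport hκsupp
  have hκgL : ∀ n, MemLp (fun x ↦ (κ x : ℂ) * g n x) 2 (volume.restrict (Ioo a b)) := fun n ↦
    (hκC.mul (hgs n)).continuous.memLp_of_hasCompactSupport (hgc n).mul_left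
  have hκg : Tendsto (fun n ↦ (hκgL n).toLp _) atTop (𝓝 (hdf.toLp _)) := by
    rw [Lp.tendsto_Lp_iff_tendsto_eLpNorm'']
    have h1 : Tendsto (fun n : ℕ ↦ ENNReal.ofReal (1 / ((n : ℝ) + 1))) atTop (𝓝 0) := by
      simpa using ENNReal.tendsto_ofReal tendsto_one_div_add_atTop_nhds_zero_nat
    refine tendsto_of_tendsto_of_tendsto_of_le_of_le tendsto_const_nhds h1 (fun n ↦ zero_le)
      fun n ↦ le_trans ?_ (hgn n)
    refine eLpNorm_mono_ae ?_
    filter_upwards [ae_restrict_mem measurableSet_Ioo] with x hx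
    -- The plateau is `1` on `[c,d]`, outside of which `f'` vanishes, so `κ f' = f'` and
    -- multiplication by `κ` does not increase the error.
    have h2 : (κ x : ℂ) * g n x - deriv f x = (κ x : ℂ) * (g n x - deriv f x) := by
      by_cases hxc : x ∈ Icc c d
      · simp [hκone x hxc]
      · simp [hdf0 x hx hxc]
    rw [Pi.sub_apply, h2, norm_mul, Complex.norm_real, Real.norm_of_nonneg (hκ0 x), Pi.sub_apply,
      norm_sub_rev]
    exact mul_le_of_le_one_left (norm_nonneg _) (hκ1 x)
  have hcongr : ∀ {p : ℝ → ℂ} (hp : MemLp p 2 (volume.restrict (Ioo a b))), ∀ x ∈ Ioo a b,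
      ∀ y ∈ Ioo a b, ∫ t in x..y, (((fun _ ↦ 1 : ℝ → ℝ) t : ℝ) : ℂ) * hp.toLp p t =
        ∫ t in x..y, p t := by
    intro p hp x hx y hy
    have h1 := hp.coeFn_toLp
    rw [EventuallyEq, ae_restrict_iff' measurableSet_Ioo] at h1
    refine intervalIntegral.integral_congr_ae ?_
    filter_upwards [h1] with t ht htm
    simp [ht (uIcc_subset_Ioo hx hy (uIoc_subset_uIcc htm))]
  have hFTC : ∀ x ∈ Ioo a b, ∫ t in c₁..x, deriv f t = f x := by
    intro x hx
    rw [(hf.acLoc.absolutelyContinuousOnInterval hc₁m hx).integral_deriv_eq_sub_complex,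
      h0 c₁ hc₁m fun h ↦ absurd h.1 (not_le.2 hc₁c), sub_zero]
  have hone : ContinuousOn (fun _ ↦ 1 : ℝ → ℝ) (Ioo a b) := continuousOn_const
  -- The corrections tend to the integral of `f'` over `[c₁,d₁]` divided by `I₁`, and that integral
  -- is `f d₁ - f c₁ = 0`.
  have hm0 : Tendsto m atTop (𝓝 0) := by
    have h1 := (tendsto_integral_mul_of_tendsto hone hκg hc₁m hd₁m).div_const I₁
    rw [hcongr hdf _ hc₁m _ hd₁m, hFTC d₁ hd₁m, h0 d₁ hd₁m fun h ↦ absurd h.2 (not_le.2 hdd₁),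
      zero_div] at h1
    exact h1.congr fun n ↦ by rw [hcongr (hκgL n) _ hc₁m _ hd₁m]
  have hkL : ∀ n, MemLp (k n) 2 (volume.restrict (Ioo a b)) := fun n ↦
    (hκgL n).sub (hκL.const_mul (m n))
  have hkt : Tendsto (fun n ↦ (hkL n).toLp _) atTop (𝓝 (hdf.toLp _)) := by
    have h1 := hκg.sub (hm0.smul_const (hκL.toLp _))
    rw [zero_smul, sub_zero] at h1
    refine h1.congr fun n ↦ ?_
    rw [← MemLp.toLp_const_smul, ← MemLp.toLp_sub]
    rfl
  -- convergence of the primitives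
  have hGpt : ∀ x ∈ Ioo a b, Tendsto (fun n ↦ G n x) atTop (𝓝 (f x)) := by
    intro x hx
    have h1 := tendsto_integral_mul_of_tendsto hone hkt hc₁m hx
    rw [hcongr hdf _ hc₁m _ hx, hFTC x hx] at h1
    exact h1.congr fun n ↦ hcongr (hkL n) _ hc₁m _ hx
  obtain ⟨B, hB⟩ := hkt.norm.bddAbove_range
  -- Cauchy-Schwarz and the boundedness of the norms of `k n` give a uniform bound, so pointwise
  -- convergence becomes `L²` convergence on the finite interval.
  have hGb : ∀ n, ∀ x ∈ Ioo a b, ‖G n x‖ ≤ Real.sqrt (d₁ - c₁) * B := by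
    intro n x hx
    have hB' : ‖(hkL n).toLp (k n)‖ ≤ B := hB ⟨n, rfl⟩
    have hB0 : 0 ≤ B := (norm_nonneg _).trans hB'
    by_cases hxm : x ∈ Icc c₁ d₁
    · have h1 := norm_integral_mul_le (P := fun _ ↦ 1) hxm.1 continuousOn_const
        ((Lp.memLp ((hkL n).toLp (k n))).mono_measure (Measure.restrict_mono_set _
          (show Ioc c₁ x ⊆ Ioo a b from fun t ht ↦ ⟨hc₁.trans ht.1, ht.2.trans_lt hx.2⟩)))
      rw [hcongr (hkL n) _ hc₁m _ hx] at h1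
      refine h1.trans (mul_le_mul (Real.sqrt_le_sqrt ?_)
        ((sqrt_integral_le_norm _ hc₁ hxm.1 hx.2).trans hB') (Real.sqrt_nonneg _)
        (Real.sqrt_nonneg _))
      simp only [one_pow, intervalIntegral.integral_const, smul_eq_mul, mul_one]
      linarith [hxm.2]
    · rw [hG0 n x hxm, norm_zero]
      positivity
  set D : ℝ := Real.sqrt (d₁ - c₁) * B with hD
  have hfin : IsFiniteMeasure (volume.restrict (Ioo a b)) := ⟨by simp⟩
  have hdom : MemLp (fun x ↦ D + ‖f x‖) 2 (volume.restrict (Ioo a b)) :=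
    (memLp_const D).add hfL.norm
  have hGt2 : Tendsto (fun n ↦ (hGL n).toLp _) atTop (𝓝 (hfL.toLp _)) := by
    rw [Lp.tendsto_Lp_iff_tendsto_eLpNorm'']
    refine tendsto_eLpNorm_of_dominated (fun n ↦ ((hGL n).sub hfL).1) hdom (fun n ↦ ?_) ?_
    · filter_upwards [ae_restrict_mem measurableSet_Ioo] with x hx
      exact (norm_sub_le _ _).trans (by linarith [hGb n x hx])
    · filter_upwards [ae_restrict_mem measurableSet_Ioo] with x hx
      simpa using (hGpt x hx).sub_const (f x)
  have hφG : ∀ n, MemLp (fun x ↦ (φ x : ℂ) * G n x) 2 (volume.restrict (Ioo a b)) := fun n ↦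
    memLp_mul_of_eq_zero_off_compact hφ (hGL n) isCompact_Icc hsub fun x _ hx ↦ hG0 n x hx
  obtain ⟨C, hC⟩ := isCompact_Icc.exists_bound_of_continuousOn (hφ.mono hsub)
  have hφt : Tendsto (fun n ↦ (hφG n).toLp _) atTop (𝓝 (hφf.toLp _)) := by
    rw [Lp.tendsto_Lp_iff_tendsto_eLpNorm'']
    refine tendsto_eLpNorm_of_dominated (G := fun x ↦ C * (D + ‖f x‖))
      (fun n ↦ ((hφG n).sub hφf).1) (hdom.const_mul C) (fun n ↦ ?_) ?_
    · have hC0 : 0 ≤ C := (norm_nonneg _).trans (hC c₁ (left_mem_Icc.2 hcd₁.le))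
      filter_upwards [ae_restrict_mem measurableSet_Ioo] with x hx
      rw [Pi.sub_apply, ← mul_sub, norm_mul, Complex.norm_real]
      by_cases hxm : x ∈ Icc c₁ d₁
      · exact mul_le_mul (hC x hxm) ((norm_sub_le _ _).trans (by linarith [hGb n x hx]))
          (norm_nonneg _) hC0
      · have h1 : x ∉ Icc c d := fun h ↦ hxm ⟨hc₁c.le.trans h.1, h.2.trans hdd₁.le⟩
        rw [hG0 n x hxm, h0 x hx h1, sub_zero, norm_zero, mul_zero, add_zero]
        exact mul_nonneg hC0 ((norm_nonneg _).trans (hGb n x hx))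
    · filter_upwards [ae_restrict_mem measurableSet_Ioo] with x hx
      simpa using ((hGpt x hx).const_mul (φ x : ℂ)).sub_const ((φ x : ℂ) * f x)
  refine ⟨fun n ↦ ((hGL n).toLp _, (hkL n).toLp _ + (hφG n).toLp _), fun n ↦ ⟨?_, ?_⟩, ?_⟩
  · refine mem_graph_maxOp_iff.2 ⟨G n, maxRep_of_testFunction hφ (hGd n) (hGc n)
      ((hGt n).trans hsub) (hGL n).coeFn_toLp, ?_⟩
    filter_upwards [Lp.coeFn_add ((hkL n).toLp (k n)) ((hφG n).toLp _), (hkL n).coeFn_toLp,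
      (hφG n).coeFn_toLp] with x h1 h2 h3
    rw [h1, Pi.add_apply, h2, h3, firstOrder, hGderiv n]
  · exact ⟨G n, hGd n, hGc n, (hGt n).trans hsub, (hGL n).coeFn_toLp⟩
  · have hu' : u = hfL.toLp f := Lp.ext (hf.ae_eq.trans hfL.coeFn_toLp.symm)
    have hw' : w = hdf.toLp _ + hφf.toLp _ := by
      rw [← MemLp.toLp_add]
      exact Lp.ext (hw.trans (hdf.add hφf).coeFn_toLp.symm)
    rw [hu', hw']
    exact hGt2.prodMk_nhds (hkt.add hφt)

/-- Both operators are compared through their graphs: closedness of the minimal operator gives one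
inclusion of closures, and for the other every point of the preminimal graph is a limit of graph
points over test functions. -/
theorem minOp_hasCore_testFunctions (hab : a < b) (hφ : ContinuousOn φ (Ioo a b)) :
    (minOp a b φ).HasCore (testFunctions a b) := by
  have hle := testFunctions_le_minOp_domain (a := a) (b := b) hφ
  have hcl : (minOp a b φ).IsClosed := (preMinOp_isClosable hab hφ).closure_isClosed
  have hS : (minOp a b φ).domRestrict (testFunctions a b) ≤ minOp a b φ :=
    LinearPMap.domRestrict_le
  refine ⟨hle, LinearPMap.eq_of_eq_graph ?_⟩
  rw [← (hcl.isClosable.leIsClosable hS).graph_closure_eq_closure_graph]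
  refine le_antisymm ?_ ?_
  · exact Submodule.topologicalClosure_minimal _ (LinearPMap.le_graph_of_le hS) hcl
  · rw [show (minOp a b φ).graph = (preMinOp a b φ).graph.topologicalClosure from
      ((preMinOp_isClosable hab hφ).graph_closure_eq_closure_graph).symm]
    refine Submodule.topologicalClosure_minimal _ ?_ (Submodule.isClosed_topologicalClosure _)
    rintro ⟨u, w⟩ huw
    obtain ⟨q, hq, hlim⟩ := exists_testFunctions_tendsto hab hφ huw
    refine mem_closure_of_tendsto hlim (.of_forall fun n ↦ ?_)
    have h1 : (q n).1 ∈ (minOp a b φ).domain := hle (hq n).2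
    obtain ⟨y, hy1, hy2⟩ := (LinearPMap.mem_graph_iff _).1 (hq n).1
    refine (LinearPMap.mem_graph_iff _).2 ⟨⟨(q n).1, (hq n).2, h1⟩, rfl, ?_⟩
    rw [← hy2]
    exact (minOp_le_maxOp hab hφ).2 (x := ⟨(q n).1, h1⟩) (y := y) hy1.symm

end Core

/-! ### Elements of the maximal domain that violate the endpoint condition. -/

section Witness

variable {a b sa sb δ : ℝ} {φ : ℝ → ℝ}

theorem exists_maxRep_of_bound {F F' P : ℝ → ℝ} {C D : ℝ} (hφ : ContinuousOn φ (Ioo a b))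
    (hF : ∀ x ∈ Ioo a b, HasDerivAt F (F' x) x) (hF' : ContinuousOn F' (Ioo a b))
    (hP : MemLp P 2 (volume.restrict (Ioo a b))) (hC : ∀ x ∈ Ioo a b, |F x| ≤ C * P x)
    (hD : ∀ x ∈ Ioo a b, |F' x + φ x * F x| ≤ D * P x) :
    ∃ u : L2 a b, MaxRep a b φ u (fun x ↦ (F x : ℂ)) := by
  have hFc : ContinuousOn F (Ioo a b) := fun x hx ↦ (hF x hx).continuousAt.continuousWithinAt
  have hd : ∀ x ∈ Ioo a b, HasDerivAt (fun x ↦ (F x : ℂ)) (F' x : ℂ) x := fun x hx ↦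
    (hF x hx).ofReal_comp
  have hm : ∀ {G : ℝ → ℝ}, ContinuousOn G (Ioo a b) →
      AEStronglyMeasurable (fun x ↦ (G x : ℂ)) (volume.restrict (Ioo a b)) := fun hG ↦
    (Complex.continuous_ofReal.comp_continuousOn hG).aestronglyMeasurable measurableSet_Ioo
  have h1 : MemLp (fun x ↦ (F x : ℂ)) 2 (volume.restrict (Ioo a b)) := by
    refine (hP.const_mul C).mono' (hm hFc) ?_
    filter_upwards [ae_restrict_mem measurableSet_Ioo] with x hx
    rw [Complex.norm_real]
    exact hC x hx
  have h2 : MemLp (fun x ↦ ((F' x + φ x * F x : ℝ) : ℂ)) 2 (volume.restrict (Ioo a b)) := by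
    refine (hP.const_mul D).mono' (hm (hF'.add (hφ.mul hFc))) ?_
    filter_upwards [ae_restrict_mem measurableSet_Ioo] with x hx
    rw [Complex.norm_real]
    exact hD x hx
  refine ⟨h1.toLp _, fun c d hc hcd hd' ↦ ?_, h1.coeFn_toLp, (memLp_congr_ae ?_).1 h2⟩
  · have hsub : uIcc c d ⊆ Ioo a b := by
      rw [uIcc_of_le hcd]
      exact Icc_subset_Ioo hc hd'
    exact AbsolutelyContinuousOnInterval.of_hasDerivAt (fun x hx ↦ hd x (hsub hx))
      (Complex.continuous_ofReal.comp_continuousOn (hF'.mono hsub))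
  · filter_upwards [ae_restrict_mem measurableSet_Ioo] with x hx
    rw [firstOrder, (hd x hx).deriv]
    push_cast
    ring

theorem memLp_rpow_Ioo {r ℓ : ℝ} (hr : -1 / 2 < r) (hℓ : 0 < ℓ) :
    MemLp (fun t : ℝ ↦ t ^ r) 2 (volume.restrict (Ioo 0 ℓ)) := by
  have hc : ContinuousOn (fun t : ℝ ↦ t ^ r) (Ioo 0 ℓ) := fun t ht ↦
    (Real.continuousAt_rpow_const t r (Or.inl ht.1.ne')).continuousWithinAt
  rw [memLp_two_iff_integrable_sq (hc.aestronglyMeasurable measurableSet_Ioo)]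
  have h := (intervalIntegral.intervalIntegrable_rpow' (a := 0) (b := ℓ) (r := r * 2)
    (by linarith))
  rw [intervalIntegrable_iff_integrableOn_Ioo_of_le hℓ.le] at h
  refine h.congr_fun (fun t ht ↦ ?_) measurableSet_Ioo
  simp only
  rw [Real.rpow_mul ht.1.le]
  norm_cast

/-- For `t < 1` and `s ≤ 0` one has `t^(s+1/2) ≥ √t`, and for `t < ℓ / 2` the linear factor exceeds
`ℓ / 2`. The constant `ℓ / 4` therefore contradicts smallness. -/
theorem not_isLittleO_sqrt_rpow_mul {s ℓ : ℝ} (hs : s ≤ 0) (hℓ : 0 < ℓ) :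
    ¬ (fun t : ℝ ↦ ((t ^ (s + 1 / 2) * (ℓ - t) : ℝ) : ℂ)) =o[𝓝[>] 0] Real.sqrt := by
  intro h
  have h1 := h.bound (show 0 < ℓ / 4 by positivity)
  have hm1 : ∀ᶠ t in 𝓝[>] (0 : ℝ), t ∈ Ioo 0 1 := Ioo_mem_nhdsGT one_pos
  have hm2 : ∀ᶠ t in 𝓝[>] (0 : ℝ), t ∈ Ioo 0 (ℓ / 2) := Ioo_mem_nhdsGT (half_pos hℓ)
  obtain ⟨t, ht, ht1, ht2⟩ := (h1.and (hm1.and hm2)).exists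
  have h2 : Real.sqrt t ≤ t ^ (s + 1 / 2) := by
    rw [Real.sqrt_eq_rpow]
    exact Real.rpow_le_rpow_of_exponent_ge ht1.1 ht1.2.le (by linarith)
  have h3 : 0 < Real.sqrt t := Real.sqrt_pos.2 ht1.1
  rw [Complex.norm_real, Real.norm_of_nonneg h3.le, Real.norm_of_nonneg
    (mul_nonneg (h3.le.trans h2) (by linarith [ht2.2]))] at ht
  nlinarith [ht2.2, mul_le_mul h2 (show ℓ / 2 ≤ ℓ - t by linarith [ht2.2]) (by positivity)
    (h3.le.trans h2), mul_pos h3 hℓ]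

theorem isLittleO_sqrt_rpow_mul (r : ℝ) {ℓ : ℝ} (hℓ : 0 < ℓ) :
    (fun t : ℝ ↦ (((ℓ - t) ^ r * t : ℝ) : ℂ)) =o[𝓝[>] 0] Real.sqrt := by
  rw [isLittleO_iff_tendsto_div
    (by filter_upwards [self_mem_nhdsWithin] with t ht using Real.sqrt_pos.2 ht)]
  have h1 : ContinuousAt (fun t : ℝ ↦ (((ℓ - t) ^ r * Real.sqrt t : ℝ) : ℂ)) 0 := by
    refine Complex.continuous_ofReal.continuousAt.comp (ContinuousAt.mul ?_
      Real.continuous_sqrt.continuousAt)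
    exact ContinuousAt.rpow_const (by fun_prop) (Or.inl (by simpa using hℓ.ne'))
  have h2 := h1.tendsto.mono_left (nhdsWithin_le_nhds (s := Ioi (0 : ℝ)))
  simp only [Real.sqrt_zero, mul_zero, Complex.ofReal_zero] at h2
  refine h2.congr' ?_
  filter_upwards [self_mem_nhdsWithin] with t ht
  have h3 : ((Real.sqrt t : ℝ) : ℂ) ≠ 0 := by exact_mod_cast (Real.sqrt_pos.2 ht).ne'
  rw [eq_div_iff h3, ← Complex.ofReal_mul, mul_assoc, Real.mul_self_sqrt (le_of_lt ht)]

/-- The substitution `x ↦ -x` exchanges the endpoints and their parameters, so a witness at the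
right endpoint comes from one at the left. -/
theorem IsBesselPotential.reflect (hφ : IsBesselPotential a b sa sb δ φ) :
    IsBesselPotential (-b) (-a) sb sa δ (fun x ↦ -φ (-x)) where
  pos := hφ.pos
  lt := by linarith [hφ.lt]
  continuousOn := (hφ.continuousOn.comp continuousOn_neg
    fun x hx ↦ ⟨by linarith [hx.2], by linarith [hx.1]⟩).neg
  left := fun x hx ↦ by
    rw [hφ.right _ ⟨by linarith [hx.2], by linarith [hx.1]⟩]
    ring_nf
  right := fun x hx ↦ by
    rw [hφ.left _ ⟨by linarith [hx.2], by linarith [hx.1]⟩, neg_neg]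
    ring_nf

/-- This is `f' + φ f` divided by `(x - a)^(sa+1/2)` for `f = (x - a)^(sa+1/2) (b - x)`. Near `a`
the poles cancel exactly and leave `-1`; near `b` the factor `b - x` cancels the pole of `φ`. -/
theorem IsBesselPotential.exists_bound_witness (hφ : IsBesselPotential a b sa sb δ φ) :
    ∃ D, ∀ x ∈ Ioo a b, |(sa + 1 / 2) * (x - a)⁻¹ * (b - x) - 1 + φ x * (b - x)| ≤ D := by
  obtain ⟨K, hK0, hK⟩ := hφ.exists_bound
  have hδ := hφ.pos
  have hab := hφ.a_lt_b
  refine ⟨2 * (|sa + 1 / 2| * δ⁻¹ * (b - a)) + 1 + K * (b - a) + |sb + 1 / 2|, fun x hx ↦ ?_⟩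
  have h1 : 0 < x - a := sub_pos.2 hx.1
  have h2 : 0 < b - x := sub_pos.2 hx.2
  have h3 : 0 ≤ |sa + 1 / 2| * δ⁻¹ * (b - a) :=
    mul_nonneg (by positivity) (sub_pos.2 hab).le
  have h4 : 0 ≤ K * (b - a) := mul_nonneg hK0 (sub_pos.2 hab).le
  have h5 := abs_nonneg (sb + 1 / 2)
  rcases lt_or_ge x (a + δ) with hxδ | hxδ
  · have h6 : (sa + 1 / 2) * (x - a)⁻¹ * (b - x) - 1 + φ x * (b - x) = -1 := by
      rw [hφ.left x ⟨hx.1, hxδ⟩]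
      ring
    rw [h6, abs_neg, abs_one]
    linarith
  · have h6 : (x - a)⁻¹ ≤ δ⁻¹ := inv_anti₀ hδ (by linarith)
    have h7 : |sa + 1 / 2| * (x - a)⁻¹ * (b - x) ≤ |sa + 1 / 2| * δ⁻¹ * (b - a) := by
      gcongr
      exact hx.1.le
    have h8 : |φ x| * (b - x) ≤
        K * (b - a) + |sa + 1 / 2| * δ⁻¹ * (b - a) + |sb + 1 / 2| := by
      calc |φ x| * (b - x)
          ≤ (K + |sa + 1 / 2| * (x - a)⁻¹ + |sb + 1 / 2| * (b - x)⁻¹) * (b - x) := by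
            gcongr
            exact hK x hx
        _ = K * (b - x) + |sa + 1 / 2| * (x - a)⁻¹ * (b - x) + |sb + 1 / 2| := by
            field_simp
        _ ≤ _ := by
            have h9 : K * (b - x) ≤ K * (b - a) := by
              gcongr
              exact hx.1.le
            linarith
    calc |(sa + 1 / 2) * (x - a)⁻¹ * (b - x) - 1 + φ x * (b - x)|
        ≤ |(sa + 1 / 2) * (x - a)⁻¹ * (b - x)| + |(1 : ℝ)| + |φ x * (b - x)| :=
          (abs_add_le _ _).trans (add_le_add_left (abs_sub _ _) _)
      _ = |sa + 1 / 2| * (x - a)⁻¹ * (b - x) + 1 + |φ x| * (b - x) := by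
          rw [abs_mul, abs_mul, abs_mul, abs_of_pos h2, abs_of_pos (inv_pos.2 h1), abs_one]
      _ ≤ _ := by linarith

/-- For `-1 < sa ≤ 0`, some element of the maximal domain is not `o(√·)` at the left endpoint. -/
theorem IsBesselPotential.exists_not_sqrtLeft (hφ : IsBesselPotential a b sa sb δ φ)
    (hs : -1 < sa) (hs' : sa ≤ 0) :
    ∃ (u : L2 a b) (f : ℝ → ℂ), MaxRep a b φ u f ∧ ¬ SqrtLeft a f ∧ SqrtRight b f := by
  have hab := hφ.a_lt_b
  obtain ⟨D, hD⟩ := hφ.exists_bound_witness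
  have hcont : ContinuousOn (fun x ↦ (x - a) ^ (sa + 1 / 2)) (Ioo a b) :=
    (continuousOn_id.sub continuousOn_const).rpow_const
      fun x hx ↦ Or.inl (sub_pos.2 hx.1).ne'
  -- Square integrability at `a` requires `2 sa + 1 > -1`, which is the hypothesis `-1 < sa`.
  have hP : MemLp (fun x ↦ (x - a) ^ (sa + 1 / 2)) 2 (volume.restrict (Ioo a b)) := by
    have h := MemLp_comp_affine (p := -a) (Or.inl rfl) measurableSet_Ioo (S := Ioo a b)
      (fun t ht ↦ (⟨by linarith [ht.1], by linarith [ht.2]⟩ : -a + 1 * t ∈ Ioo 0 (b - a)))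
      (memLp_rpow_Ioo (r := sa + 1 / 2) (by linarith) (sub_pos.2 hab))
    convert h using 3 with x
    ring
  have hder : ∀ x ∈ Ioo a b, HasDerivAt (fun x ↦ (x - a) ^ (sa + 1 / 2) * (b - x))
      ((x - a) ^ (sa + 1 / 2) * ((sa + 1 / 2) * (x - a)⁻¹ * (b - x) - 1)) x := fun x hx ↦ by
    have h1 := sub_pos.2 hx.1
    refine ((((hasDerivAt_id' x).sub_const a).rpow_const (p := sa + 1 / 2)
      (Or.inl h1.ne')).fun_mul ((hasDerivAt_id' x).const_sub b)).congr_deriv ?_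
    rw [Real.rpow_sub_one h1.ne']
    ring
  have hbound : ∀ x ∈ Ioo a b, |(x - a) ^ (sa + 1 / 2) * (b - x)| ≤
      (b - a) * (x - a) ^ (sa + 1 / 2) := fun x hx ↦ by
    have h1 := Real.rpow_nonneg (sub_pos.2 hx.1).le (sa + 1 / 2)
    rw [abs_mul, abs_of_nonneg h1, abs_of_pos (sub_pos.2 hx.2), mul_comm]
    gcongr
    exact hx.1.le
  have hbound' : ∀ x ∈ Ioo a b,
      |(x - a) ^ (sa + 1 / 2) * ((sa + 1 / 2) * (x - a)⁻¹ * (b - x) - 1) +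
        φ x * ((x - a) ^ (sa + 1 / 2) * (b - x))| ≤ D * (x - a) ^ (sa + 1 / 2) := fun x hx ↦ by
    have h1 := Real.rpow_nonneg (sub_pos.2 hx.1).le (sa + 1 / 2)
    have h2 : (x - a) ^ (sa + 1 / 2) * ((sa + 1 / 2) * (x - a)⁻¹ * (b - x) - 1) +
        φ x * ((x - a) ^ (sa + 1 / 2) * (b - x)) = (x - a) ^ (sa + 1 / 2) *
          ((sa + 1 / 2) * (x - a)⁻¹ * (b - x) - 1 + φ x * (b - x)) := by ring
    rw [h2, abs_mul, abs_of_nonneg h1, mul_comm]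
    gcongr
    exact hD x hx
  obtain ⟨u, hu⟩ := exists_maxRep_of_bound hφ.continuousOn hder
    (hcont.mul (((continuousOn_const.mul ((continuousOn_id.sub continuousOn_const).inv₀
      fun x hx ↦ (sub_pos.2 hx.1).ne')).mul (continuousOn_const.sub continuousOn_id)).sub
      continuousOn_const)) hP hbound hbound'
  refine ⟨u, _, hu, fun h ↦ ?_, sqrtRight_iff.2 ?_⟩
  · refine not_isLittleO_sqrt_rpow_mul hs' (sub_pos.2 hab) ?_
    refine (sqrtLeft_iff.1 h).congr_left fun t ↦ ?_
    rw [show a + 1 * t - a = t by ring, show b - (a + 1 * t) = b - a - t by ring]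
  · refine (isLittleO_sqrt_rpow_mul (sa + 1 / 2) (sub_pos.2 hab)).congr_left fun t ↦ ?_
    rw [show b + -1 * t - a = b - a - t by ring, show b - (b + -1 * t) = t by ring]

theorem MaxRep.exists_reflect {v : L2 (-b) (-a)} {g : ℝ → ℂ}
    (hg : MaxRep (-b) (-a) (fun x ↦ -φ (-x)) v g) :
    ∃ u : L2 a b, MaxRep a b φ u (fun x ↦ g (0 + -1 * x)) := by
  have hm : MapsTo (fun x : ℝ ↦ 0 + -1 * x) (Ioo a b) (Ioo (-b) (-a)) := fun x hx ↦
    ⟨by linarith [hx.2], by linarith [hx.1]⟩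
  have h1 := MemLp_comp_affine (Or.inr rfl) measurableSet_Ioo hm hg.memLp_rep
  refine ⟨h1.toLp _, fun c d hc hcd hd ↦ ?_, h1.coeFn_toLp, ?_⟩
  · exact AbsolutelyContinuousOnInterval.comp_affine (by norm_num)
      (hg.acLoc.absolutelyContinuousOnInterval (hm ⟨hc, hcd.trans_lt hd⟩)
        (hm ⟨hc.trans_le hcd, hd⟩))
  · have h2 := (MemLp_comp_affine (Or.inr rfl) measurableSet_Ioo hm hg.memLp).const_mul
      ((-1 : ℝ) : ℂ)
    refine h2.ae_eq (.of_forall fun x ↦ ?_)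
    refine (firstOrder_comp_affine ?_).symm
    simp

/-- For `-1 < sb ≤ 0`, some element of the maximal domain is not `o(√·)` at the right endpoint. -/
theorem IsBesselPotential.exists_not_sqrtRight (hφ : IsBesselPotential a b sa sb δ φ)
    (hs : -1 < sb) (hs' : sb ≤ 0) :
    ∃ (u : L2 a b) (f : ℝ → ℂ), MaxRep a b φ u f ∧ SqrtLeft a f ∧ ¬ SqrtRight b f := by
  obtain ⟨v, g, hg, hl, hr⟩ := hφ.reflect.exists_not_sqrtLeft hs hs'
  obtain ⟨u, hu⟩ := hg.exists_reflect
  rw [sqrtLeft_iff] at hl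
  rw [sqrtRight_iff] at hr
  refine ⟨u, _, hu, sqrtLeft_iff.2 (hr.congr_left fun t ↦ ?_), fun h ↦ hl ?_⟩
  · congr 1
    ring
  · refine (sqrtRight_iff.1 h).congr_left fun t ↦ ?_
    congr 1
    ring

end Witness

/-! ### Descriptions of the minimal domain. -/

section Domain

variable {a b sa sb δ : ℝ} {φ : ℝ → ℝ}

theorem MaxRep.eqOn {u : L2 a b} {f g : ℝ → ℂ} (hf : MaxRep a b φ u f)
    (hg : MaxRep a b φ u g) : EqOn f g (Ioo a b) :=
  Measure.eqOn_open_of_ae_eq (hf.ae_eq.symm.trans hg.ae_eq) isOpen_Ioo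
    hf.acLoc.continuousOn hg.acLoc.continuousOn

theorem MaxRep.sqrtLeft_congr (hab : a < b) {u : L2 a b} {f g : ℝ → ℂ} (hf : MaxRep a b φ u f)
    (hg : MaxRep a b φ u g) (h : SqrtLeft a f) : SqrtLeft a g := by
  refine Tendsto.congr' ?_ h
  filter_upwards [Ioo_mem_nhdsGT hab] with x hx
  rw [hf.eqOn hg hx]

theorem MaxRep.sqrtRight_congr (hab : a < b) {u : L2 a b} {f g : ℝ → ℂ} (hf : MaxRep a b φ u f)
    (hg : MaxRep a b φ u g) (h : SqrtRight b f) : SqrtRight b g := by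
  refine Tendsto.congr' ?_ h
  filter_upwards [Ioo_mem_nhdsLT hab] with x hx
  rw [hf.eqOn hg hx]

theorem MaxRep.logLeft (hφ : IsBesselPotential a b 0 sb δ φ) {u : L2 a b} {f : ℝ → ℂ}
    (hf : MaxRep a b φ u f) {R : ℝ} (hR : 0 < R) : LogLeft a R f :=
  (logLeft_iff hR).2 ((hf.isLocalSol_left hφ).isLittleO_sqrt_log hR)

theorem MaxRep.logRight (hφ : IsBesselPotential a b sa 0 δ φ) {u : L2 a b} {f : ℝ → ℂ}
    (hf : MaxRep a b φ u f) {R : ℝ} (hR : 0 < R) : LogRight b R f :=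
  (logRight_iff hR).2 ((hf.isLocalSol_right hφ).isLittleO_sqrt_log hR)

theorem LogLeft.vanishesLeft {f : ℝ → ℂ} {R : ℝ} (hR : 0 < R) (h : LogLeft a R f) :
    VanishesLeft a f :=
  vanishesLeft_iff.2 (tendsto_zero_of_isLittleO_sqrt_log hR ((logLeft_iff hR).1 h))

theorem LogRight.vanishesRight {f : ℝ → ℂ} {R : ℝ} (hR : 0 < R) (h : LogRight b R f) :
    VanishesRight b f :=
  vanishesRight_iff.2 (tendsto_zero_of_isLittleO_sqrt_log hR ((logRight_iff hR).1 h))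

theorem SqrtLeft.vanishesLeft {f : ℝ → ℂ} (h : SqrtLeft a f) : VanishesLeft a f :=
  vanishesLeft_iff.2 (tendsto_zero_of_isLittleO_sqrt (sqrtLeft_iff.1 h))

theorem SqrtRight.vanishesRight {f : ℝ → ℂ} (h : SqrtRight b f) : VanishesRight b f :=
  vanishesRight_iff.2 (tendsto_zero_of_isLittleO_sqrt (sqrtRight_iff.1 h))

theorem MaxRep.sqrtLeft_of_vanishesLeft (hφ : IsBesselPotential a b sa sb δ φ) {u : L2 a b}
    {f : ℝ → ℂ} (hf : MaxRep a b φ u f) (hs : sa ≤ -1 / 2 ∨ 0 < sa) (h : VanishesLeft a f) :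
    SqrtLeft a f :=
  sqrtLeft_iff.2 ((hf.isLocalSol_left hφ).isLittleO_sqrt_of_tendsto_zero
    (vanishesLeft_iff.1 h) hs)

theorem MaxRep.sqrtRight_of_vanishesRight (hφ : IsBesselPotential a b sa sb δ φ) {u : L2 a b}
    {f : ℝ → ℂ} (hf : MaxRep a b φ u f) (hs : sb ≤ -1 / 2 ∨ 0 < sb) (h : VanishesRight b f) :
    SqrtRight b f :=
  sqrtRight_iff.2 ((hf.isLocalSol_right hφ).isLittleO_sqrt_of_tendsto_zero
    (vanishesRight_iff.1 h) hs)

/-- Membership in the minimal domain is decided by the behaviour at the endpoints with nonzero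
parameter. -/
theorem MaxRep.mem_minOp_domain_iff (hφ : IsBesselPotential a b sa sb δ φ) {u : L2 a b}
    {f : ℝ → ℂ} (hf : MaxRep a b φ u f) :
    u ∈ (minOp a b φ).domain ↔ (sa ≠ 0 → SqrtLeft a f) ∧ (sb ≠ 0 → SqrtRight b f) := by
  refine ⟨fun h ↦ ?_, fun h ↦ hf.mem_minOp_domain hφ.a_lt_b hφ.continuousOn one_pos one_pos ?_ ?_⟩
  · obtain ⟨g, hg, hl, hr⟩ := exists_maxRep_sqrt_of_mem_minOp hφ h
    exact ⟨fun hs ↦ hg.sqrtLeft_congr hφ.a_lt_b hf (hl hs),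
      fun hs ↦ hg.sqrtRight_congr hφ.a_lt_b hf (hr hs)⟩
  -- At a zero parameter the logarithmic bound holds on the whole maximal domain, so no condition is
  -- required there; at a nonzero parameter the `√t` bound implies the logarithmic one.
  · rcases eq_or_ne sa 0 with hs | hs
    · exact ((hs ▸ hf.isLocalSol_left hφ : IsLocalSol 0 δ _).isLittleO_sqrt_log one_pos).isBigO
    · exact isBigO_sqrt_log_of_isBigO_sqrt (sqrtLeft_iff.1 (h.1 hs)).isBigO
  · rcases eq_or_ne sb 0 with hs | hs
    · exact ((hs ▸ hf.isLocalSol_right hφ : IsLocalSol 0 δ _).isLittleO_sqrt_log one_pos).isBigO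
    · exact isBigO_sqrt_log_of_isBigO_sqrt (sqrtRight_iff.1 (h.2 hs)).isBigO

theorem mem_minOp_domain_iff_exists (hφ : IsBesselPotential a b sa sb δ φ) {u : L2 a b} :
    u ∈ (minOp a b φ).domain ↔
      ∃ f, MaxRep a b φ u f ∧ (sa ≠ 0 → SqrtLeft a f) ∧ (sb ≠ 0 → SqrtRight b f) :=
  ⟨exists_maxRep_sqrt_of_mem_minOp hφ, fun ⟨_, hf, h⟩ ↦ (hf.mem_minOp_domain_iff hφ).2 h⟩

/-- The minimal domain is cut out by any endpoint condition equivalent to the `o(√·)` behaviour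
at the endpoints with nonzero parameter. -/
theorem minOp_domain_eq_setOf (hφ : IsBesselPotential a b sa sb δ φ) {bc : (ℝ → ℂ) → Prop}
    (h : ∀ (u : L2 a b) (f : ℝ → ℂ), MaxRep a b φ u f →
      (bc f ↔ (sa ≠ 0 → SqrtLeft a f) ∧ (sb ≠ 0 → SqrtRight b f))) :
    ((minOp a b φ).domain : Set (L2 a b)) = {u | ∃ f, MaxRep a b φ u f ∧ bc f} := by
  ext u
  rw [SetLike.mem_coe, mem_minOp_domain_iff_exists hφ]
  exact exists_congr fun f ↦ and_congr_right fun hf ↦ (h u f hf).symm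

theorem minOp_domain_eq_H01 (hφ : IsBesselPotential a b sa sb δ φ) (ha : sa ≠ 0) (hb : sb ≠ 0) :
    ((minOp a b φ).domain : Set (L2 a b)) = H01 a b := by
  ext u
  rw [SetLike.mem_coe, mem_minOp_domain_iff_exists hφ]
  constructor
  · rintro ⟨f, hf, hl, hr⟩
    exact hf.mem_H01 hφ ha hb (hl ha) (hr hb)
  · intro hu
    obtain ⟨f, hf, hl, hr⟩ := exists_maxRep_sqrt_of_mem_H01 hφ hu
    exact ⟨f, hf, fun _ ↦ hl, fun _ ↦ hr⟩

theorem H01_subset_minOp_domain (hφ : IsBesselPotential a b sa sb δ φ) :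
    H01 a b ⊆ ((minOp a b φ).domain : Set (L2 a b)) := fun u hu ↦ by
  obtain ⟨f, hf, hl, hr⟩ := exists_maxRep_sqrt_of_mem_H01 hφ hu
  exact (hf.mem_minOp_domain_iff hφ).2 ⟨fun _ ↦ hl, fun _ ↦ hr⟩

/-- At an endpoint with parameter `0` the minimal domain imposes nothing, while elements of `H01`
are still `o(√t)` there. The witness, well behaved at the other endpoint, separates the two. -/
theorem H01_ssubset_minOp_domain (hφ : IsBesselPotential a b sa sb δ φ) (h : sa = 0 ∨ sb = 0) :
    H01 a b ⊂ ((minOp a b φ).domain : Set (L2 a b)) := by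
  refine ⟨H01_subset_minOp_domain hφ, fun hsub ↦ ?_⟩
  rcases h with h | h
  · obtain ⟨u, f, hf, hl, hr⟩ := hφ.exists_not_sqrtLeft (by linarith) h.le
    obtain ⟨g, hg, hgl, -⟩ := exists_maxRep_sqrt_of_mem_H01 hφ
      (hsub ((hf.mem_minOp_domain_iff hφ).2 ⟨fun hs ↦ absurd h hs, fun _ ↦ hr⟩))
    exact hl (hg.sqrtLeft_congr hφ.a_lt_b hf hgl)
  · obtain ⟨u, f, hf, hl, hr⟩ := hφ.exists_not_sqrtRight (by linarith) h.le
    obtain ⟨g, hg, -, hgr⟩ := exists_maxRep_sqrt_of_mem_H01 hφ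
      (hsub ((hf.mem_minOp_domain_iff hφ).2 ⟨fun _ ↦ hl, fun hs ↦ absurd h hs⟩))
    exact hr (hg.sqrtRight_congr hφ.a_lt_b hf hgr)

/-- For these parameters the endpoint condition is either automatic on the maximal domain or, at
parameter `0`, absent. -/
theorem minOp_eq_maxOp_of_param (hφ : IsBesselPotential a b sa sb δ φ) (ha : sa ≤ -1 ∨ 0 ≤ sa)
    (hb : sb ≤ -1 ∨ 0 ≤ sb) : minOp a b φ = maxOp a b φ := by
  refine minOp_eq_maxOp hφ.a_lt_b hφ.continuousOn ?_
  rintro u ⟨f, hf⟩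
  exact (hf.mem_minOp_domain_iff hφ).2
    ⟨fun h ↦ hf.sqrtLeft hφ (ha.imp_right fun h' ↦ h'.lt_of_ne' h),
      fun h ↦ hf.sqrtRight hφ (hb.imp_right fun h' ↦ h'.lt_of_ne' h)⟩

theorem minOp_domain_ssubset_maxOp_domain (hφ : IsBesselPotential a b sa sb δ φ)
    (h : sa ∈ Ioo (-1 : ℝ) 0 ∨ sb ∈ Ioo (-1 : ℝ) 0) :
    ((minOp a b φ).domain : Set (L2 a b)) ⊂ ((maxOp a b φ).domain : Set (L2 a b)) := by
  refine ⟨(minOp_le_maxOp hφ.a_lt_b hφ.continuousOn).1, fun hsub ↦ ?_⟩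
  rcases h with h | h
  · obtain ⟨u, f, hf, hl, -⟩ := hφ.exists_not_sqrtLeft h.1 h.2.le
    exact hl (((hf.mem_minOp_domain_iff hφ).1 (hsub ⟨f, hf⟩)).1 h.2.ne)
  · obtain ⟨u, f, hf, -, hr⟩ := hφ.exists_not_sqrtRight h.1 h.2.le
    exact hr (((hf.mem_minOp_domain_iff hφ).1 (hsub ⟨f, hf⟩)).2 h.2.ne)

end Domain

end BesselType

/-! ### Assembly of the theorem. -/

theorem theorem3p6 (a b : ℝ) (hab : a < b) (ε : ℝ) (hε : 0 < ε) (hε' : ε < (b - a) / 2)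
    (χa χb : ℝ → ℝ) (hχ : IsCutoffPair a b ε χa χb) (sa sb : ℝ) :
    -- the preminimal operator is closable, so that its closure is an operator
    (AdotMin a b sa sb χa χb).IsClosable ∧
    -- (i)
    (sa ≠ 0 → sb ≠ 0 → ((Amin a b sa sb χa χb).domain : Set (L2 a b)) = H01 a b) ∧
    -- (ii)
    (((sa = 0 ∧ sb ≠ 0) ∨ (sa ≠ 0 ∧ sb = 0)) →
      (Amin a b sa sb χa χb).HasCore (testFunctions a b) ∧
      H01 a b ⊂ ((Amin a b sa sb χa χb).domain : Set (L2 a b))) ∧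
    (sa = 0 → sb ≠ 0 →
      (∀ R : ℝ, 0 < R → ((Amin a b sa sb χa χb).domain : Set (L2 a b)) =
        domainWith a b sa sb χa χb (fun f ↦ LogLeft a R f ∧ SqrtRight b f)) ∧
      (sb ∉ Ioo (-1 / 2 : ℝ) 0 → ((Amin a b sa sb χa χb).domain : Set (L2 a b)) =
        domainWith a b sa sb χa χb (fun f ↦ VanishesLeft a f ∧ VanishesRight b f)) ∧
      (sb ∉ Ioo (-1 : ℝ) 0 → Amin a b sa sb χa χb = Amax a b sa sb χa χb)) ∧
    (sa ≠ 0 → sb = 0 →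
      (∀ R : ℝ, 0 < R → ((Amin a b sa sb χa χb).domain : Set (L2 a b)) =
        domainWith a b sa sb χa χb (fun f ↦ SqrtLeft a f ∧ LogRight b R f)) ∧
      (sa ∉ Ioo (-1 / 2 : ℝ) 0 → ((Amin a b sa sb χa χb).domain : Set (L2 a b)) =
        domainWith a b sa sb χa χb (fun f ↦ VanishesLeft a f ∧ VanishesRight b f)) ∧
      (sa ∉ Ioo (-1 : ℝ) 0 → Amin a b sa sb χa χb = Amax a b sa sb χa χb)) ∧
    -- (iii)
    (sa ∈ Iic (-1 : ℝ) ∪ Ioi 0 → sb ∈ Iic (-1 : ℝ) ∪ Ioi 0 →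
      ((Amax a b sa sb χa χb).domain : Set (L2 a b)) =
        domainWith a b sa sb χa χb (fun _ ↦ True) ∧
      ((Amax a b sa sb χa χb).domain : Set (L2 a b)) =
        domainWith a b sa sb χa χb (fun f ↦ VanishesLeft a f ∧ VanishesRight b f) ∧
      ((Amax a b sa sb χa χb).domain : Set (L2 a b)) =
        domainWith a b sa sb χa χb (fun f ↦ SqrtLeft a f ∧ SqrtRight b f) ∧
      ((Amax a b sa sb χa χb).domain : Set (L2 a b)) =
        ((Amin a b sa sb χa χb).domain : Set (L2 a b)) ∧
      ((Amax a b sa sb χa χb).domain : Set (L2 a b)) = H01 a b) ∧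
    (sa ∈ Iic (-1 : ℝ) ∪ Ici 0 → sb ∈ Iic (-1 : ℝ) ∪ Ici 0 →
      Amax a b sa sb χa χb = Amin a b sa sb χa χb) ∧
    -- (iv)
    ((sa ∈ Ioo (-1 : ℝ) 0 ∨ sb ∈ Ioo (-1 : ℝ) 0) →
      ((Amin a b sa sb χa χb).domain : Set (L2 a b)) ⊂
        ((Amax a b sa sb χa χb).domain : Set (L2 a b)) ∧
      (sa ≠ 0 → sb ≠ 0 → H01 a b = ((Amin a b sa sb χa χb).domain : Set (L2 a b)))) := by
  have hφ := isBesselPotential_potential hε hε' hχ sa sb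
  have hout : ∀ {c s : ℝ}, s ≠ 0 → s ∉ Ioo c 0 → s ≤ c ∨ 0 < s := fun {c s} h0 hs ↦ by
    by_contra! h
    exact hs ⟨h.1, h.2.lt_of_ne h0⟩
  have hle : ∀ {s : ℝ}, s ≤ -1 ∨ 0 < s → s ≤ -1 ∨ 0 ≤ s := fun h ↦ h.imp_right le_of_lt
  have hne : ∀ {s : ℝ}, s ≤ -1 ∨ 0 < s → s ≠ 0 := fun h h0 ↦ by
    rcases h with h | h <;> linarith
  refine ⟨preMinOp_isClosable hab hφ.continuousOn, fun ha hb ↦ minOp_domain_eq_H01 hφ ha hb,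
    fun h ↦ ⟨minOp_hasCore_testFunctions hab hφ.continuousOn,
      H01_ssubset_minOp_domain hφ (h.imp And.left And.right)⟩,
    fun ha hb ↦ ⟨fun R hR ↦ minOp_domain_eq_setOf hφ fun u f hf ↦ ?_,
      fun hb' ↦ minOp_domain_eq_setOf hφ fun u f hf ↦ ?_,
      fun hb' ↦ minOp_eq_maxOp_of_param hφ (Or.inr ha.ge) (hle (hout hb hb'))⟩,
    fun ha hb ↦ ⟨fun R hR ↦ minOp_domain_eq_setOf hφ fun u f hf ↦ ?_,
      fun ha' ↦ minOp_domain_eq_setOf hφ fun u f hf ↦ ?_,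
      fun ha' ↦ minOp_eq_maxOp_of_param hφ (hle (hout ha ha')) (Or.inr hb.ge)⟩,
    fun ha hb ↦ ?_, fun ha hb ↦ (minOp_eq_maxOp_of_param hφ ha hb).symm,
    fun h ↦ ⟨minOp_domain_ssubset_maxOp_domain hφ h,
      fun ha hb ↦ (minOp_domain_eq_H01 hφ ha hb).symm⟩⟩
  · subst ha
    exact ⟨fun h ↦ ⟨fun h0 ↦ absurd rfl h0, fun _ ↦ h.2⟩, fun h ↦ ⟨hf.logLeft hφ hR, h.2 hb⟩⟩
  · subst ha
    exact ⟨fun h ↦ ⟨fun h0 ↦ absurd rfl h0,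
      fun _ ↦ hf.sqrtRight_of_vanishesRight hφ (hout hb hb') h.2⟩,
      fun h ↦ ⟨(hf.logLeft hφ one_pos).vanishesLeft one_pos, (h.2 hb).vanishesRight⟩⟩
  · subst hb
    exact ⟨fun h ↦ ⟨fun _ ↦ h.1, fun h0 ↦ absurd rfl h0⟩, fun h ↦ ⟨h.1 ha, hf.logRight hφ hR⟩⟩
  · subst hb
    exact ⟨fun h ↦ ⟨fun _ ↦ hf.sqrtLeft_of_vanishesLeft hφ (hout ha ha') h.1,
      fun h0 ↦ absurd rfl h0⟩,
      fun h ↦ ⟨(h.1 ha).vanishesLeft, (hf.logRight hφ one_pos).vanishesRight one_pos⟩⟩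
  · have hl : ∀ (u : L2 a b) (f : ℝ → ℂ), MaxRep a b (potential a b sa sb χa χb) u f →
        SqrtLeft a f := fun u f hf ↦ hf.sqrtLeft hφ ha
    have hr : ∀ (u : L2 a b) (f : ℝ → ℂ), MaxRep a b (potential a b sa sb χa χb) u f →
        SqrtRight b f := fun u f hf ↦ hf.sqrtRight hφ hb
    have hEq : Amin a b sa sb χa χb = Amax a b sa sb χa χb :=
      minOp_eq_maxOp_of_param hφ (hle ha) (hle hb)
    -- Once the two operators coincide, each description of the maximal domain is one of the minimal
    -- domain, and every boundary condition involved holds for all representatives.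
    rw [← hEq]
    refine ⟨minOp_domain_eq_setOf hφ fun u f hf ↦ ?_, minOp_domain_eq_setOf hφ fun u f hf ↦ ?_,
      minOp_domain_eq_setOf hφ fun u f hf ↦ ?_, rfl, minOp_domain_eq_H01 hφ (hne ha) (hne hb)⟩
    · exact ⟨fun _ ↦ ⟨fun _ ↦ hl u f hf, fun _ ↦ hr u f hf⟩, fun _ ↦ trivial⟩
    · exact ⟨fun _ ↦ ⟨fun _ ↦ hl u f hf, fun _ ↦ hr u f hf⟩,
        fun _ ↦ ⟨(hl u f hf).vanishesLeft, (hr u f hf).vanishesRight⟩⟩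
    · exact ⟨fun _ ↦ ⟨fun _ ↦ hl u f hf, fun _ ↦ hr u f hf⟩, fun _ ↦ ⟨hl u f hf, hr u f hf⟩⟩
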